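/- **Setting.** There are $n\ge 1$ experts and $T$ days. An oblivious adversary fixes loss vectors $\ell_1,\dots,\ell_T\in[0,1]^n$. If an algorithm plays expert $i_t$ on day $t$, its regret is $\sum_{t=1}^T\ell_t(i_t)-\min_{e\in[n]}\sum_{t=1}^T\ell_t(e)$. **Hierarchical baseline algorithm.** Input: $k\ge1$, positive integer block sizes $T_0<T_1<\dots<T_k=T$ with $T_{i-1}\mid T_i$ for $1\le i\le k$, and a space parameter $m\ge 1$. Let $\epsilon=\log(T)/m$. The algorithm keeps buckets $B_0,\dots,B_{k-1}$ (initially empty) of entries (expert, arrival time, loss since arrival, weight), where one expert may have several entries, and for each $1\le i\le k-1$ a pair of external weights $(w_i,w_i')$, initially $(1,1)$. An entry $e'$ *$\epsilon$-dominates* an entry $e$ if $e'$ arrived before $e$ and the loss of $e'$ is at most $(1+\epsilon)$ times the loss of $e$. *Bucket update at time $t$.* Let $k'=\max\{i\le k-1: T_i\mid t\}$ and $\tau=\max\{t'\le t: T_{k'+1}\mid t'\}$. (1) For each $i\le k'$, remove simultaneously from $B_i$ all entries with arrival time at least $\tau+\frac12$ that are $\epsilon$-dominated by some entry of $B_i$;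 set the weights of the remaining entries of $B_i$ to $1$ and, if $i\ge1$, set $w_i=w_i'=1$. (2) For $i=k',k'-1,\dots,1$, add to $B_i$ a copy of every entry of $B_0,\dots,B_{i-1}$, with loss $0$, weight $1$ and distinct arrival times in $[t,t+\frac12)$. (3) For each $i\le k'$, add to $B_i$ entries for $m$ experts sampled independently and uniformly with replacement from $[n]$, with loss $0$, weight $1$ and distinct arrival times in $[t+\frac12,t+1)$. The distinct arrival times are chosen by an arbitrary fixed rule depending only on $t$, $i$ and the position of the new entry in the list of added entries. *Run.* Perform the bucket update at time $0$. On each day $t=1,\dots,T$: for each $i$ draw $e_i$ from $B_i$ with probability proportional to the weights; put $y_0=e_0$ and, for $i\ge1$, $y_i=e_i$ with probability $w_i/(w_i+w_i')$ and $y_i=y_{i-1}$ otherwise (all draws independent). Play $y_{k-1}$. Then add $\ell_t(e)$ to the loss of every entry of every bucket (with expert $e$), multiply the weight of every entry of $B_i$ by $\exp(-\sqrt{\log|B_i|/T_i}\;\ell_t(e))$, multiply $w_i$ by $\exp(-\sqrt{2/T_i}\;\ell_t(e_i))$ and $w_i'$ by $\exp(-\sqrt{2/T_i}\;\ell_t(y_{i-1}))$.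 If $T_0\mid t$, perform the bucket update at time $t$. **Theorem.** For all constants $\gamma>0$ and $a>0$ there are constants $C,K>0$ and $c\in\mathbb N$, depending only on $\gamma$ and $a$, such that for all $n,m,k\geq 1$ and block sizes as above with $m\le T^a$, every rule for the arrival times and every loss sequence $\ell_1,\dots,\ell_T\in[0,1]^n$, with probability at least $1-K\,T^{-\gamma}$ the regret of the hierarchical baseline algorithm is at most $$C(\log T)^c\left(\frac{T_k}{m}+\frac{T_k}{\sqrt{T_{k-1}}}+\frac nm\sum_{i=0}^{k-1}\frac{T_i}{\sqrt{T_{i-1}}}\right),\qquad\text{where } T_{-1}=1 .$$ -/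

import Mathlib

/-! The hierarchical baseline algorithm for the experts problem, as a probabilistic program in the
`PMF` monad. Experts are `Fin n`, days are `1, …, T`, buckets (levels) are `0, …, k - 1`, and the
block sizes are `Ts 0 < ⋯ < Ts k = T`; values of `Ts`, buckets and weights beyond these ranges are
never read. -/

namespace HierBaseline

noncomputable section

/-- A tuple (expert, arrival time, loss since arrival, internal weight) stored in a bucket. The same
expert may occur in several entries. -/
structure Entry (n : ℕ) where
  expert : Fin n
  arrival : ℝ
  loss : ℝ
  weight : ℝ

/-- The memory of the algorithm: the buckets and, for each `i`, the pair of external weights between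
levels `i` and `i + 1`: `big i` belongs to the pick of bucket `i + 1`, and `small i` to the
prediction of level `i`. -/
structure State (n : ℕ) where
  bucket : ℕ → List (Entry n)
  big : ℕ → ℝ
  small : ℕ → ℝ

/-- A choice of the unique arrival times: at time `t`, the `r`-th copy forwarded to bucket `i` gets
the arrival time `fwd t i r ∈ [t, t + 1/2)`, and the `r`-th new sample of bucket `i` gets
`smp t i r ∈ [t + 1/2, t + 1)`. -/
structure ArrivalRule where
  fwd : ℕ → ℕ → ℕ → ℝ
  smp : ℕ → ℕ → ℕ → ℝ
  fwd_injective : ∀ t i, Function.Injective (fwd t i)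
  smp_injective : ∀ t i, Function.Injective (smp t i)
  fwd_mem : ∀ t i r : ℕ, fwd t i r ∈ Set.Ico (t : ℝ) (t + 1 / 2)
  smp_mem : ∀ t i r : ℕ, smp t i r ∈ Set.Ico ((t : ℝ) + 1 / 2) (t + 1)

/-- `x'` `ε`-dominates `x`. -/
def Dominates {n : ℕ} (ε : ℝ) (x' x : Entry n) : Prop :=
  x'.arrival < x.arrival ∧ x'.loss ≤ (1 + ε) * x.loss

theorem sum_ofReal_ne_top {α : Type} (l : List (α × ℝ)) :
    ∑' j : Fin l.length, ENNReal.ofReal (l.get j).2 ≠ ⊤ := by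
  rw [tsum_fintype]
  exact ENNReal.sum_ne_top.2 fun _ _ => ENNReal.ofReal_ne_top

open Classical in
/-- Choose an item of the list with probability proportional to its weight. The value `d` is used
only if there is no item of positive weight, which does not happen in the algorithm. -/
def weightedChoice {α : Type} (d : α) (l : List (α × ℝ)) : PMF α :=
  if h : ∑' j : Fin l.length, ENNReal.ofReal (l.get j).2 ≠ 0 then
    (PMF.normalize (fun j : Fin l.length => ENNReal.ofReal (l.get j).2) h
      (sum_ofReal_ne_top l)).map fun j => (l.get j).1
  else PMF.pure d

/-- The random picks and predictions of the levels `0, …, i` on one day: the value at `j` is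
`(e_j, pred_j)`, where `e_j` is drawn from bucket `j` in proportion to the internal weights,
`pred_0 = e_0`, and `pred_(j+1)` is `e_(j+1)` or `pred_j`, chosen in proportion to the external
weights. (The values at levels above `i` are meaningless.) -/
def getPredictions {n : ℕ} [NeZero n] (s : State n) : ℕ → PMF (ℕ → Fin n × Fin n)
  | 0 => (weightedChoice 0 ((s.bucket 0).map fun x => (x.expert, x.weight))).map fun e _ => (e, e)
  | i + 1 =>
    (getPredictions s i).bind fun y =>
      (weightedChoice 0 ((s.bucket (i + 1)).map fun x => (x.expert, x.weight))).bind fun e =>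
        (weightedChoice e [(e, s.big i), ((y i).2, s.small i)]).map fun p =>
          Function.update y (i + 1) (e, p)

/-- Multiplicative weights updates after the losses `loss` of the day are observed. Bucket `i` runs
MWU over its entries with rate `√(log |B_i| / T_i)`. The external weights between the levels `i` and
`i + 1` run MWU with rate `√(2 / T_(i+1))` over two options: the pick of bucket `i + 1` and the
prediction of level `i`. -/
def updateWeights {n : ℕ} (Ts : ℕ → ℕ) (loss : Fin n → ℝ) (y : ℕ → Fin n × Fin n)
    (s : State n) : State n where
  bucket i := (s.bucket i).map fun x =>
    { x with
      loss := x.loss + loss x.expert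
      weight := x.weight *
        Real.exp (-(√(Real.log ((s.bucket i).length : ℝ) / (Ts i : ℝ)) * loss x.expert)) }
  big i := s.big i * Real.exp (-(√(2 / (Ts (i + 1) : ℝ)) * loss (y (i + 1)).1))
  small i := s.small i * Real.exp (-(√(2 / (Ts (i + 1) : ℝ)) * loss (y i).2))

/-- The largest level `i ≤ k - 1` whose block size divides `t`. -/
def topLevel (Ts : ℕ → ℕ) (k t : ℕ) : ℕ := Nat.findGreatest (fun i => Ts i ∣ t) (k - 1)

open Classical in
/-- Remove from a bucket all entries which arrived at time `τ + 1/2` or later and are dominated by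
some entry of the bucket, and set the weights of the remaining entries to `1`. -/
def evict {n : ℕ} (ε : ℝ) (τ : ℕ) (b : List (Entry n)) : List (Entry n) :=
  (b.filter fun x => ¬ ((τ : ℝ) + 1 / 2 ≤ x.arrival ∧ ∃ x' ∈ b, Dominates ε x' x)).map
    fun x => { x with weight := 1 }

/-- New entries with the given experts and arrival times, loss `0` and weight `1`. -/
def fresh {n : ℕ} (arr : ℕ → ℝ) (es : List (Fin n)) : List (Entry n) :=
  es.mapIdx fun r e => ⟨e, arr r, 0, 1⟩

/-- Update of the buckets `0, …, k'` at time `t`, where `k' = topLevel Ts k t`: eviction, reset of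
the weights, forwarding of all surviving experts of smaller buckets to larger ones, and sampling of
`m` new experts, uniformly and with replacement, for each of these buckets. -/
def updateBuckets {n : ℕ} [NeZero n] (A : ArrivalRule) (Ts : ℕ → ℕ) (k m t : ℕ) (s : State n) :
    PMF (State n) :=
  let ε : ℝ := Real.log (Ts k : ℝ) / (m : ℝ)
  let k' := topLevel Ts k t
  let τ := t / Ts (k' + 1) * Ts (k' + 1)
  let old : ℕ → List (Entry n) := fun i => evict ε τ (s.bucket i)
  let forwarded : ℕ → List (Fin n) := fun i =>
    (List.range i).flatMap fun j => (old j).map Entry.expert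
  (PMF.uniformOfFintype (Fin (k' + 1) → Fin m → Fin n)).map fun S =>
    { bucket := fun i =>
        if h : i < k' + 1 then
          old i ++ fresh (A.fwd t i) (forwarded i) ++ fresh (A.smp t i) (List.ofFn (S ⟨i, h⟩))
        else s.bucket i
      big := fun i => if i + 1 ≤ k' then 1 else s.big i
      small := fun i => if i + 1 ≤ k' then 1 else s.small i }

/-- Empty buckets and unit external weights. -/
def emptyState (n : ℕ) : State n where
  bucket _ := []
  big _ := 1
  small _ := 1

/-- The joint law of the memory after day `t` and of the sequence of experts played on the days
`1, …, t`, on the loss sequence `ℓ`. -/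
def run {n : ℕ} [NeZero n] (A : ArrivalRule) (Ts : ℕ → ℕ) (k m : ℕ) (ℓ : ℕ → Fin n → ℝ) :
    ℕ → PMF (State n × (ℕ → Fin n))
  | 0 => (updateBuckets A Ts k m 0 (emptyState n)).map fun s => (s, fun _ => 0)
  | t + 1 =>
    (run A Ts k m ℓ t).bind fun sp =>
      (getPredictions sp.1 (k - 1)).bind fun y =>
        let s := updateWeights Ts (ℓ (t + 1)) y sp.1
        (if Ts 0 ∣ t + 1 then updateBuckets A Ts k m (t + 1) s else PMF.pure s).map fun s' =>
          (s', Function.update sp.2 (t + 1) (y (k - 1)).2)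

/-- The law of the sequence of experts played by the hierarchical baseline algorithm on the days
`1, …, Ts k`. -/
def hierarchicalBaseline {n : ℕ} [NeZero n] (A : ArrivalRule) (Ts : ℕ → ℕ) (k m : ℕ)
    (ℓ : ℕ → Fin n → ℝ) : PMF (ℕ → Fin n) :=
  (run A Ts k m ℓ (Ts k)).map Prod.snd

/-- Regret over the days `1, …, T` of playing expert `p t` on day `t`. -/
def regret {n : ℕ} (ℓ : ℕ → Fin n → ℝ) (T : ℕ) (p : ℕ → Fin n) : ℝ :=
  ∑ t ∈ Finset.Icc 1 T, ℓ t (p t) - ⨅ e : Fin n, ∑ t ∈ Finset.Icc 1 T, ℓ t e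

/-- `T_(i-1)`, with the convention `T_(-1) = 1`. -/
def prevSize (Ts : ℕ → ℕ) : ℕ → ℕ
  | 0 => 1
  | i + 1 => Ts i

/-- `T_k / m + T_k / √T_(k-1) + (n / m) ∑_(i < k) T_i / √T_(i-1)`. -/
def regretBound (Ts : ℕ → ℕ) (k n m : ℕ) : ℝ :=
  (Ts k : ℝ) / m + (Ts k : ℝ) / √(prevSize Ts k : ℝ)
    + (n : ℝ) / m * ∑ i ∈ Finset.range k, (Ts i : ℝ) / √(prevSize Ts i : ℝ)

end

end HierBaseline

/-!
Fix an expert `star` of minimal total loss. A level updated at time `s` is *bad* at `s` if no entry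
of its bucket competes with `star`, up to a factor `1 + ε`, on an interval starting at `s` during
which the entry stays in the bucket. Walk through the days: from a time with a good level, along the
longest such interval of the largest good level, and otherwise by one smallest block.

Bad levels met by the walk are rare: if level `i` is bad, then replacing any of its new samples by
`star` makes `star` an entry that stays until the last day, since an entry evicting it would itself
compete with it. Hence the potential that grows by a factor `exp (m / n)` at every bad time, and is
set to `0` when the walk jumps to the last day, is a supermartingale, and with high probability each
level has at most `(n / m) * Γ` bad times.

Assign to each day the smallest level `j` for which its block of size `Ts (j + 1)` is bad. While the
walk follows an entry of level `i`, the days have level at least `i`, and at the higher levels the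
entry is present as a forwarded copy. If such a copy is evicted, its dominator was present during
the whole block and serves instead, at the cost of one factor `1 + ε` per level. On blocks of size
`D`, multiplicative weights have regret of order `√D` up to logarithms, and the losses of the random
picks are as close to their conditional means, by exponential supermartingales. So following the
right level costs `1 / √(Ts (i - 1))` per day on the bad blocks of size `Ts i`, of which there are
few; this gives the terms `(n / m) * Ts i / √(Ts (i - 1))`, and the largest level gives
`Ts k / √(Ts (k - 1))`.
-/

namespace HierBaseline

noncomputable section

open scoped ENNReal

/-! ### Expectation over a probability mass function -/

section Expectation

variable {α β : Type*}

/-- The expectation of an extended nonnegative function. Unlike the Lebesgue integral against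
`PMF.toMeasure`, it needs no measurable structure on `α`. -/
def expect (μ : PMF α) (f : α → ℝ≥0∞) : ℝ≥0∞ := ∑' a, μ a * f a

theorem expect_pure (a : α) (f : α → ℝ≥0∞) : expect (PMF.pure a) f = f a := by
  rw [expect, tsum_eq_single a fun b hb => by simp [hb]]
  simp

theorem expect_bind (μ : PMF α) (κ : α → PMF β) (f : β → ℝ≥0∞) :
    expect (μ.bind κ) f = expect μ fun a => expect (κ a) f := by
  simp only [expect, PMF.bind_apply, ← ENNReal.tsum_mul_right, ← ENNReal.tsum_mul_left]
  rw [ENNReal.tsum_comm]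
  simp only [mul_assoc]

theorem expect_map (μ : PMF α) (g : α → β) (f : β → ℝ≥0∞) :
    expect (μ.map g) f = expect μ fun a => f (g a) := by
  simp only [PMF.map, expect_bind, Function.comp_apply, expect_pure]

theorem expect_mono_of_mem_support (μ : PMF α) {f g : α → ℝ≥0∞} (h : ∀ a ∈ μ.support, f a ≤ g a) :
    expect μ f ≤ expect μ g := by
  refine ENNReal.tsum_le_tsum fun a => ?_
  by_cases ha : a ∈ μ.support
  · gcongr
    exact h a ha
  · simp [μ.apply_eq_zero_iff a |>.2 ha]

theorem expect_mono (μ : PMF α) {f g : α → ℝ≥0∞} (h : ∀ a, f a ≤ g a) :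
    expect μ f ≤ expect μ g :=
  expect_mono_of_mem_support μ fun a _ => h a

theorem expect_const (μ : PMF α) (c : ℝ≥0∞) : expect μ (fun _ => c) = c := by
  rw [expect, ENNReal.tsum_mul_right, PMF.tsum_coe, one_mul]

theorem expect_le_one (μ : PMF α) {f : α → ℝ≥0∞} (h : ∀ a, f a ≤ 1) : expect μ f ≤ 1 :=
  (expect_mono μ h).trans (expect_const μ 1).le

theorem expect_const_mul (μ : PMF α) (c : ℝ≥0∞) (f : α → ℝ≥0∞) :
    expect μ (fun a => c * f a) = c * expect μ f := by
  simp only [expect, ← ENNReal.tsum_mul_left, mul_left_comm]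

theorem expect_mul_const (μ : PMF α) (c : ℝ≥0∞) (f : α → ℝ≥0∞) :
    expect μ (fun a => f a * c) = expect μ f * c := by
  simp only [mul_comm _ c, expect_const_mul]

theorem expect_add (μ : PMF α) (f g : α → ℝ≥0∞) :
    expect μ (fun a => f a + g a) = expect μ f + expect μ g := by
  simp only [expect, mul_add, ENNReal.tsum_add]

theorem expect_uniformOfFintype [Fintype α] [Nonempty α] (f : α → ℝ≥0∞) :
    expect (PMF.uniformOfFintype α) f = (∑ a, f a) / Fintype.card α := by
  rw [expect, tsum_fintype, ENNReal.div_eq_inv_mul, Finset.mul_sum]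
  simp only [PMF.uniformOfFintype_apply]

theorem mul_toOuterMeasure_le_expect (μ : PMF α) {f : α → ℝ≥0∞} {c : ℝ≥0∞} {s : Set α}
    (h : ∀ a ∈ s, c ≤ f a) : c * μ.toOuterMeasure s ≤ expect μ f := by
  rw [PMF.toOuterMeasure_apply, ← ENNReal.tsum_mul_left]
  refine ENNReal.tsum_le_tsum fun a => ?_
  by_cases ha : a ∈ s
  · rw [Set.indicator_of_mem ha, mul_comm]
    gcongr
    exact h a ha
  · simp [ha]

theorem toOuterMeasure_le_exp_neg_of_expect_le_one (μ : PMF α) {f : α → ℝ≥0∞} {Γ : ℝ} {s : Set α}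
    (hf : expect μ f ≤ 1) (hs : ∀ a ∈ s, ENNReal.ofReal (Real.exp Γ) ≤ f a) :
    μ.toOuterMeasure s ≤ ENNReal.ofReal (Real.exp (-Γ)) := by
  have hmarkov := (mul_toOuterMeasure_le_expect μ hs).trans hf
  rw [Real.exp_neg, ENNReal.ofReal_inv_of_pos (Real.exp_pos Γ), ← one_div]
  exact (ENNReal.le_div_iff_mul_le (.inl (ENNReal.ofReal_pos.2 (Real.exp_pos Γ)).ne')
    (.inl ENNReal.ofReal_ne_top)).2 (by rwa [mul_comm])

theorem toOuterMeasure_add_compl (p : PMF α) (s : Set α) :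
    p.toOuterMeasure s + p.toOuterMeasure sᶜ = 1 := by
  rw [PMF.toOuterMeasure_apply, PMF.toOuterMeasure_apply, ← ENNReal.tsum_add, ← p.tsum_coe]
  exact tsum_congr fun a => Set.indicator_self_add_compl_apply s p a

/-- The expectation of a nonnegative bounded function, as a real number. Negative values of `X`
count as `0`. -/
def mean (μ : PMF α) (X : α → ℝ) : ℝ := (expect μ fun a => ENNReal.ofReal (X a)).toReal

theorem mean_nonneg (μ : PMF α) (X : α → ℝ) : 0 ≤ mean μ X := ENNReal.toReal_nonneg

theorem expect_ofReal_le_one (μ : PMF α) {X : α → ℝ} (hX : ∀ a, X a ≤ 1) :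
    expect μ (fun a => ENNReal.ofReal (X a)) ≤ 1 :=
  expect_le_one μ fun a => ENNReal.ofReal_le_one.2 (hX a)

theorem mean_le_one (μ : PMF α) {X : α → ℝ} (hX : ∀ a, X a ≤ 1) : mean μ X ≤ 1 :=
  ENNReal.toReal_le_of_le_ofReal zero_le_one (by simpa using expect_ofReal_le_one μ hX)

theorem expect_ofReal_eq_ofReal_mean (μ : PMF α) {X : α → ℝ} (hX : ∀ a, X a ≤ 1) :
    expect μ (fun a => ENNReal.ofReal (X a)) = ENNReal.ofReal (mean μ X) :=
  (ENNReal.ofReal_toReal ((expect_ofReal_le_one μ hX).trans_lt ENNReal.one_lt_top).ne).symm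

theorem exp_mul_le_one_add_mul {x : ℝ} (hx : x ∈ Set.Icc (0 : ℝ) 1) (c : ℝ) :
    Real.exp (c * x) ≤ 1 + x * (Real.exp c - 1) := by
  have hconv := convexOn_exp.2 (Set.mem_univ (0 : ℝ)) (Set.mem_univ c) (sub_nonneg.2 hx.2) hx.1
    (by ring)
  simp only [smul_eq_mul, mul_zero, zero_add, Real.exp_zero, mul_one] at hconv
  rw [mul_comm c x]
  linarith

theorem one_add_mul_exp_sub_one_le {p c : ℝ} (hp : 0 ≤ p) (hc : c ∈ Set.Icc (0 : ℝ) 1) :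
    1 + p * (Real.exp c - 1) ≤ Real.exp ((c + c ^ 2) * p) := by
  have hexp : Real.exp c - 1 ≤ c + c ^ 2 := by
    linarith [(abs_le.1 (Real.abs_exp_sub_one_sub_id_le (abs_le.2 ⟨by linarith [hc.1], hc.2⟩))).2]
  calc 1 + p * (Real.exp c - 1) ≤ (c + c ^ 2) * p + 1 := by
        linarith [mul_le_mul_of_nonneg_left hexp hp]
    _ ≤ _ := Real.add_one_le_exp _

theorem expect_exp_mul_le (μ : PMF α) {X : α → ℝ} (hX : ∀ a, X a ∈ Set.Icc (0 : ℝ) 1) {c : ℝ}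
    (hc : c ∈ Set.Icc (0 : ℝ) 1) :
    expect μ (fun a => ENNReal.ofReal (Real.exp (c * X a))) ≤
      ENNReal.ofReal (Real.exp ((c + c ^ 2) * mean μ X)) := by
  have he : 0 ≤ Real.exp c - 1 := by linarith [Real.add_one_le_exp c, hc.1]
  have hsplit : ∀ {x : ℝ}, 0 ≤ x → ENNReal.ofReal (1 + x * (Real.exp c - 1)) =
      1 + ENNReal.ofReal x * ENNReal.ofReal (Real.exp c - 1) := fun hx => by
    rw [ENNReal.ofReal_add zero_le_one (mul_nonneg hx he), ENNReal.ofReal_mul hx,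
      ENNReal.ofReal_one]
  calc expect μ (fun a => ENNReal.ofReal (Real.exp (c * X a)))
      ≤ expect μ fun a => 1 + ENNReal.ofReal (X a) * ENNReal.ofReal (Real.exp c - 1) :=
        expect_mono μ fun a => (ENNReal.ofReal_le_ofReal
          (exp_mul_le_one_add_mul (hX a) c)).trans_eq (hsplit (hX a).1)
    _ = ENNReal.ofReal (1 + mean μ X * (Real.exp c - 1)) := by
        rw [expect_add, expect_const, expect_mul_const,
          expect_ofReal_eq_ofReal_mean μ fun a => (hX a).2, hsplit (mean_nonneg μ X)]
    _ ≤ _ := ENNReal.ofReal_le_ofReal (one_add_mul_exp_sub_one_le (mean_nonneg μ X) hc)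

theorem expect_exp_mul_sub_mean_le_one (μ : PMF α) {X : α → ℝ}
    (hX : ∀ a, X a ∈ Set.Icc (0 : ℝ) 1) {c : ℝ} (hc : c ∈ Set.Icc (0 : ℝ) 1) :
    expect μ (fun a => ENNReal.ofReal (Real.exp (c * X a - (c + c ^ 2) * mean μ X))) ≤ 1 := by
  set M := (c + c ^ 2) * mean μ X
  calc expect μ (fun a => ENNReal.ofReal (Real.exp (c * X a - M)))
      = expect μ (fun a => ENNReal.ofReal (Real.exp (c * X a))) *
          ENNReal.ofReal (Real.exp (-M)) := by
        simp only [sub_eq_add_neg, Real.exp_add, ENNReal.ofReal_mul (Real.exp_pos _).le,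
          expect_mul_const]
    _ ≤ ENNReal.ofReal (Real.exp M) * ENNReal.ofReal (Real.exp (-M)) := by
        gcongr
        exact expect_exp_mul_le μ hX hc
    _ = 1 := by
        rw [← ENNReal.ofReal_mul (Real.exp_pos M).le, ← Real.exp_add, add_neg_cancel,
          Real.exp_zero, ENNReal.ofReal_one]

end Expectation

/-! ### Multiplicative weights -/

section Hedge

theorem exp_neg_le_one_sub_add_sq_div_two {x : ℝ} (hx : 0 ≤ x) :
    Real.exp (-x) ≤ 1 - x + x ^ 2 / 2 := by
  have hpos : 0 < 1 + x + x ^ 2 / 2 := by positivity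
  rw [Real.exp_neg]
  refine (inv_anti₀ hpos (Real.quadratic_le_exp_of_nonneg hx)).trans ?_
  rw [inv_le_iff_one_le_mul₀ hpos]
  nlinarith [sq_nonneg (x ^ 2)]

variable {ι : Type*} (η : ℝ) (ℓ : ℕ → ι → ℝ)

/-- The weight of option `x` before round `d`, under multiplicative weights with rate `η`. -/
def hedgeWeight (d : ℕ) (x : ι) : ℝ := Real.exp (-(η * ∑ u ∈ Finset.range d, ℓ u x))

theorem hedgeWeight_pos (d : ℕ) (x : ι) : 0 < hedgeWeight η ℓ d x := Real.exp_pos _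

theorem hedgeWeight_zero (x : ι) : hedgeWeight η ℓ 0 x = 1 := by simp [hedgeWeight]

theorem hedgeWeight_succ (d : ℕ) (x : ι) :
    hedgeWeight η ℓ (d + 1) x = hedgeWeight η ℓ d x * Real.exp (-(η * ℓ d x)) := by
  rw [hedgeWeight, hedgeWeight, Finset.sum_range_succ, mul_add, neg_add, Real.exp_add]

variable [Fintype ι]

/-- The expected loss of multiplicative weights in round `d`. -/
def hedgeLoss (d : ℕ) : ℝ :=
  (∑ x, hedgeWeight η ℓ d x * ℓ d x) / ∑ x, hedgeWeight η ℓ d x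

variable {η ℓ}

theorem sum_hedgeWeight_succ_le (hη : 0 ≤ η) (hℓ : ∀ d x, ℓ d x ∈ Set.Icc (0 : ℝ) 1) (d : ℕ) :
    ∑ x, hedgeWeight η ℓ (d + 1) x ≤
      (∑ x, hedgeWeight η ℓ d x) * Real.exp (-(η * hedgeLoss η ℓ d) + η ^ 2 / 2) := by
  rcases isEmpty_or_nonempty ι with hι | hι
  · simp
  have hpos : 0 < ∑ x, hedgeWeight η ℓ d x :=
    Finset.sum_pos (fun x _ => hedgeWeight_pos η ℓ d x) Finset.univ_nonempty
  have hloss : hedgeLoss η ℓ d * ∑ x, hedgeWeight η ℓ d x = ∑ x, hedgeWeight η ℓ d x * ℓ d x :=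
    div_mul_cancel₀ _ hpos.ne'
  have hexp : ∀ x, Real.exp (-(η * ℓ d x)) ≤ 1 - η * ℓ d x + η ^ 2 / 2 := fun x => by
    have hsq : ℓ d x ^ 2 ≤ 1 := pow_le_one₀ (hℓ d x).1 (hℓ d x).2
    linarith [exp_neg_le_one_sub_add_sq_div_two (mul_nonneg hη (hℓ d x).1),
      mul_le_mul_of_nonneg_left hsq (sq_nonneg η), mul_pow η (ℓ d x) 2]
  calc ∑ x, hedgeWeight η ℓ (d + 1) x
      ≤ ∑ x, hedgeWeight η ℓ d x * (1 - η * ℓ d x + η ^ 2 / 2) := by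
        gcongr with x
        rw [hedgeWeight_succ]
        exact mul_le_mul_of_nonneg_left (hexp x) (hedgeWeight_pos η ℓ d x).le
    _ = (∑ x, hedgeWeight η ℓ d x) * (1 + η ^ 2 / 2) -
          η * ∑ x, hedgeWeight η ℓ d x * ℓ d x := by
        rw [Finset.mul_sum, Finset.sum_mul, ← Finset.sum_sub_distrib]
        exact Finset.sum_congr rfl fun x _ => by ring
    _ = (∑ x, hedgeWeight η ℓ d x) * (-(η * hedgeLoss η ℓ d) + η ^ 2 / 2 + 1) := by
        rw [← hloss]
        ring
    _ ≤ _ := by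
        gcongr
        exact Real.add_one_le_exp _

theorem sum_hedgeWeight_le (hη : 0 ≤ η) (hℓ : ∀ d x, ℓ d x ∈ Set.Icc (0 : ℝ) 1) (D : ℕ) :
    ∑ x, hedgeWeight η ℓ D x ≤
      Fintype.card ι *
        Real.exp (-(η * ∑ d ∈ Finset.range D, hedgeLoss η ℓ d) + η ^ 2 / 2 * D) := by
  induction D with
  | zero => simp [hedgeWeight_zero]
  | succ D ih =>
    calc ∑ x, hedgeWeight η ℓ (D + 1) x
        ≤ (∑ x, hedgeWeight η ℓ D x) * Real.exp (-(η * hedgeLoss η ℓ D) + η ^ 2 / 2) :=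
          sum_hedgeWeight_succ_le hη hℓ D
      _ ≤ _ := mul_le_mul_of_nonneg_right ih (Real.exp_pos _).le
      _ = _ := by
          rw [mul_assoc, ← Real.exp_add, Finset.sum_range_succ]
          congr 2
          push_cast
          ring

theorem mul_sum_hedgeLoss_le (hη : 0 ≤ η) (hℓ : ∀ d x, ℓ d x ∈ Set.Icc (0 : ℝ) 1) (D : ℕ) (e : ι) :
    η * ∑ d ∈ Finset.range D, hedgeLoss η ℓ d ≤
      η * ∑ d ∈ Finset.range D, ℓ d e + Real.log (Fintype.card ι) + η ^ 2 / 2 * D := by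
  have hcard : (Fintype.card ι : ℝ) ≠ 0 := by
    exact_mod_cast (Fintype.card_pos_iff.2 ⟨e⟩).ne'
  have hweight : hedgeWeight η ℓ D e ≤ _ :=
    (Finset.single_le_sum (fun x _ => (hedgeWeight_pos η ℓ D x).le) (Finset.mem_univ e)).trans
      (sum_hedgeWeight_le hη hℓ D)
  have hlog := Real.log_le_log (hedgeWeight_pos η ℓ D e) hweight
  rw [hedgeWeight, Real.log_exp, Real.log_mul hcard (Real.exp_pos _).ne', Real.log_exp] at hlog
  linarith

theorem hedgeLoss_of_subsingleton [Subsingleton ι] (d : ℕ) (e : ι) :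
    hedgeLoss η ℓ d = ℓ d e := by
  rw [hedgeLoss, Fintype.sum_subsingleton _ e, Fintype.sum_subsingleton _ e,
    mul_div_cancel_left₀ _ (hedgeWeight_pos η ℓ d e).ne']

theorem sum_hedgeLoss_sqrt_log_div_le (hℓ : ∀ d x, ℓ d x ∈ Set.Icc (0 : ℝ) 1) {D : ℕ} (hD : 0 < D)
    {B : ℝ} (hB : 0 ≤ B) (hcard : Real.log (Fintype.card ι) ≤ B ^ 2) (e : ι) :
    ∑ d ∈ Finset.range D, hedgeLoss (√(Real.log (Fintype.card ι) / D)) ℓ d ≤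
      ∑ d ∈ Finset.range D, ℓ d e + 2 * B * √(D : ℝ) := by
  have hD' : (0 : ℝ) < D := Nat.cast_pos.2 hD
  have hpos : 0 < Fintype.card ι := Fintype.card_pos_iff.2 ⟨e⟩
  rcases Nat.eq_or_lt_of_le (Nat.succ_le_of_lt hpos) with hone | hmany
  · -- The rate vanishes for a single option, but then there is no regret either.
    have : Subsingleton ι := Fintype.card_le_one_iff_subsingleton.1 hone.ge
    simp only [hedgeLoss_of_subsingleton _ e]
    exact le_add_of_nonneg_right (by positivity)
  have hlog : 0 < Real.log (Fintype.card ι) := Real.log_pos (Nat.one_lt_cast.2 hmany)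
  set η := √(Real.log (Fintype.card ι) / D)
  have hη : 0 < η := Real.sqrt_pos.2 (by positivity)
  have hηsq : η ^ 2 * D = Real.log (Fintype.card ι) := by
    rw [Real.sq_sqrt (by positivity), div_mul_cancel₀ _ hD'.ne']
  have hηB : η * √(D : ℝ) ≤ B := by
    rw [← Real.sqrt_mul (by positivity), div_mul_cancel₀ _ hD'.ne']
    exact Real.sqrt_le_iff.2 ⟨hB, hcard⟩
  have hηD : η ^ 2 * D ≤ η * (B * √(D : ℝ)) := by
    calc η ^ 2 * D = η * (η * √(D : ℝ) * √(D : ℝ)) := by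
          rw [mul_assoc η (√_), Real.mul_self_sqrt hD'.le, sq, mul_assoc]
      _ ≤ η * (B * √(D : ℝ)) := by gcongr
  refine le_of_mul_le_mul_left ((mul_sum_hedgeLoss_le hη.le hℓ D e).trans ?_) hη
  have hreg : 0 ≤ η * (B * √(D : ℝ)) := by positivity
  linarith only [hηsq, hηD, hreg]

theorem sum_hedgeLoss_sqrt_two_div_le (hℓ : ∀ d x, ℓ d x ∈ Set.Icc (0 : ℝ) 1) {D : ℕ} (hD : 0 < D)
    (hcard : Real.log (Fintype.card ι) ≤ 1) (e : ι) :
    ∑ d ∈ Finset.range D, hedgeLoss (√(2 / D)) ℓ d ≤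
      ∑ d ∈ Finset.range D, ℓ d e + 2 * √(D : ℝ) := by
  have hD' : (0 : ℝ) < D := Nat.cast_pos.2 hD
  set η := √(2 / (D : ℝ))
  have hη : 0 < η := Real.sqrt_pos.2 (by positivity)
  have hηsq : η ^ 2 * D = 2 := by rw [Real.sq_sqrt (by positivity), div_mul_cancel₀ _ hD'.ne']
  have hηD : 1 ≤ η * √(D : ℝ) := by
    rw [← Real.sqrt_mul (by positivity), div_mul_cancel₀ _ hD'.ne']
    exact Real.one_le_sqrt.2 one_le_two
  refine le_of_mul_le_mul_left ((mul_sum_hedgeLoss_le hη.le hℓ D e).trans ?_) hη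
  linarith

end Hedge

/-! ### Block sizes -/

/-- Admissible block sizes `Ts 0 < ⋯ < Ts k`, each dividing the next. -/
structure BlockSizes (Ts : ℕ → ℕ) (k : ℕ) : Prop where
  k_pos : 0 < k
  pos_zero : 0 < Ts 0
  lt_succ : ∀ i < k, Ts i < Ts (i + 1)
  dvd_succ : ∀ i < k, Ts i ∣ Ts (i + 1)

/-- The time `τ` of the bucket update at time `t`: the start of the block of size
`Ts (topLevel Ts k t + 1)` containing `t`. -/
def blockStart (Ts : ℕ → ℕ) (k t : ℕ) : ℕ :=
  t / Ts (topLevel Ts k t + 1) * Ts (topLevel Ts k t + 1)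

theorem topLevel_dvd {Ts : ℕ → ℕ} {t : ℕ} (h : Ts 0 ∣ t) (k : ℕ) : Ts (topLevel Ts k t) ∣ t :=
  Nat.findGreatest_spec (P := fun i => Ts i ∣ t) (Nat.zero_le _) h

theorem le_topLevel {Ts : ℕ → ℕ} {k i t : ℕ} (hi : i < k) (h : Ts i ∣ t) : i ≤ topLevel Ts k t :=
  Nat.le_findGreatest (by omega) h

theorem add_le_of_dvd_of_lt {d a b : ℕ} (ha : d ∣ a) (hb : d ∣ b) (h : a < b) : a + d ≤ b :=
  Nat.le_of_lt_add_of_dvd (by omega) (ha.add dvd_rfl) hb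

theorem not_dvd_of_lt_of_lt_add {d b x : ℕ} (hb : d ∣ b) (h1 : b < x) (h2 : x < b + d) : ¬ d ∣ x :=
  fun h => absurd (add_le_of_dvd_of_lt hb h h1) (not_le.2 h2)

theorem div_eq_div_of_dvd {d b x : ℕ} (hb : d ∣ b) (h1 : b ≤ x) (h2 : x < b + d) :
    x / d = b / d := by
  obtain ⟨c, rfl⟩ := hb
  have hd : 0 < d := by omega
  rw [Nat.mul_div_cancel_left c hd]
  exact Nat.div_eq_of_lt_le (by rwa [mul_comm]) (by rwa [add_mul, one_mul, mul_comm c])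

theorem sum_Ico_le_sum_Ico_of_blocks {M : Type*} [AddCommMonoid M] [PartialOrder M]
    [IsOrderedAddMonoid M] {f g : ℕ → M} {d u v : ℕ} (hu : d ∣ u) (hv : d ∣ v) (huv : u ≤ v)
    (h : ∀ b, d ∣ b → u ≤ b → b < v →
      ∑ x ∈ Finset.Ico b (b + d), f x ≤ ∑ x ∈ Finset.Ico b (b + d), g x) :
    ∑ x ∈ Finset.Ico u v, f x ≤ ∑ x ∈ Finset.Ico u v, g x := by
  rcases d.eq_zero_or_pos with rfl | hd
  · simp [Nat.eq_zero_of_zero_dvd hu, Nat.eq_zero_of_zero_dvd hv]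
  obtain ⟨c, hc⟩ := Nat.dvd_sub hv hu
  obtain rfl : v = u + d * c := by omega
  clear hv hc huv
  induction c with
  | zero => simp
  | succ c ih =>
    have hmid : u ≤ u + d * c := Nat.le_add_right _ _
    rw [mul_add, mul_one, ← add_assoc, ← Finset.sum_Ico_consecutive f hmid (Nat.le_add_right _ d),
      ← Finset.sum_Ico_consecutive g hmid (Nat.le_add_right _ d)]
    refine add_le_add (ih fun b hb hub hbv => h b hb hub (hbv.trans_le ?_))
      (h _ (hu.add (dvd_mul_right d c)) hmid ?_) <;> rw [mul_add, mul_one] <;> omega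

namespace BlockSizes

variable {Ts : ℕ → ℕ} {k : ℕ}

theorem pos (hS : BlockSizes Ts k) {i : ℕ} (hi : i ≤ k) : 0 < Ts i := by
  cases i with
  | zero => exact hS.pos_zero
  | succ i => exact (Nat.zero_le _).trans_lt (hS.lt_succ i hi)

theorem dvd_of_le (hS : BlockSizes Ts k) {i j : ℕ} (hij : i ≤ j) (hj : j ≤ k) : Ts i ∣ Ts j := by
  induction j, hij using Nat.le_induction with
  | base => exact dvd_rfl
  | succ j _ ih => exact (ih (by omega)).trans (hS.dvd_succ j hj)

theorem topLevel_lt (hS : BlockSizes Ts k) (t : ℕ) : topLevel Ts k t < k :=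
  (Nat.findGreatest_le (k - 1)).trans_lt (Nat.sub_lt hS.k_pos one_pos)

theorem dvd_of_le_topLevel (hS : BlockSizes Ts k) {i t : ℕ} (h : Ts 0 ∣ t)
    (hi : i ≤ topLevel Ts k t) : Ts i ∣ t :=
  (hS.dvd_of_le hi (hS.topLevel_lt t).le).trans (topLevel_dvd h k)

theorem zero_dvd_of_dvd (hS : BlockSizes Ts k) {i t : ℕ} (hi : i ≤ k) (h : Ts i ∣ t) : Ts 0 ∣ t :=
  (hS.dvd_of_le (Nat.zero_le i) hi).trans h

theorem dvd_of_blockStart_lt (hS : BlockSizes Ts k) {j p v : ℕ} (hj : j < k) (hv : Ts 0 ∣ v)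
    (hp : Ts j ∣ p) (hpv : p ≤ v) (h : blockStart Ts k v < p) : Ts j ∣ v := by
  by_contra hndvd
  have hlt : topLevel Ts k v < j :=
    lt_of_not_ge fun hle => hndvd (hS.dvd_of_le_topLevel hv hle)
  obtain ⟨c, rfl⟩ : Ts (topLevel Ts k v + 1) ∣ p := (hS.dvd_of_le hlt hj.le).trans hp
  have hc : c ≤ v / Ts (topLevel Ts k v + 1) :=
    (Nat.le_div_iff_mul_le (hS.pos (hS.topLevel_lt v))).2 (by rwa [mul_comm])
  exact absurd (Nat.mul_le_mul_left _ hc) (not_le.2 (by rwa [blockStart, mul_comm] at h))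

theorem div_eq_of_blockStart_le (hS : BlockSizes Ts k) {w v : ℕ} (h : blockStart Ts k v ≤ w)
    (hwv : w ≤ v) : w / Ts (topLevel Ts k v + 1) = v / Ts (topLevel Ts k v + 1) :=
  le_antisymm (Nat.div_le_div_right hwv)
    ((Nat.le_div_iff_mul_le (hS.pos (hS.topLevel_lt v))).2 h)

theorem two_pow_le (hS : BlockSizes Ts k) {i : ℕ} (hi : i ≤ k) : 2 ^ i ≤ Ts i := by
  induction i with
  | zero => exact hS.pos_zero
  | succ i ih =>
    obtain ⟨c, hc⟩ := hS.dvd_succ i hi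
    have hlt := hS.lt_succ i hi
    have hc2 : 2 ≤ c := by
      by_contra! hc2
      interval_cases c <;> omega
    rw [hc, pow_succ]
    exact Nat.mul_le_mul (ih (by omega)) hc2

end BlockSizes

/-! ### Evictions -/

section Evictions

variable {n : ℕ} (Ts : ℕ → ℕ) (k : ℕ) (ε : ℝ) (ℓ : ℕ → Fin n → ℝ)

/-- The loss of expert `e` on the days `a + 1, …, b`. -/
def cumLoss (a b : ℕ) (e : Fin n) : ℝ := ∑ x ∈ Finset.Ico a b, ℓ (x + 1) e

theorem cumLoss_add {a b c : ℕ} (hab : a ≤ b) (hbc : b ≤ c) (e : Fin n) :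
    cumLoss ℓ a b e + cumLoss ℓ b c e = cumLoss ℓ a c e :=
  Finset.sum_Ico_consecutive _ hab hbc

variable {ℓ} in
theorem cumLoss_nonneg (hℓ : ∀ t e, 0 ≤ ℓ t e) (a b : ℕ) (e : Fin n) : 0 ≤ cumLoss ℓ a b e :=
  Finset.sum_nonneg fun _ _ => hℓ _ _

variable {ℓ} in
theorem cumLoss_anti_left (hℓ : ∀ t e, 0 ≤ ℓ t e) {a b : ℕ} (hab : a ≤ b) (c : ℕ) (e : Fin n) :
    cumLoss ℓ b c e ≤ cumLoss ℓ a c e :=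
  Finset.sum_le_sum_of_subset_of_nonneg (Finset.Ico_subset_Ico_left hab) fun _ _ _ => hℓ _ _

/-- `Dominates` for entries represented by their expert and arrival time, with the losses at
time `t`. An entry that arrives in `[b, b + 1)` sees its first loss on day `b + 1`. -/
def DominatesAt (t : ℕ) (x' x : Fin n × ℝ) : Prop :=
  x'.2 < x.2 ∧ cumLoss ℓ ⌊x'.2⌋₊ t x'.1 ≤ (1 + ε) * cumLoss ℓ ⌊x.2⌋₊ t x.1

/-- Whether the update at time `t` removes the entry `x` from a bucket with content `X`. -/
def IsEvicted (t : ℕ) (X : Set (Fin n × ℝ)) (x : Fin n × ℝ) : Prop :=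
  (blockStart Ts k t : ℝ) + 1 / 2 ≤ x.2 ∧ ∃ x' ∈ X, DominatesAt ε ℓ t x' x

/-- The entries of a bucket with content `X` that survive the update at time `t`. -/
def survivors (t : ℕ) (X : Set (Fin n × ℝ)) : Set (Fin n × ℝ) :=
  {x | x ∈ X ∧ ¬ IsEvicted Ts k ε ℓ t X x}

open Classical in
/-- What is left at time `s + d` of the content `X` of bucket `i` at time `s`, if no entries are
added in between. -/
def evolve (i s : ℕ) (X : Set (Fin n × ℝ)) : ℕ → Set (Fin n × ℝ)
  | 0 => X
  | d + 1 =>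
    if Ts i ∣ s + d + 1 then survivors Ts k ε ℓ (s + d + 1) (evolve i s X d) else evolve i s X d

theorem survivors_sep_lt (t : ℕ) (X : Set (Fin n × ℝ)) (c : ℝ) :
    survivors Ts k ε ℓ t {x ∈ X | x.2 < c} = {x ∈ survivors Ts k ε ℓ t X | x.2 < c} := by
  ext x
  constructor
  · rintro ⟨⟨hx, hc⟩, h⟩
    exact ⟨⟨hx, fun ⟨hτ, x', hx', hdom⟩ => h ⟨hτ, x', ⟨hx', hdom.1.trans hc⟩, hdom⟩⟩, hc⟩
  · rintro ⟨⟨hx, h⟩, hc⟩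
    exact ⟨⟨hx, hc⟩, fun ⟨hτ, x', hx', hdom⟩ => h ⟨hτ, x', hx'.1, hdom⟩⟩

theorem evolve_sep_lt (i s : ℕ) (X : Set (Fin n × ℝ)) (c : ℝ) (d : ℕ) :
    evolve Ts k ε ℓ i s {x ∈ X | x.2 < c} d = {x ∈ evolve Ts k ε ℓ i s X d | x.2 < c} := by
  induction d with
  | zero => rfl
  | succ d ih =>
    simp only [evolve]
    split_ifs
    · rw [ih, survivors_sep_lt]
    · exact ih

/-- The deterministic part of a run: `X t i` is the content of bucket `i` after the updates at
time `t`, and samples are only known to arrive in the right time interval. -/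
structure BucketPath (X : ℕ → ℕ → Set (Fin n × ℝ)) : Prop where
  arrival_mem : ∀ t < Ts k, ∀ i < k, ∀ x ∈ X t i, x.2 ∈ Set.Ico (0 : ℝ) (t + 1)
  stay : ∀ t, t + 1 < Ts k → ∀ i < k, ¬ Ts i ∣ t + 1 → X (t + 1) i = X t i
  mem_and_lt_iff : ∀ t, t + 1 < Ts k → ∀ i < k, Ts i ∣ t + 1 →
    ∀ x, x ∈ X (t + 1) i ∧ x.2 < (t + 1 : ℕ) ↔ x ∈ survivors Ts k ε ℓ (t + 1) (X t i)
  forward : ∀ t, t + 1 < Ts k → ∀ i < k, Ts i ∣ t + 1 → ∀ j < i,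
    ∀ x ∈ survivors Ts k ε ℓ (t + 1) (X t j),
      ∃ r ∈ Set.Ico ((t + 1 : ℕ) : ℝ) ((t + 1 : ℕ) + 1 / 2), (x.1, r) ∈ X (t + 1) i

namespace BucketPath

variable {Ts k ε ℓ} {X : ℕ → ℕ → Set (Fin n × ℝ)}

theorem mem_of_mem_later (hX : BucketPath Ts k ε ℓ X) {i w w' : ℕ} (hi : i < k) (hw : w ≤ w')
    (hw' : w' < Ts k) {x : Fin n × ℝ} (hx : x ∈ X w' i) (hlt : x.2 < w + 1) : x ∈ X w i := by
  induction w', hw using Nat.le_induction with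
  | base => exact hx
  | succ t hwt ih =>
    refine ih (by omega) ?_
    by_cases hd : Ts i ∣ t + 1
    · have hxt : x.2 < (t + 1 : ℕ) := hlt.trans_le (by exact_mod_cast Nat.succ_le_succ hwt)
      exact ((hX.mem_and_lt_iff t hw' i hi hd x).1 ⟨hx, hxt⟩).1
    · rwa [hX.stay t hw' i hi hd] at hx

theorem evolve_eq (hX : BucketPath Ts k ε ℓ X) {i w d : ℕ} (hi : i < k) (hd : w + d < Ts k) :
    evolve Ts k ε ℓ i w (X w i) d = {x ∈ X (w + d) i | x.2 < w + 1} := by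
  induction d with
  | zero => exact Set.ext fun x => ⟨fun h => ⟨h, (hX.arrival_mem w hd i hi x h).2⟩, And.left⟩
  | succ d ih =>
    simp only [evolve, ih (by omega)]
    split_ifs with hdvd
    · rw [survivors_sep_lt]
      ext x
      have hle : (w : ℝ) + 1 ≤ ((w + d + 1 : ℕ) : ℝ) := by exact_mod_cast (by omega)
      have hiff := hX.mem_and_lt_iff (w + d) hd i hi hdvd x
      exact ⟨fun ⟨h1, h2⟩ => ⟨(hiff.2 h1).1, h2⟩,
        fun ⟨h1, h2⟩ => ⟨hiff.1 ⟨h1, h2.trans_le hle⟩, h2⟩⟩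
    · rw [← hX.stay (w + d) hd i hi hdvd]
      rfl

theorem exists_isEvicted (hX : BucketPath Ts k ε ℓ X) {i w v : ℕ} (hi : i < k) (hv : v ≤ Ts k)
    {x : Fin n × ℝ} (hx : x ∈ X w i) (hleave : ∃ w', w ≤ w' ∧ w' < v ∧ x ∉ X w' i) :
    ∃ t, w ≤ t ∧ t + 1 < v ∧ Ts i ∣ t + 1 ∧ IsEvicted Ts k ε ℓ (t + 1) (X t i) x := by
  classical
  obtain ⟨hw, hlt, hnot⟩ := Nat.find_spec hleave
  have hfirst := fun {w'} => Nat.find_min hleave (m := w')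
  obtain ⟨t, ht⟩ : ∃ t, Nat.find hleave = t + 1 :=
    Nat.exists_eq_succ_of_ne_zero fun h0 => hnot (by rwa [h0, ← show w = 0 by omega])
  rw [ht] at hw hlt hnot hfirst
  have hwt : w ≤ t := by
    by_contra hwt
    exact hnot (by rwa [← show w = t + 1 by omega])
  have hxt : x ∈ X t i := by
    by_contra hxt
    exact hfirst t.lt_succ_self ⟨hwt, by omega, hxt⟩
  have hdvd : Ts i ∣ t + 1 := by
    by_contra hdvd
    exact hnot (by rwa [hX.stay t (by omega) i hi hdvd])
  refine ⟨t, hwt, hlt, hdvd, ?_⟩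
  by_contra hkept
  exact hnot ((hX.mem_and_lt_iff t (by omega) i hi hdvd x).2 ⟨hxt, hkept⟩).1

end BucketPath

end Evictions

/-! ### Competing with a surviving entry -/

section NestedBlocks

variable {Ts : ℕ → ℕ} {k : ℕ}

open Classical in
/-- The value `q j x` at the level `j` of day `x + 1`, which is the smallest `j` with `U (j + 1) x`;
the value is `0` if `U 0 x`. -/
def levelValue (k : ℕ) (U : ℕ → ℕ → Prop) (q : ℕ → ℕ → ℝ) (x : ℕ) : ℝ :=
  ∑ j ∈ Finset.range k, if U (j + 1) x ∧ ¬ U j x then q j x else 0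

/-- An increasing family of sets of days, the one at level `j` being a union of blocks of size
`Ts j` and the one at level `k` containing every day; `U j x` stands for membership of
day `x + 1`. -/
structure NestedBlocks (Ts : ℕ → ℕ) (k : ℕ) (U : ℕ → ℕ → Prop) : Prop where
  top : ∀ x, U k x
  mono_succ : ∀ j < k, ∀ x < Ts k, U j x → U (j + 1) x
  congr : ∀ j ≤ k, ∀ x y, x / Ts j = y / Ts j → U j x → U j y

namespace NestedBlocks

variable {U : ℕ → ℕ → Prop}

theorem mono (hU : NestedBlocks Ts k U) {i j x : ℕ} (hij : i ≤ j) (hj : j ≤ k) (hx : x < Ts k)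
    (h : U i x) : U j x := by
  induction j, hij using Nat.le_induction with
  | base => exact h
  | succ j _ ih => exact hU.mono_succ j hj x hx (ih (by omega))

theorem of_mem_block (hU : NestedBlocks Ts k U) {i b x y : ℕ} (hi : i ≤ k) (hb : Ts i ∣ b)
    (hx : x ∈ Set.Ico b (b + Ts i)) (hy : y ∈ Set.Ico b (b + Ts i)) (h : U i x) : U i y :=
  hU.congr i hi x y
    ((div_eq_div_of_dvd hb hx.1 hx.2).trans (div_eq_div_of_dvd hb hy.1 hy.2).symm) h

theorem levelValue_eq (hU : NestedBlocks Ts k U) {q : ℕ → ℕ → ℝ} {i x : ℕ} (hi : i < k)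
    (hx : x < Ts k) (h1 : U (i + 1) x) (h2 : ¬ U i x) : levelValue k U q x = q i x := by
  rw [levelValue, Finset.sum_eq_single i, if_pos ⟨h1, h2⟩]
  · intro j hj hne
    refine if_neg fun ⟨h3, h4⟩ => ?_
    rcases lt_or_gt_of_ne hne with hji | hij
    · exact h2 (hU.mono hji hi.le hx h3)
    · exact h4 (hU.mono hij (Finset.mem_range.1 hj).le hx h1)
  · exact fun h => absurd (Finset.mem_range.2 hi) h

theorem levelValue_eq_zero (hU : NestedBlocks Ts k U) {q : ℕ → ℕ → ℝ} {x : ℕ} (hx : x < Ts k)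
    (h : U 0 x) : levelValue k U q x = 0 :=
  Finset.sum_eq_zero fun j hj =>
    if_neg fun ⟨_, h2⟩ => h2 (hU.mono (Nat.zero_le j) (Finset.mem_range.1 hj).le hx h)

theorem of_pred (hU : NestedBlocks Ts k U) (hS : BlockSizes Ts k) {i t : ℕ} (hi : i < k)
    (ht : t < Ts k) (hd : Ts i ∣ t + 1) (h : U i t) :
    U (topLevel Ts k (t + 1) + 1) (t + 1) := by
  rcases (Nat.succ_le_of_lt (hS.topLevel_lt (t + 1))).eq_or_lt with htop | hlt
  · rw [← Nat.succ_eq_add_one, htop]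
    exact hU.top _
  have hnd : ¬ Ts (topLevel Ts k (t + 1) + 1) ∣ t + 1 := fun hdvd =>
    absurd (le_topLevel hlt hdvd) (Nat.lt_succ_self _).not_ge
  exact hU.congr _ (hS.topLevel_lt _) t (t + 1) (Nat.succ_div_of_not_dvd hnd).symm
    (hU.mono ((le_topLevel hi hd).trans (Nat.le_succ _)) (hS.topLevel_lt _) ht h)

end NestedBlocks

end NestedBlocks

section Comparison

variable {n : ℕ} {Ts : ℕ → ℕ} {k : ℕ} {ε : ℝ} {ℓ : ℕ → Fin n → ℝ}

theorem floor_eq_of_mem_Ico_half {w : ℕ} {r : ℝ} (hr : r ∈ Set.Ico (w : ℝ) (w + 1 / 2)) :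
    ⌊r⌋₊ = w :=
  (Nat.floor_eq_iff (w.cast_nonneg.trans hr.1)).2 ⟨hr.1, by linarith [hr.2]⟩

namespace BucketPath

variable {X : ℕ → ℕ → Set (Fin n × ℝ)}

theorem exists_forwarded (hX : BucketPath Ts k ε ℓ X) (hS : BlockSizes Ts k) {i w : ℕ}
    (hw : w < Ts k) (hdw : Ts 0 ∣ w) (hi : i < topLevel Ts k w) {z : Fin n × ℝ} (hz : z ∈ X w i)
    (hzw : z.2 < w) :
    ∃ r ∈ Set.Ico (w : ℝ) (w + 1 / 2), (z.1, r) ∈ X w (topLevel Ts k w) := by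
  have hik := hi.trans (hS.topLevel_lt w)
  cases w with
  | zero => exact absurd (hX.arrival_mem 0 hw i hik z hz).1 (by exact_mod_cast hzw.not_ge)
  | succ t =>
    exact hX.forward t hw _ (hS.topLevel_lt _) (topLevel_dvd hdw k) i hi z
      ((hX.mem_and_lt_iff t hw i hik (hS.dvd_of_le_topLevel hdw hi.le) z).1 ⟨hz, hzw⟩)

/-- Since its arrival time is less than `τ + 1/2` when `τ = w`, a forwarded copy is only evicted
after a common block of the next level started, and its dominator was present all along. -/
theorem exists_dominator_of_forwarded (hX : BucketPath Ts k ε ℓ X) (hℓ : ∀ t e, 0 ≤ ℓ t e)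
    {j w v : ℕ} (hj : j < k) (hv : v ≤ Ts k) {e : Fin n} {r : ℝ}
    (hr : r ∈ Set.Ico (w : ℝ) (w + 1 / 2)) (hx : (e, r) ∈ X w j)
    (hleave : ∃ w', w ≤ w' ∧ w' < v ∧ (e, r) ∉ X w' j) :
    ∃ w' y, w < w' ∧ w' < v ∧ Ts j ∣ w' ∧ blockStart Ts k w' ≤ w ∧
      (∀ x, w ≤ x → x < w' → y ∈ X x j) ∧
      cumLoss ℓ w w' y.1 ≤ (1 + ε) * cumLoss ℓ w w' e := by
  obtain ⟨t, hwt, htv, hdvd, hτ, y, hy, hyr, hyloss⟩ := hX.exists_isEvicted hj hv hx hleave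
  have hblock : blockStart Ts k (t + 1) ≤ w := by
    have : (blockStart Ts k (t + 1) : ℝ) < w := by linarith [hr.2, show _ ≤ r from hτ]
    exact_mod_cast this.le
  have hyw : y.2 < (w : ℝ) + 1 := by linarith [hr.2, show y.2 < r from hyr]
  have hystay : ∀ x, w ≤ x → x < t + 1 → y ∈ X x j := fun x hwx hxt =>
    hX.mem_of_mem_later hj (Nat.lt_succ_iff.1 hxt) (by omega) hy
      (hyw.trans_le (by exact_mod_cast Nat.succ_le_succ hwx))
  have hfloor : ⌊y.2⌋₊ ≤ w := by
    have hpos := (hX.arrival_mem w (by omega) j hj y (hystay w le_rfl (by omega))).1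
    exact Nat.lt_succ_iff.1 ((Nat.floor_lt hpos).2 (by exact_mod_cast hyw))
  refine ⟨t + 1, y, by omega, htv, hdvd, hblock, hystay, ?_⟩
  calc cumLoss ℓ w (t + 1) y.1 ≤ cumLoss ℓ ⌊y.2⌋₊ (t + 1) y.1 := cumLoss_anti_left hℓ hfloor _ _
    _ ≤ (1 + ε) * cumLoss ℓ ⌊r⌋₊ (t + 1) e := hyloss
    _ = _ := by rw [floor_eq_of_mem_Ico_half hr]

end BucketPath

/-- On every block of level `j`, the loss `q j` competes with all entries of bucket `j` that are
present at the start of the block. -/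
def BlockCompetitive (Ts : ℕ → ℕ) (k : ℕ) (ℓ : ℕ → Fin n → ℝ) (X : ℕ → ℕ → Set (Fin n × ℝ))
    (q : ℕ → ℕ → ℝ) : Prop :=
  ∀ j < k, ∀ b, Ts j ∣ b → b < Ts k → ∀ z ∈ X b j,
    ∑ x ∈ Finset.Ico b (b + Ts j), q j x ≤ cumLoss ℓ b (b + Ts j) z.1

/-- The entry `z` stays in bucket `i` during `[u, v)`, which starts at level `i` of `U` and stays
at level at least `i`, since no block belonging to `U` starts inside it. -/
structure Leg (Ts : ℕ → ℕ) (k : ℕ) (X : ℕ → ℕ → Set (Fin n × ℝ)) (U : ℕ → ℕ → Prop) (i u v : ℕ)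
    (z : Fin n × ℝ) : Prop where
  level_lt : i < k
  lt : u < v
  le_end : v ≤ Ts k
  dvd_left : Ts i ∣ u
  dvd_right : Ts i ∣ v
  enclosed : v = Ts k ∨ blockStart Ts k v ≤ u
  above : U (i + 1) u
  not_below : ¬ U i u
  no_start : ∀ x, u < x → x < v → ∀ l < k, Ts l ∣ x → ¬ U l x
  stays : ∀ w, u ≤ w → w < v → z ∈ X w i

namespace Leg

variable {X : ℕ → ℕ → Set (Fin n × ℝ)} {U : ℕ → ℕ → Prop} {q : ℕ → ℕ → ℝ} {i u v : ℕ}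
  {z : Fin n × ℝ}

theorem not_level (hL : Leg Ts k X U i u v z) (hS : BlockSizes Ts k) (hU : NestedBlocks Ts k U)
    {x : ℕ} (hux : u ≤ x) (hxv : x < v) : ¬ U i x := by
  intro hUx
  have hpos := hS.pos hL.level_lt.le
  have hstart : U i (x / Ts i * Ts i) :=
    hU.congr i hL.level_lt.le x _ (by rw [Nat.mul_div_cancel _ hpos]) hUx
  have hle : u ≤ x / Ts i * Ts i := by
    obtain ⟨c, rfl⟩ := hL.dvd_left
    rw [mul_comm]
    exact Nat.mul_le_mul_right _ ((Nat.le_div_iff_mul_le hpos).2 (by rwa [mul_comm]))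
  rcases hle.eq_or_lt with heq | hlt
  · exact hL.not_below (heq ▸ hstart)
  · exact hL.no_start _ hlt ((Nat.div_mul_le_self _ _).trans_lt hxv) i hL.level_lt
      (dvd_mul_left _ _) hstart

theorem sum_levelValue_le_of_above (hL : Leg Ts k X U i u v z) (hS : BlockSizes Ts k)
    (hU : NestedBlocks Ts k U) (hq : BlockCompetitive Ts k ℓ X q) {v' : ℕ} (huv' : u ≤ v')
    (hv' : v' ≤ v) (hd : Ts i ∣ v') (hlevel : ∀ x, u ≤ x → x < v' → U (i + 1) x) :
    ∑ x ∈ Finset.Ico u v', levelValue k U q x ≤ cumLoss ℓ u v' z.1 := by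
  have hvT := hL.le_end
  refine sum_Ico_le_sum_Ico_of_blocks hL.dvd_left hd huv' fun b hb hub hbv => ?_
  refine le_trans (Finset.sum_le_sum fun x hx => ?_)
    (hq i hL.level_lt b hb (by omega) z (hL.stays b hub (by omega)))
  obtain ⟨hbx, hxb⟩ := Finset.mem_Ico.1 hx
  have hxv := hxb.trans_le (add_le_of_dvd_of_lt hb hd hbv)
  exact (hU.levelValue_eq hL.level_lt (by omega) (hlevel x (by omega) hxv)
    (hL.not_level hS hU (by omega) (by omega))).le

/-- The entry `y` is a forwarded copy of `z` or, if that copy is evicted, the entry which dominated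
it. -/
theorem exists_leg_above (hL : Leg Ts k X U i u v z) (hS : BlockSizes Ts k)
    (hX : BucketPath Ts k ε ℓ X) (hU : NestedBlocks Ts k U) (hε : 0 ≤ ε)
    (hℓ : ∀ t e, 0 ≤ ℓ t e) {w : ℕ} (huw : u < w) (hwv : w < v) (hdw : Ts (i + 1) ∣ w)
    (hUw : U (topLevel Ts k w + 1) w) :
    ∃ j w' y, i < j ∧ Leg Ts k X U j w w' y ∧
      cumLoss ℓ w w' y.1 ≤ (1 + ε) * cumLoss ℓ w w' z.1 ∧
      w' ≤ v ∧ Ts (i + 1) ∣ w' ∧ (w' < v → U (topLevel Ts k w' + 1) w') := by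
  have hvT := hL.le_end
  have hik1 : i + 1 < k := lt_of_le_of_ne hL.level_lt fun h =>
    absurd (Nat.le_of_dvd (by omega) (h ▸ hdw)) (by omega)
  have hdw0 : Ts 0 ∣ w := hS.zero_dvd_of_dvd hL.level_lt hdw
  have hij : i + 1 ≤ topLevel Ts k w := le_topLevel hik1 hdw
  have hjk := hS.topLevel_lt w
  have hdjw := topLevel_dvd hdw0 k
  set j := topLevel Ts k w
  have hnUj := hL.no_start w huw hwv j hjk hdjw
  have hzw : z.2 < w :=
    (hX.arrival_mem u (by omega) i hL.level_lt z (hL.stays u le_rfl hL.lt)).2.trans_le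
      (by exact_mod_cast huw)
  obtain ⟨r, hr, hcopy⟩ :=
    hX.exists_forwarded hS (hwv.trans_le hvT) hdw0 hij (hL.stays w huw.le hwv) hzw
  have hfree := fun {w'} (hw' : w' ≤ v) x (h1 : w < x) (h2 : x < w') =>
    hL.no_start x (huw.trans h1) (h2.trans_le hw')
  by_cases hleave : ∃ w', w ≤ w' ∧ w' < v ∧ (z.1, r) ∉ X w' j
  · obtain ⟨w', y, hww', hw'v, hdw', hblock, hstay, hloss⟩ :=
      hX.exists_dominator_of_forwarded hℓ hjk hvT hr hcopy hleave
    refine ⟨j, w', y, hij, ⟨hjk, hww', by omega, hdjw, hdw', .inr hblock, hUw, hnUj,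
      hfree hw'v.le, hstay⟩, hloss, hw'v.le, (hS.dvd_of_le hij hjk.le).trans hdw', fun _ => ?_⟩
    exact hU.congr _ (hS.topLevel_lt w') w w' (hS.div_eq_of_blockStart_le hblock hww'.le)
      (hU.mono (Nat.succ_le_succ (le_topLevel hjk hdw')) (hS.topLevel_lt w') (by omega) hUw)
  · push Not at hleave
    have hdjv : Ts j ∣ v := hL.enclosed.elim (fun h => h ▸ hS.dvd_of_le hjk.le le_rfl) fun h =>
      hS.dvd_of_blockStart_lt hjk (hS.zero_dvd_of_dvd hL.level_lt.le hL.dvd_right) hdjw hwv.le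
        (by omega)
    exact ⟨j, v, (z.1, r), hij, ⟨hjk, hwv, hvT, hdjw, hdjv, hL.enclosed.imp_right (by omega),
      hUw, hnUj, hfree le_rfl, hleave⟩,
      le_mul_of_one_le_left (cumLoss_nonneg hℓ w v z.1) (by linarith), le_rfl,
      (hS.dvd_of_le hij hjk.le).trans hdjv, fun h => absurd h (lt_irrefl v)⟩

theorem sum_levelValue_le_of_bound_above (hL : Leg Ts k X U i u v z) (hS : BlockSizes Ts k)
    (hX : BucketPath Ts k ε ℓ X) (hU : NestedBlocks Ts k U) (hε : 0 ≤ ε)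
    (hℓ : ∀ t e, 0 ≤ ℓ t e) {B : ℝ} (hB : 0 ≤ B)
    (ih : ∀ {j w w' y}, i < j → Leg Ts k X U j w w' y →
      ∑ x ∈ Finset.Ico w w', levelValue k U q x ≤ B * cumLoss ℓ w w' y.1)
    {w : ℕ} (huw : u < w) (hwv : w ≤ v) (hdw : Ts (i + 1) ∣ w)
    (hUw : w < v → U (topLevel Ts k w + 1) w) :
    ∑ x ∈ Finset.Ico w v, levelValue k U q x ≤ (1 + ε) * B * cumLoss ℓ w v z.1 := by
  obtain ⟨c, hc⟩ : ∃ c, v - w ≤ c := ⟨_, le_rfl⟩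
  induction c generalizing w with
  | zero => simp [show w = v by omega, cumLoss]
  | succ c ihc =>
    rcases hwv.eq_or_lt with rfl | hlt
    · simp [cumLoss]
    obtain ⟨j, w', y, hij, hleg, hloss, hw'v, hdw', hUw'⟩ :=
      hL.exists_leg_above hS hX hU hε hℓ huw hlt hdw (hUw hlt)
    have hww' := hleg.lt
    have hfirst : ∑ x ∈ Finset.Ico w w', levelValue k U q x ≤ (1 + ε) * B * cumLoss ℓ w w' z.1 :=
      calc _ ≤ B * cumLoss ℓ w w' y.1 := ih hij hleg
        _ ≤ B * ((1 + ε) * cumLoss ℓ w w' z.1) := by gcongr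
        _ = _ := by ring
    have hrest := ihc (huw.trans hww') hw'v hdw' hUw' (by omega)
    rw [← Finset.sum_Ico_consecutive _ hww'.le hw'v, ← cumLoss_add ℓ hww'.le hw'v, mul_add]
    exact add_le_add hfirst hrest

theorem sum_levelValue_le (hL : Leg Ts k X U i u v z) (hS : BlockSizes Ts k)
    (hX : BucketPath Ts k ε ℓ X) (hU : NestedBlocks Ts k U) (hq : BlockCompetitive Ts k ℓ X q)
    (hε : 0 ≤ ε) (hℓ : ∀ t e, 0 ≤ ℓ t e) {p : ℕ} (hp : k - 1 - i ≤ p) :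
    ∑ x ∈ Finset.Ico u v, levelValue k U q x ≤ (1 + ε) ^ p * cumLoss ℓ u v z.1 := by
  induction p generalizing i u v z with
  | zero =>
    have hik : i + 1 = k := by have := hL.level_lt; omega
    rw [pow_zero, one_mul]
    exact hL.sum_levelValue_le_of_above hS hU hq hL.lt.le le_rfl hL.dvd_right
      fun x _ _ => hik ▸ hU.top x
  | succ p ih =>
    have hik := hL.level_lt
    have hvT := hL.le_end
    set b := u / Ts (i + 1) * Ts (i + 1)
    have hb : Ts (i + 1) ∣ b := dvd_mul_left _ _
    have hub : u ∈ Set.Ico b (b + Ts (i + 1)) :=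
      ⟨Nat.div_mul_le_self _ _, Nat.lt_div_mul_add (hS.pos hik)⟩
    have hblock : ∀ x, u ≤ x → x < b + Ts (i + 1) → U (i + 1) x := fun x h1 h2 =>
      hU.of_mem_block hik hb hub ⟨hub.1.trans h1, h2⟩ hL.above
    have hone : 1 ≤ (1 + ε) ^ (p + 1) := one_le_pow₀ (by linarith)
    have hhead : ∀ v', u ≤ v' → v' ≤ v → v' ≤ b + Ts (i + 1) → Ts i ∣ v' →
        ∑ x ∈ Finset.Ico u v', levelValue k U q x ≤ (1 + ε) ^ (p + 1) * cumLoss ℓ u v' z.1 :=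
      fun v' h1 h2 h3 hd => (hL.sum_levelValue_le_of_above hS hU hq h1 h2 hd fun x hx1 hx2 =>
        hblock x hx1 (hx2.trans_le h3)).trans
          (le_mul_of_one_le_left (cumLoss_nonneg hℓ _ _ _) hone)
    rcases le_or_gt v (b + Ts (i + 1)) with hv | hv
    · exact hhead v hL.lt.le le_rfl hv hL.dvd_right
    obtain ⟨t, ht⟩ : ∃ t, b + Ts (i + 1) = t + 1 := Nat.exists_eq_succ_of_ne_zero (by
      have := hub.2; omega)
    have hds : Ts (i + 1) ∣ t + 1 := ht ▸ hb.add dvd_rfl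
    have hut : u ≤ t := by have := hub.2; omega
    rw [ht] at hblock hv hhead
    have hik1 : i + 1 < k := lt_of_le_of_ne hik fun h =>
      absurd (Nat.le_of_dvd t.succ_pos (h ▸ hds)) (by omega)
    have htail := hL.sum_levelValue_le_of_bound_above (q := q) (B := (1 + ε) ^ p) hS hX hU hε hℓ
      (by positivity) (fun hij hL' => ih hL' (by omega)) (Nat.lt_succ_of_le hut) hv.le hds
      fun _ => hU.of_pred hS hik1 (by omega) hds (hblock t hut t.lt_succ_self)
    rw [← pow_succ'] at htail
    rw [← Finset.sum_Ico_consecutive _ (hut.trans t.le_succ) hv.le,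
      ← cumLoss_add ℓ (hut.trans t.le_succ) hv.le, mul_add]
    exact add_le_add (hhead (t + 1) (hut.trans t.le_succ) hv.le le_rfl
      ((hS.dvd_succ i hik).trans hds)) htail

end Leg

end Comparison

/-! ### The walk over good intervals -/

section Walk

variable {n : ℕ} (Ts : ℕ → ℕ) (k : ℕ) (ε : ℝ) (ℓ : ℕ → Fin n → ℝ) (star : Fin n)

/-- Some entry of bucket `i` with content `Y` at time `s` stays up to time `v` and competes with
`star` on the days `s + 1, …, v`. -/
structure CanJump (i s : ℕ) (Y : Set (Fin n × ℝ)) (v : ℕ) : Prop where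
  lt : s < v
  le_end : v ≤ Ts k
  dvd : Ts i ∣ v
  enclosed : v = Ts k ∨ blockStart Ts k v ≤ s
  exists_competitor : ∃ x ∈ evolve Ts k ε ℓ i s Y (v - 1 - s),
    cumLoss ℓ s v x.1 ≤ (1 + ε) * cumLoss ℓ s v star

/-- No entry of bucket `i` with content `Y` competes with `star` from time `s` on. -/
def Bad (i s : ℕ) (Y : Set (Fin n × ℝ)) : Prop := ∀ v, ¬ CanJump Ts k ε ℓ star i s Y v

open Classical in
/-- The largest level that is updated at time `t` and not bad, for bucket contents `Y`; it is `0`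
if all of these levels are bad. -/
def goodLevel (t : ℕ) (Y : ℕ → Set (Fin n × ℝ)) : ℕ :=
  Nat.findGreatest (fun j => ¬ Bad Ts k ε ℓ star j t (Y j)) (topLevel Ts k t)

open Classical in
/-- The position of the walk after a visit of time `t` with bucket contents `Y`: the walk jumps as
far as it can from the largest good level, or by one smallest block if there is none. -/
def nextPos (t : ℕ) (Y : ℕ → Set (Fin n × ℝ)) : ℕ :=
  if ∀ j ≤ topLevel Ts k t, Bad Ts k ε ℓ star j t (Y j) then t + Ts 0
  else
    let i := goodLevel Ts k ε ℓ star t Y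
    Nat.findGreatest (CanJump Ts k ε ℓ star i t (Y i)) (Ts k)

/-- The first time visited by the walk which is at least `t`. -/
def walkPos (X : ℕ → ℕ → Set (Fin n × ℝ)) : ℕ → ℕ
  | 0 => 0
  | t + 1 => if walkPos X t = t then nextPos Ts k ε ℓ star t (X t) else walkPos X t

/-- The walk visits time `t`. -/
def Visited (X : ℕ → ℕ → Set (Fin n × ℝ)) (t : ℕ) : Prop := walkPos Ts k ε ℓ star X t = t

/-- The time `s` is visited and the levels from `i` up to the top level are bad. -/
structure BadTime (X : ℕ → ℕ → Set (Fin n × ℝ)) (i s : ℕ) : Prop where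
  dvd : Ts i ∣ s
  visited : Visited Ts k ε ℓ star X s
  bad : ∀ j, i ≤ j → j ≤ topLevel Ts k s → Bad Ts k ε ℓ star j s (X s j)

/-- The days lying in a block of size `Ts j` whose start is bad at level `j`. -/
def BadDay (X : ℕ → ℕ → Set (Fin n × ℝ)) (j x : ℕ) : Prop :=
  j < k → BadTime Ts k ε ℓ star X j (x / Ts j * Ts j)

theorem nextPos_cases (t : ℕ) (Y : ℕ → Set (Fin n × ℝ)) :
    ((∀ j ≤ topLevel Ts k t, Bad Ts k ε ℓ star j t (Y j)) ∧
        nextPos Ts k ε ℓ star t Y = t + Ts 0) ∨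
      ∃ i ≤ topLevel Ts k t,
        (∀ j, i < j → j ≤ topLevel Ts k t → Bad Ts k ε ℓ star j t (Y j)) ∧
        CanJump Ts k ε ℓ star i t (Y i) (nextPos Ts k ε ℓ star t Y) := by
  classical
  by_cases h : ∀ j ≤ topLevel Ts k t, Bad Ts k ε ℓ star j t (Y j)
  · exact .inl ⟨h, if_pos h⟩
  have hnext : nextPos Ts k ε ℓ star t Y = _ := if_neg h
  push Not at h
  obtain ⟨j, hj, hgood⟩ := h
  have hspec : ¬ Bad Ts k ε ℓ star (goodLevel Ts k ε ℓ star t Y) t _ :=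
    Nat.findGreatest_spec (P := fun j => ¬ Bad Ts k ε ℓ star j t (Y j)) hj hgood
  refine .inr ⟨goodLevel Ts k ε ℓ star t Y, Nat.findGreatest_le _, fun j h1 h2 =>
    not_not.1 (Nat.findGreatest_is_greatest h1 h2), ?_⟩
  obtain ⟨v, hv⟩ := not_forall_not.1 hspec
  rw [hnext]
  exact Nat.findGreatest_spec hv.le_end hv

variable {Ts k ε ℓ star}

theorem nextPos_eq_of_canJump {t i : ℕ} {Y : ℕ → Set (Fin n × ℝ)} (hi : i ≤ topLevel Ts k t)
    (hbad : ∀ j, i < j → j ≤ topLevel Ts k t → Bad Ts k ε ℓ star j t (Y j))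
    (hjump : CanJump Ts k ε ℓ star i t (Y i) (Ts k)) : nextPos Ts k ε ℓ star t Y = Ts k := by
  classical
  have hgood : ¬ Bad Ts k ε ℓ star i t (Y i) := fun h => h _ hjump
  have hlevel : goodLevel Ts k ε ℓ star t Y = i :=
    Nat.findGreatest_eq_iff.2 ⟨hi, fun _ => hgood, fun j h1 h2 h3 => h3 (hbad j h1 h2)⟩
  rw [nextPos, if_neg fun h => hgood (h i hi), hlevel]
  exact le_antisymm (Nat.findGreatest_le _) (Nat.le_findGreatest le_rfl hjump)

variable {X : ℕ → ℕ → Set (Fin n × ℝ)}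

theorem walkPos_congr {X' : ℕ → ℕ → Set (Fin n × ℝ)} {t : ℕ} (h : ∀ u < t, X u = X' u) :
    walkPos Ts k ε ℓ star X t = walkPos Ts k ε ℓ star X' t := by
  induction t with
  | zero => rfl
  | succ t ih => simp only [walkPos, ih fun u hu => h u (by omega), h t (by omega)]

theorem BadTime.congr {X' : ℕ → ℕ → Set (Fin n × ℝ)} {i s : ℕ} (h : ∀ u ≤ s, X u = X' u)
    (hb : BadTime Ts k ε ℓ star X i s) : BadTime Ts k ε ℓ star X' i s where
  dvd := hb.dvd
  visited := (walkPos_congr fun u hu => h u hu.le).symm.trans hb.visited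
  bad := h s le_rfl ▸ hb.bad

theorem lt_nextPos (h0 : 0 < Ts 0) (t : ℕ) (Y : ℕ → Set (Fin n × ℝ)) :
    t < nextPos Ts k ε ℓ star t Y := by
  rcases nextPos_cases Ts k ε ℓ star t Y with ⟨-, h⟩ | ⟨i, -, -, h⟩
  · rw [h]
    exact Nat.lt_add_of_pos_right h0
  · exact h.lt

theorem exists_visited_le (h0 : 0 < Ts 0) (t : ℕ) : ∃ u ≤ t, Visited Ts k ε ℓ star X u ∧
    (u < t → t ≤ nextPos Ts k ε ℓ star u (X u) ∧
      walkPos Ts k ε ℓ star X t = nextPos Ts k ε ℓ star u (X u)) := by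
  induction t with
  | zero => exact ⟨0, le_rfl, rfl, fun h => absurd h (lt_irrefl _)⟩
  | succ t ih =>
    obtain ⟨u, hu, hv, h⟩ := ih
    by_cases ht : walkPos Ts k ε ℓ star X t = t
    · refine ⟨t, Nat.le_succ t, ht, fun _ => ⟨lt_nextPos h0 t (X t), ?_⟩⟩
      simp only [walkPos, ht, if_true]
    · have hut : u < t := lt_of_le_of_ne hu fun h => ht (h ▸ hv)
      obtain ⟨h1, h2⟩ := h hut
      refine ⟨u, by omega, hv, fun _ => ⟨by omega, ?_⟩⟩
      simp only [walkPos]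
      rw [if_neg ht, h2]

namespace Visited

variable {u t : ℕ}

theorem walkPos_eq (hu : Visited Ts k ε ℓ star X u) (h1 : u < t)
    (h2 : t ≤ nextPos Ts k ε ℓ star u (X u)) :
    walkPos Ts k ε ℓ star X t = nextPos Ts k ε ℓ star u (X u) := by
  induction t, h1 using Nat.le_induction with
  | base => simp only [walkPos, show walkPos Ts k ε ℓ star X u = u from hu, if_true]
  | succ t _ ih =>
    have := ih (by omega)
    simp only [walkPos]
    rw [if_neg (by omega), this]

theorem nextPos_le (hu : Visited Ts k ε ℓ star X u) (ht : Visited Ts k ε ℓ star X t)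
    (hut : u < t) : nextPos Ts k ε ℓ star u (X u) ≤ t := by
  by_contra! h
  exact h.ne' ((hu.walkPos_eq hut h.le).symm.trans ht)

theorem visited_nextPos (h0 : 0 < Ts 0) (hu : Visited Ts k ε ℓ star X u) :
    Visited Ts k ε ℓ star X (nextPos Ts k ε ℓ star u (X u)) :=
  hu.walkPos_eq (lt_nextPos h0 u (X u)) le_rfl

end Visited

theorem dvd_walkPos (hS : BlockSizes Ts k) (t : ℕ) : Ts 0 ∣ walkPos Ts k ε ℓ star X t := by
  induction t with
  | zero => exact dvd_zero _
  | succ t ih =>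
    simp only [walkPos]
    split_ifs with ht
    · rcases nextPos_cases Ts k ε ℓ star t (X t) with ⟨-, h⟩ | ⟨i, hi, -, h⟩
      · rw [h]
        exact (ht ▸ ih).add dvd_rfl
      · exact hS.zero_dvd_of_dvd (hi.trans (hS.topLevel_lt t).le) h.dvd
    · exact ih

theorem Visited.dvd (hS : BlockSizes Ts k) {t : ℕ} (ht : Visited Ts k ε ℓ star X t) : Ts 0 ∣ t := by
  have := dvd_walkPos (ε := ε) (ℓ := ℓ) (star := star) (X := X) hS t
  rwa [show walkPos Ts k ε ℓ star X t = t from ht] at this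

/-- A jump over the start of a block of level `j` cannot end inside that block. -/
theorem Visited.blockStart_visited (hS : BlockSizes Ts k) {p u j : ℕ}
    (hu : Visited Ts k ε ℓ star X u) (huT : u < Ts k) (hj : j < k) (hdp : Ts j ∣ p) (hpu : p ≤ u)
    (hup : u < p + Ts j) : Visited Ts k ε ℓ star X p := by
  obtain ⟨w, hwp, hw, h⟩ :=
    exists_visited_le (ε := ε) (ℓ := ℓ) (star := star) (X := X) hS.pos_zero p
  rcases hwp.eq_or_lt with rfl | hlt
  · exact hw
  obtain ⟨hpnext, hwalk⟩ := h hlt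
  rcases hpnext.eq_or_lt with heq | hpnext
  · exact hwalk.trans heq.symm
  exfalso
  have hnextu := hw.nextPos_le hu (by omega)
  rcases nextPos_cases Ts k ε ℓ star w (X w) with ⟨-, hstep⟩ | ⟨i, hi, -, hjump⟩
  · have := add_le_of_dvd_of_lt (hw.dvd hS) (hS.zero_dvd_of_dvd hj.le hdp) hlt
    omega
  rcases hjump.enclosed with hend | hblock
  · omega
  have hd0 := hS.zero_dvd_of_dvd (hi.trans_lt (hS.topLevel_lt w)).le hjump.dvd
  exact not_dvd_of_lt_of_lt_add hdp hpnext (hnextu.trans_lt hup)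
    (hS.dvd_of_blockStart_lt hj hd0 hdp hpnext.le (by omega))

/-- A jump from level `j` or above at the start of the block would have passed over `u`. -/
theorem Visited.badTime_blockStart (hS : BlockSizes Ts k) {u j : ℕ}
    (hu : Visited Ts k ε ℓ star X u) (huT : u < Ts k) (hj : j < k) (hlev : topLevel Ts k u < j) :
    BadTime Ts k ε ℓ star X j (u / Ts j * Ts j) := by
  set p := u / Ts j * Ts j
  have hpu : p ≤ u := Nat.div_mul_le_self _ _
  have hup : u < p + Ts j := Nat.lt_div_mul_add (hS.pos hj.le)
  have hdp : Ts j ∣ p := dvd_mul_left _ _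
  have hlt : p < u := hpu.lt_of_ne fun h => hlev.not_ge (le_topLevel hj (h ▸ hdp))
  have hp := hu.blockStart_visited hS huT hj hdp hpu hup
  refine ⟨hdp, hp, fun i hi1 hi2 => ?_⟩
  rcases nextPos_cases Ts k ε ℓ star p (X p) with ⟨hbad, -⟩ | ⟨i', hi', hbad, hjump⟩
  · exact hbad i hi2
  refine hbad i (lt_of_not_ge fun hle => ?_) hi2
  have hik : i' < k := hi'.trans_lt (hS.topLevel_lt p)
  exact not_dvd_of_lt_of_lt_add hdp hjump.lt ((hp.nextPos_le hu hlt).trans_lt hup)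
    ((hS.dvd_of_le (hi1.trans hle) hik.le).trans hjump.dvd)

theorem nestedBlocks_badDay (hS : BlockSizes Ts k) (X : ℕ → ℕ → Set (Fin n × ℝ)) :
    NestedBlocks Ts k (BadDay Ts k ε ℓ star X) where
  top x h := absurd h (lt_irrefl _)
  mono_succ j hj x hx h hj1 := by
    have hb := h hj
    set b := x / Ts j * Ts j with hbdef
    have hbx : b ≤ x := Nat.div_mul_le_self _ _
    have hblock : b / Ts (j + 1) = x / Ts (j + 1) := by
      obtain ⟨c, hc⟩ := hS.dvd_succ j hj
      rw [hc, ← Nat.div_div_eq_div_mul, ← Nat.div_div_eq_div_mul, hbdef,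
        Nat.mul_div_cancel _ (hS.pos hj.le)]
    rw [← hblock]
    by_cases hd : Ts (j + 1) ∣ b
    · rw [Nat.div_mul_cancel hd]
      exact ⟨hd, hb.visited, fun i h1 h2 => hb.bad i (by omega) h2⟩
    · exact hb.visited.badTime_blockStart hS (by omega) hj1
        (lt_of_not_ge fun hle => hd (hS.dvd_of_le_topLevel (hb.visited.dvd hS) hle))
  congr j _ x y hxy h hj := hxy ▸ h hj

theorem Visited.leg (hS : BlockSizes Ts k) (hX : BucketPath Ts k ε ℓ X) {u i v : ℕ}
    (hu : Visited Ts k ε ℓ star X u) (hi : i ≤ topLevel Ts k u)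
    (hbad : ∀ j, i < j → j ≤ topLevel Ts k u → Bad Ts k ε ℓ star j u (X u j))
    (hjump : CanJump Ts k ε ℓ star i u (X u i) v) (hv : v = nextPos Ts k ε ℓ star u (X u)) :
    ∃ z, Leg Ts k X (BadDay Ts k ε ℓ star X) i u v z ∧
      cumLoss ℓ u v z.1 ≤ (1 + ε) * cumLoss ℓ u v star := by
  have huv := hjump.lt
  have hvT := hjump.le_end
  have hik : i < k := hi.trans_lt (hS.topLevel_lt u)
  have hdu := hS.dvd_of_le_topLevel (hu.dvd hS) hi
  obtain ⟨z, hz, hzloss⟩ := hjump.exists_competitor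
  rw [hX.evolve_eq hik (by omega)] at hz
  refine ⟨z, ⟨hik, huv, hvT, hdu, hjump.dvd, hjump.enclosed, fun hi1 => ?_, fun hday => ?_, ?_, ?_⟩,
    hzloss⟩
  · rcases hi.eq_or_lt with rfl | hlt
    · exact hu.badTime_blockStart hS (by omega) hi1 (Nat.lt_succ_self _)
    · have hd := hS.dvd_of_le_topLevel (hu.dvd hS) hlt
      rw [Nat.div_mul_cancel hd]
      exact ⟨hd, hu, fun j hj1 hj2 => hbad j hj1 hj2⟩
  · have hbadu := (hday hik).bad
    rw [Nat.div_mul_cancel hdu] at hbadu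
    exact hbadu i le_rfl hi v hjump
  · intro x hux hxv l hl hdl hday
    have hx := (hday hl).visited
    rw [Nat.div_mul_cancel hdl] at hx
    exact hxv.not_ge (hv ▸ hu.nextPos_le hx hux)
  · intro w huw hwv
    have hcast : (u : ℝ) ≤ w := by exact_mod_cast huw
    exact hX.mem_of_mem_later hik (by omega : w ≤ u + (v - 1 - u)) (by omega) hz.1
      (hz.2.trans_le (by linarith))

theorem Visited.sum_levelValue_le_nextPos (hS : BlockSizes Ts k) (hX : BucketPath Ts k ε ℓ X)
    {q : ℕ → ℕ → ℝ} (hq : BlockCompetitive Ts k ℓ X q) (hε : 0 ≤ ε) (hℓ : ∀ t e, 0 ≤ ℓ t e) {u : ℕ}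
    (hu : Visited Ts k ε ℓ star X u) (huT : u < Ts k) :
    nextPos Ts k ε ℓ star u (X u) ≤ Ts k ∧
      ∑ x ∈ Finset.Ico u (nextPos Ts k ε ℓ star u (X u)),
          levelValue k (BadDay Ts k ε ℓ star X) q x ≤
        (1 + ε) ^ k * cumLoss ℓ u (nextPos Ts k ε ℓ star u (X u)) star := by
  have hU := nestedBlocks_badDay (ε := ε) (ℓ := ℓ) (star := star) hS X
  obtain ⟨v, hv⟩ : ∃ v, nextPos Ts k ε ℓ star u (X u) = v := ⟨_, rfl⟩
  rcases nextPos_cases Ts k ε ℓ star u (X u) with ⟨hbad, hstep⟩ | ⟨i, hi, hbad, hjump⟩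
  · rw [hstep]
    have huT' := add_le_of_dvd_of_lt (hu.dvd hS) (hS.dvd_of_le (Nat.zero_le k) le_rfl) huT
    refine ⟨huT', ?_⟩
    rw [Finset.sum_eq_zero]
    · exact mul_nonneg (by positivity) (cumLoss_nonneg hℓ _ _ _)
    intro x hx
    obtain ⟨h1, h2⟩ := Finset.mem_Ico.1 hx
    refine hU.levelValue_eq_zero (by omega) fun _ => ?_
    rw [div_eq_div_of_dvd (hu.dvd hS) h1 h2, Nat.div_mul_cancel (hu.dvd hS)]
    exact ⟨hu.dvd hS, hu, fun j _ hj => hbad j hj⟩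
  · rw [hv] at hjump ⊢
    obtain ⟨z, hleg, hz⟩ := hu.leg hS hX hi hbad hjump hv.symm
    refine ⟨hjump.le_end, ?_⟩
    calc _ ≤ (1 + ε) ^ (k - 1) * cumLoss ℓ u v z.1 :=
          hleg.sum_levelValue_le hS hX hU hq hε hℓ (by omega)
      _ ≤ (1 + ε) ^ (k - 1) * ((1 + ε) * cumLoss ℓ u v star) := by gcongr
      _ = (1 + ε) ^ k * cumLoss ℓ u v star := by
          rw [← mul_assoc, pow_sub_one_mul hS.k_pos.ne']

theorem sum_levelValue_badDay_le (hS : BlockSizes Ts k) (hX : BucketPath Ts k ε ℓ X)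
    {q : ℕ → ℕ → ℝ} (hq : BlockCompetitive Ts k ℓ X q) (hε : 0 ≤ ε) (hℓ : ∀ t e, 0 ≤ ℓ t e) :
    ∑ x ∈ Finset.range (Ts k), levelValue k (BadDay Ts k ε ℓ star X) q x ≤
      (1 + ε) ^ k * cumLoss ℓ 0 (Ts k) star := by
  suffices main : ∀ c u, Ts k - u ≤ c → u ≤ Ts k → Visited Ts k ε ℓ star X u →
      ∑ x ∈ Finset.Ico u (Ts k), levelValue k (BadDay Ts k ε ℓ star X) q x ≤
        (1 + ε) ^ k * cumLoss ℓ u (Ts k) star by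
    rw [Finset.range_eq_Ico]
    exact main (Ts k) 0 (by omega) (Nat.zero_le _) rfl
  intro c
  induction c with
  | zero =>
    intro u h1 h2 _
    simp [show u = Ts k by omega, cumLoss]
  | succ c ih =>
    intro u h1 h2 hu
    rcases h2.eq_or_lt with rfl | huT
    · simp [cumLoss]
    have hlt := lt_nextPos (k := k) (ε := ε) (ℓ := ℓ) (star := star) hS.pos_zero u (X u)
    obtain ⟨hle, hsum⟩ := hu.sum_levelValue_le_nextPos hS hX hq hε hℓ huT
    rw [← Finset.sum_Ico_consecutive _ hlt.le hle, ← cumLoss_add ℓ hlt.le hle, mul_add]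
    exact add_le_add hsum (ih _ (by omega) hle (hu.visited_nextPos hS.pos_zero))

end Walk

/-! ### Combining the levels -/

section Mixing

variable {Ts : ℕ → ℕ} {k : ℕ} {U : ℕ → ℕ → Prop}

theorem NestedBlocks.iff_of_mem_block (hU : NestedBlocks Ts k U) (hS : BlockSizes Ts k)
    {i j b x : ℕ} (hij : i ≤ j) (hj : j ≤ k) (hd : Ts i ∣ b) (hx : x ∈ Finset.Ico b (b + Ts i)) :
    U j x ↔ U j b := by
  obtain ⟨h1, h2⟩ := Finset.mem_Ico.1 hx
  have hdiv : x / Ts j = b / Ts j := by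
    obtain ⟨c, hc⟩ := hS.dvd_of_le hij hj
    rw [hc, ← Nat.div_div_eq_div_mul, ← Nat.div_div_eq_div_mul, div_eq_div_of_dvd hd h1 h2]
  exact ⟨hU.congr j hj x b hdiv, hU.congr j hj b x hdiv.symm⟩

/-- Losses `Y j x` of the predictions of the levels `j < k` on day `x + 1`: on every block, the
prediction of level `j + 1` is worse by at most `ρ (j + 1)` per day than the pick of that level,
with loss `E (j + 1) x`, and than the prediction of level `j`. -/
structure MixedPredictions (Ts : ℕ → ℕ) (k : ℕ) (E Y : ℕ → ℕ → ℝ) (ρ : ℕ → ℝ) : Prop where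
  zero_eq : ∀ x < Ts k, Y 0 x = E 0 x
  le_pick : ∀ j, j + 1 < k → ∀ b, Ts (j + 1) ∣ b → b < Ts k →
    ∑ x ∈ Finset.Ico b (b + Ts (j + 1)), Y (j + 1) x ≤
      ∑ x ∈ Finset.Ico b (b + Ts (j + 1)), (E (j + 1) x + ρ (j + 1))
  le_pred : ∀ j, j + 1 < k → ∀ b, Ts (j + 1) ∣ b → b < Ts k →
    ∑ x ∈ Finset.Ico b (b + Ts (j + 1)), Y (j + 1) x ≤
      ∑ x ∈ Finset.Ico b (b + Ts (j + 1)), (Y j x + ρ (j + 1))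

namespace MixedPredictions

variable {E Y : ℕ → ℕ → ℝ} {ρ : ℕ → ℝ}

open Classical in
/-- On each block of level `i + 1`, follow the prediction of level `i` if the block lies in
`U (i + 1)` and the pick of level `i + 1` otherwise. -/
theorem sum_succ_le (hY : MixedPredictions Ts k E Y ρ) (hS : BlockSizes Ts k)
    (hU : NestedBlocks Ts k U) {i : ℕ} (hi : i + 1 < k) :
    ∑ x ∈ Finset.range (Ts k), (if U (i + 2) x then Y (i + 1) x else 0) ≤
      ∑ x ∈ Finset.range (Ts k), ((if U (i + 1) x then Y i x else 0) +
        ((if U (i + 2) x ∧ ¬ U (i + 1) x then E (i + 1) x else 0) +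
          if U (i + 2) x then ρ (i + 1) else 0)) := by
  rw [Finset.range_eq_Ico]
  refine sum_Ico_le_sum_Ico_of_blocks (dvd_zero _) (hS.dvd_of_le hi.le le_rfl) (Nat.zero_le _)
    fun b hb _ hbT => ?_
  have hU1 := fun x hx => hU.iff_of_mem_block (x := x) hS le_rfl hi.le hb hx
  have hU2 := fun x hx => hU.iff_of_mem_block (x := x) hS (Nat.le_succ _) hi hb hx
  rw [Finset.sum_congr rfl fun x hx => if_congr (hU2 x hx) rfl rfl,
    Finset.sum_congr rfl fun x hx => congrArg₂ (· + ·) (if_congr (hU1 x hx) rfl rfl)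
      (congrArg₂ (· + ·) (if_congr (and_congr (hU2 x hx) (not_congr (hU1 x hx))) rfl rfl)
        (if_congr (hU2 x hx) rfl rfl))]
  by_cases h2 : U (i + 2) b
  · by_cases h1 : U (i + 1) b
    · simpa [h1, h2] using hY.le_pred i hi b hb hbT
    · simpa [h1, h2] using hY.le_pick i hi b hb hbT
  · have h1 : ¬ U (i + 1) b := fun h => h2 (hU.mono_succ (i + 1) hi b hbT h)
    simp [h1, h2]

open Classical in
theorem sum_level_le (hY : MixedPredictions Ts k E Y ρ) (hS : BlockSizes Ts k)
    (hU : NestedBlocks Ts k U) (hE : ∀ x, E 0 x ≤ 1) (hρ : 0 ≤ ρ 0) {i : ℕ} (hi : i < k) :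
    ∑ x ∈ Finset.range (Ts k), (if U (i + 1) x then Y i x else 0) ≤
      ∑ x ∈ Finset.range (Ts k), ((if U 0 x then 1 else 0) +
        (levelValue (i + 1) U E x +
          ∑ j ∈ Finset.range (i + 1), if U (j + 1) x then ρ j else 0)) := by
  induction i with
  | zero =>
    refine Finset.sum_le_sum fun x hx => ?_
    have := hE x
    simp only [levelValue, zero_add, Finset.sum_range_one, hY.zero_eq x (Finset.mem_range.1 hx)]
    by_cases h0 : U 0 x <;> by_cases h1 : U 1 x <;> simp [h0, h1] <;> linarith
  | succ i ih =>
    refine (hY.sum_succ_le hS hU hi).trans ?_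
    rw [Finset.sum_add_distrib]
    refine (add_le_add_left (ih (by omega)) _).trans (le_of_eq ?_)
    rw [← Finset.sum_add_distrib]
    refine Finset.sum_congr rfl fun x _ => ?_
    rw [levelValue, levelValue, Finset.sum_range_succ _ (i + 1), Finset.sum_range_succ _ (i + 1)]
    ring

open Classical in
theorem sum_top_le (hY : MixedPredictions Ts k E Y ρ) (hS : BlockSizes Ts k)
    (hU : NestedBlocks Ts k U) (hE : ∀ x, E 0 x ≤ 1) (hρ : 0 ≤ ρ 0) :
    ∑ x ∈ Finset.range (Ts k), Y (k - 1) x ≤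
      ∑ x ∈ Finset.range (Ts k), ((if U 0 x then 1 else 0) +
        (levelValue k U E x + ∑ j ∈ Finset.range k, if U (j + 1) x then ρ j else 0)) := by
  have h := hY.sum_level_le hS hU hE hρ (Nat.sub_lt hS.k_pos one_pos)
  rw [show k - 1 + 1 = k from Nat.sub_add_cancel hS.k_pos] at h
  simpa only [hU.top, if_true] using h

end MixedPredictions

variable {n : ℕ} {ε : ℝ} {ℓ : ℕ → Fin n → ℝ} {star : Fin n} {X : ℕ → ℕ → Set (Fin n × ℝ)}

open Classical in
theorem sum_badDay_le_mul_card_badTime (hS : BlockSizes Ts k) {j : ℕ} (hj : j < k) :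
    ∑ x ∈ Finset.range (Ts k), (if BadDay Ts k ε ℓ star X j x then (1 : ℝ) else 0) ≤
      Ts j * ((Finset.range (Ts k)).filter (BadTime Ts k ε ℓ star X j)).card := by
  have hblock : ∀ b, Ts j ∣ b →
      ∑ x ∈ Finset.Ico b (b + Ts j), (if BadDay Ts k ε ℓ star X j x then (1 : ℝ) else 0) =
        if BadTime Ts k ε ℓ star X j b then (Ts j : ℝ) else 0 := fun b hb => by
    have hiff : BadDay Ts k ε ℓ star X j b ↔ BadTime Ts k ε ℓ star X j b := by
      rw [BadDay, Nat.div_mul_cancel hb]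
      exact ⟨fun h => h hj, fun h _ => h⟩
    rw [Finset.sum_congr rfl fun x hx => if_congr
      (((nestedBlocks_badDay hS X).iff_of_mem_block hS le_rfl hj.le hb hx).trans hiff) rfl rfl]
    simp
  have hpos := hS.pos hj.le
  calc _ ≤ ∑ x ∈ Finset.range (Ts k), if BadTime Ts k ε ℓ star X j x then (Ts j : ℝ) else 0 := by
        rw [Finset.range_eq_Ico]
        refine sum_Ico_le_sum_Ico_of_blocks (dvd_zero _) (hS.dvd_of_le hj.le le_rfl)
          (Nat.zero_le _) fun b hb _ _ => ?_
        rw [hblock b hb]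
        exact Finset.single_le_sum
          (f := fun x => if BadTime Ts k ε ℓ star X j x then (Ts j : ℝ) else 0)
          (fun x _ => by positivity) (Finset.mem_Ico.2 ⟨le_rfl, by omega⟩)
    _ = _ := by rw [← Finset.sum_filter, Finset.sum_const, nsmul_eq_mul, mul_comm]

open Classical in
theorem ite_add_levelValue_le {E : ℕ → ℕ → ℝ} {ρ : ℕ → ℝ} (hρ : ∀ j, 0 ≤ ρ j) (x : ℕ) :
    levelValue k U E x + ∑ j ∈ Finset.range k, (if U (j + 1) x then ρ j else 0) ≤
      levelValue k U (fun j x => E j x - ρ j) x +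
        ∑ j ∈ Finset.range k, 2 * ρ j * (if U (j + 1) x then 1 else 0) := by
  rw [levelValue, levelValue, ← Finset.sum_add_distrib, ← Finset.sum_add_distrib]
  refine Finset.sum_le_sum fun j _ => ?_
  have := hρ j
  by_cases h1 : U (j + 1) x <;> by_cases h0 : U j x <;> simp [h0, h1] <;> linarith

open Classical in
theorem MixedPredictions.sum_top_le_of_card_badTime_le {E Y : ℕ → ℕ → ℝ} {ρ : ℕ → ℝ} {Z : ℝ}
    (hY : MixedPredictions Ts k E Y ρ) (hS : BlockSizes Ts k) (hX : BucketPath Ts k ε ℓ X)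
    (hε : 0 ≤ ε) (hℓ : ∀ t e, 0 ≤ ℓ t e) (hρ : ∀ j, 0 ≤ ρ j) (hE : ∀ x, E 0 x ≤ 1)
    (hEX : BlockCompetitive Ts k ℓ X fun j x => E j x - ρ j)
    (hZ : ∀ j < k, (((Finset.range (Ts k)).filter (BadTime Ts k ε ℓ star X j)).card : ℝ) ≤ Z) :
    ∑ x ∈ Finset.range (Ts k), Y (k - 1) x ≤
      (1 + ε) ^ k * cumLoss ℓ 0 (Ts k) star + Ts 0 * Z +
        ∑ j ∈ Finset.range k, 2 * ρ j * (if j + 1 < k then Ts (j + 1) * Z else Ts k) := by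
  set U := BadDay Ts k ε ℓ star X
  have hcount : ∀ j < k, ∑ x ∈ Finset.range (Ts k), (if U j x then (1 : ℝ) else 0) ≤ Ts j * Z :=
    fun j hj => (sum_badDay_le_mul_card_badTime hS hj).trans
      (mul_le_mul_of_nonneg_left (hZ j hj) (Nat.cast_nonneg _))
  have hcount_succ : ∀ j, ∑ x ∈ Finset.range (Ts k), (if U (j + 1) x then (1 : ℝ) else 0) ≤
      if j + 1 < k then Ts (j + 1) * Z else (Ts k : ℝ) := by
    intro j
    split_ifs with h
    · exact hcount (j + 1) h
    · calc _ ≤ ∑ _ ∈ Finset.range (Ts k), (1 : ℝ) :=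
            Finset.sum_le_sum fun _ _ => by split_ifs <;> norm_num
        _ = Ts k := by simp
  calc _ ≤ ∑ x ∈ Finset.range (Ts k), ((if U 0 x then 1 else 0) +
          (levelValue k U (fun j x => E j x - ρ j) x +
            ∑ j ∈ Finset.range k, 2 * ρ j * (if U (j + 1) x then 1 else 0))) :=
        (hY.sum_top_le hS (nestedBlocks_badDay hS X) hE (hρ 0)).trans
          (Finset.sum_le_sum fun _ _ => add_le_add_right (ite_add_levelValue_le hρ _) _)
    _ = ∑ x ∈ Finset.range (Ts k), levelValue k U (fun j x => E j x - ρ j) x +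
          ∑ x ∈ Finset.range (Ts k), (if U 0 x then 1 else 0) +
          ∑ j ∈ Finset.range k, 2 * ρ j *
            ∑ x ∈ Finset.range (Ts k), (if U (j + 1) x then 1 else 0) := by
        simp only [Finset.sum_add_distrib, Finset.mul_sum]
        rw [Finset.sum_comm (s := Finset.range (Ts k))]
        ring
    _ ≤ _ := by
        refine add_le_add (add_le_add (sum_levelValue_badDay_le hS hX hEX hε hℓ)
          (hcount 0 hS.k_pos)) (Finset.sum_le_sum fun j _ => ?_)
        exact mul_le_mul_of_nonneg_left (hcount_succ j) (mul_nonneg zero_le_two (hρ j))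

end Mixing

/-! ### Planting the comparator among the samples -/

section PlantedSamples

variable {n : ℕ} {Ts : ℕ → ℕ} {k : ℕ} {ε : ℝ} {ℓ : ℕ → Fin n → ℝ} {star : Fin n}

/-- The entries with experts `S r` and arrival times `arr r`. -/
def sampleSet {m : ℕ} (S : Fin m → Fin n) (arr : Fin m → ℝ) : Set (Fin n × ℝ) :=
  Set.range fun r => (S r, arr r)

/-- Replace the samples in the slots `R` by `star`. -/
def plant {ι α : Type*} [DecidableEq ι] (star : α) (R : Finset ι) (S : ι → α) : ι → α :=
  fun r => if r ∈ R then star else S r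

theorem plant_empty {ι α : Type*} [DecidableEq ι] (star : α) (S : ι → α) :
    plant star ∅ S = S := by
  funext r
  simp [plant]

theorem sep_lt_sampleSet_plant {m : ℕ} {arr : Fin m → ℝ} {R : Finset (Fin m)} {c : ℝ}
    (hc : ∀ r ∈ R, c ≤ arr r) (base : Set (Fin n × ℝ)) (S : Fin m → Fin n) :
    {x ∈ base ∪ sampleSet (plant star R S) arr | x.2 < c} =
      {x ∈ base ∪ sampleSet S arr | x.2 < c} := by
  have hnot : ∀ r, arr r < c → r ∉ R := fun r hlt hr => (hc r hr).not_gt hlt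
  ext x
  constructor
  all_goals
    rintro ⟨hx | ⟨r, rfl⟩, hlt⟩
    · exact ⟨.inl hx, hlt⟩
    · exact ⟨.inr ⟨r, by simp [plant, hnot r hlt]⟩, hlt⟩

/-- An entry that evicts the copy of `star` arrived before it, hence also belongs to the other
contents `Y`, and its loss shows that `Y` is not bad. -/
theorem Bad.mem_evolve {i t : ℕ} {Y Y' : Set (Fin n × ℝ)} (hbad : Bad Ts k ε ℓ star i t Y)
    (hℓ : ∀ t e, 0 ≤ ℓ t e) {a : ℝ} (ha : a ∈ Set.Ico (t : ℝ) (t + 1))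
    (heq : {x ∈ Y' | x.2 < a} = {x ∈ Y | x.2 < a}) (hmem : (star, a) ∈ Y') {d : ℕ}
    (hd : t + d < Ts k) : (star, a) ∈ evolve Ts k ε ℓ i t Y' d := by
  induction d with
  | zero => exact hmem
  | succ d ih =>
    have hstay := ih (by omega)
    simp only [evolve]
    split_ifs with hdvd
    · refine ⟨hstay, fun ⟨hτ, x', hx', hlt, hloss⟩ => ?_⟩
      have hx'Y : x' ∈ {x ∈ evolve Ts k ε ℓ i t Y d | x.2 < a} := by
        rw [← evolve_sep_lt, ← heq, evolve_sep_lt]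
        exact ⟨hx', hlt⟩
      have hτt : blockStart Ts k (t + d + 1) ≤ t := by
        have : (blockStart Ts k (t + d + 1) : ℝ) < t + 1 := by
          linarith [ha.2, show _ ≤ a from hτ]
        exact Nat.lt_succ_iff.1 (by exact_mod_cast this)
      have hfloor' : ⌊x'.2⌋₊ ≤ t := by
        refine Nat.lt_succ_iff.1 ((Nat.floor_lt' (Nat.succ_ne_zero t)).2 ?_)
        push_cast
        exact (show x'.2 < a from hlt).trans ha.2
      have hfloor : ⌊a⌋₊ = t := (Nat.floor_eq_iff (t.cast_nonneg.trans ha.1)).2 ha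
      refine hbad (t + d + 1) ⟨by omega, by omega, hdvd, .inr hτt, x', ?_, ?_⟩
      · rw [show t + d + 1 - 1 - t = d by omega]
        exact hx'Y.1
      · simp only [hfloor] at hloss
        exact (cumLoss_anti_left hℓ hfloor' _ _).trans hloss
    · exact hstay

theorem Bad.canJump_plant (hS : BlockSizes Ts k) (hε : 0 ≤ ε) (hℓ : ∀ t e, 0 ≤ ℓ t e) {m i t : ℕ}
    (hi : i < k) (ht : t < Ts k) {base : Set (Fin n × ℝ)} {arr : Fin m → ℝ}
    (harr : ∀ r, arr r ∈ Set.Ico (t : ℝ) (t + 1)) {S : Fin m → Fin n}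
    (hbad : Bad Ts k ε ℓ star i t (base ∪ sampleSet S arr)) {R : Finset (Fin m)}
    (hR : R.Nonempty) :
    CanJump Ts k ε ℓ star i t (base ∪ sampleSet (plant star R S) arr) (Ts k) := by
  obtain ⟨r₀, hr₀, hmin⟩ := R.exists_min_image arr hR
  have hmem : (star, arr r₀) ∈ base ∪ sampleSet (plant star R S) arr :=
    .inr ⟨r₀, by simp [plant, hr₀]⟩
  exact ⟨ht, le_rfl, hS.dvd_of_le hi.le le_rfl, .inl rfl, _,
    hbad.mem_evolve hℓ (harr r₀) (sep_lt_sampleSet_plant hmin base S) hmem (by omega),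
    le_mul_of_one_le_left (cumLoss_nonneg hℓ _ _ _) (by linarith)⟩

theorem Bad.ne_star (hS : BlockSizes Ts k) (hε : 0 ≤ ε) (hℓ : ∀ t e, 0 ≤ ℓ t e) {m i t : ℕ}
    (hi : i < k) (ht : t < Ts k) {base : Set (Fin n × ℝ)} {arr : Fin m → ℝ}
    (harr : ∀ r, arr r ∈ Set.Ico (t : ℝ) (t + 1)) {S : Fin m → Fin n}
    (hbad : Bad Ts k ε ℓ star i t (base ∪ sampleSet S arr)) (r : Fin m) : S r ≠ star := by
  intro h
  have hplant : plant star {r} S = S := by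
    funext r'
    by_cases hr : r' = r <;> simp [plant, hr, h]
  exact hbad _ (hplant ▸ hbad.canJump_plant hS hε hℓ hi ht harr (Finset.singleton_nonempty r))

end PlantedSamples

/-- Pair a sample `S` in `B` with a second row `c` of samples and swap the entries of `S i` and `c`
wherever `c` is `star`. This is injective, since the resulting second row avoids `star`. -/
theorem card_mul_pow_le_of_plant {κ ι α : Type*} [DecidableEq κ] [Fintype ι] [DecidableEq ι]
    [Fintype α] (i : κ) (star : α) {B G : Finset (κ → ι → α)}
    (hB : ∀ S ∈ B, ∀ r, S i r ≠ star)
    (hG : ∀ S ∈ B, ∀ R, Function.update S i (plant star R (S i)) ∈ G) :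
    B.card * Fintype.card α ^ Fintype.card ι ≤
      G.card * (Fintype.card α - 1) ^ Fintype.card ι := by
  classical
  let swap : (κ → ι → α) × (ι → α) → (κ → ι → α) × (ι → α) := fun x =>
    (Function.update x.1 i (plant star {r | x.2 r = star} (x.1 i)),
      fun r => if x.2 r = star then x.1 i r else x.2 r)
  have hmaps : Set.MapsTo swap (B ×ˢ (Finset.univ : Finset (ι → α)) : Finset _)
      (G ×ˢ Fintype.piFinset fun _ : ι => Finset.univ.erase star : Finset _) := by
    rintro ⟨S, c⟩ hx
    have hS : S ∈ B := (Finset.mem_product.1 (Finset.mem_coe.1 hx)).1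
    refine Finset.mem_coe.2 (Finset.mem_product.2 ⟨hG S hS _, Fintype.mem_piFinset.2 fun r => ?_⟩)
    refine Finset.mem_erase.2 ⟨?_, Finset.mem_univ _⟩
    simp only [swap]
    split_ifs with h
    exacts [hB S hS r, h]
  have hinj : Set.InjOn swap (B ×ˢ (Finset.univ : Finset (ι → α)) : Finset _) := by
    rintro ⟨S, c⟩ hx ⟨S', c'⟩ hx' heq
    have hS := hB S (Finset.mem_product.1 (Finset.mem_coe.1 hx)).1
    have hS' := hB S' (Finset.mem_product.1 (Finset.mem_coe.1 hx')).1
    obtain ⟨h1, h2⟩ := Prod.ext_iff.1 heq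
    have hrow : ∀ r, S i r = S' i r ∧ c r = c' r := fun r => by
      have h1r := congrFun (congrFun h1 i) r
      have h2r := congrFun h2 r
      have := hS r
      have := hS' r
      simp only [swap, plant, Function.update_self, Finset.mem_filter, Finset.mem_univ,
        true_and] at h1r h2r
      grind
    refine Prod.ext (funext fun j => ?_) (funext fun r => (hrow r).2)
    by_cases hj : j = i
    · exact hj ▸ funext fun r => (hrow r).1
    · simpa [swap, hj] using congrFun h1 j
  simpa [Fintype.card_piFinset, Finset.card_product] using
    Finset.card_le_card_of_injOn swap hmaps hinj

theorem sub_one_pow_mul_exp_le {x : ℝ} (hx : 1 ≤ x) (m : ℕ) :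
    (x - 1) ^ m * Real.exp (m / x) ≤ x ^ m := by
  have hbase : (x - 1) * Real.exp (1 / x) ≤ x := by
    calc (x - 1) * Real.exp (1 / x) = x * ((1 - 1 / x) * Real.exp (1 / x)) := by field_simp
      _ ≤ x * (Real.exp (-(1 / x)) * Real.exp (1 / x)) := by
          gcongr
          exact Real.one_sub_le_exp_neg _
      _ = x := by rw [← Real.exp_add, neg_add_cancel, Real.exp_zero, mul_one]
  have hexp : Real.exp (m / x) = Real.exp (1 / x) ^ m := by
    rw [← Real.exp_nat_mul, mul_one_div]
  rw [hexp, ← mul_pow]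
  exact pow_le_pow_left₀ (mul_nonneg (by linarith) (Real.exp_pos _).le) hbase m

open Classical in
theorem expect_uniformOfFintype_le {Ω : Type*} [Fintype Ω] [Nonempty Ω] {B D : Ω → Prop}
    (hdisj : ∀ ω, B ω → ¬ D ω) {θ : ℝ} (hθ : 0 ≤ θ)
    (hcard : (Finset.univ.filter B).card * θ ≤
      (Finset.univ.filter B).card + (Finset.univ.filter D).card)
    {F : Ω → ℝ≥0∞} {c : ℝ≥0∞} (hFB : ∀ ω, B ω → F ω ≤ c * ENNReal.ofReal θ)
    (hFD : ∀ ω, D ω → F ω = 0) (hF : ∀ ω, ¬ B ω → F ω ≤ c) :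
    expect (PMF.uniformOfFintype Ω) F ≤ c := by
  set G : Ω → ℝ := fun ω => (1 - if D ω then 1 else 0) + (if B ω then 1 else 0) * (θ - 1) with hG
  have hG_nonneg : ∀ ω, 0 ≤ G ω := fun ω => by
    by_cases hb : B ω
    · simpa [hG, hb, hdisj ω hb] using hθ
    · by_cases hd : D ω <;> simp [hG, hb, hd]
  have hFG : ∀ ω, F ω ≤ c * ENNReal.ofReal (G ω) := fun ω => by
    by_cases hb : B ω
    · simpa [hG, hb, hdisj ω hb] using hFB ω hb
    · by_cases hd : D ω
      · simp [hFD ω hd]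
      · simpa [hG, hb, hd] using hF ω hb
  have hsum : ∑ ω, G ω ≤ Fintype.card Ω := by
    simp only [hG]
    rw [Finset.sum_add_distrib, Finset.sum_sub_distrib, ← Finset.sum_mul, Finset.sum_boole,
      Finset.sum_boole]
    simp only [Finset.sum_const, Finset.card_univ, nsmul_eq_mul, mul_one]
    linarith
  rw [expect_uniformOfFintype]
  refine ENNReal.div_le_of_le_mul ?_
  calc ∑ ω, F ω ≤ ∑ ω, c * ENNReal.ofReal (G ω) := Finset.sum_le_sum fun ω _ => hFG ω
    _ = c * ENNReal.ofReal (∑ ω, G ω) := by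
        rw [← Finset.mul_sum, ENNReal.ofReal_sum_of_nonneg fun ω _ => hG_nonneg ω]
    _ ≤ c * ENNReal.ofReal (Fintype.card Ω) := by gcongr
    _ = c * Fintype.card Ω := by rw [ENNReal.ofReal_natCast]

open Classical in
theorem expect_uniformOfFintype_le_of_plant {κ : Type*} [Fintype κ] [DecidableEq κ] {n m : ℕ}
    [NeZero n] (i : κ) (star : Fin n) {B D : (κ → Fin m → Fin n) → Prop}
    (hB : ∀ S, B S → ∀ r, S i r ≠ star)
    (hBD : ∀ S, B S → ∀ R : Finset (Fin m), R.Nonempty →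
      D (Function.update S i (plant star R (S i))))
    (hdisj : ∀ S, B S → ¬ D S) {F : (κ → Fin m → Fin n) → ℝ≥0∞} {c : ℝ≥0∞}
    (hFB : ∀ S, B S → F S ≤ c * ENNReal.ofReal (Real.exp (m / n))) (hFD : ∀ S, D S → F S = 0)
    (hF : ∀ S, ¬ B S → F S ≤ c) :
    expect (PMF.uniformOfFintype (κ → Fin m → Fin n)) F ≤ c := by
  refine expect_uniformOfFintype_le hdisj (Real.exp_pos _).le ?_ hFB hFD hF
  set b := (Finset.univ.filter B).card
  set d := (Finset.univ.filter D).card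
  have hn : (1 : ℝ) ≤ n := by exact_mod_cast Nat.one_le_iff_ne_zero.2 (NeZero.ne n)
  have hcount : b * n ^ m ≤ (b + d) * (n - 1) ^ m := by
    have h := card_mul_pow_le_of_plant i star (B := Finset.univ.filter B)
      (G := Finset.univ.filter B ∪ Finset.univ.filter D)
      (fun S hS => hB S (Finset.mem_filter.1 hS).2) fun S hS R => by
        rcases R.eq_empty_or_nonempty with rfl | hR
        · rw [plant_empty, Function.update_eq_self]
          exact Finset.mem_union_left _ hS
        · exact Finset.mem_union_right _ (Finset.mem_filter.2
            ⟨Finset.mem_univ _, hBD S (Finset.mem_filter.1 hS).2 R hR⟩)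
    rw [Fintype.card_fin, Fintype.card_fin] at h
    exact h.trans (Nat.mul_le_mul_right _ (Finset.card_union_le _ _))
  have hcount_real : (b : ℝ) * (n : ℝ) ^ m ≤ (b + d) * ((n : ℝ) - 1) ^ m := by
    rw [← Nat.cast_pred (Nat.pos_of_ne_zero (NeZero.ne n))]
    exact_mod_cast hcount
  refine le_of_mul_le_mul_right ?_ (show (0 : ℝ) < (n : ℝ) ^ m by positivity)
  calc (b : ℝ) * Real.exp (m / n) * (n : ℝ) ^ m
      = ((b : ℝ) * (n : ℝ) ^ m) * Real.exp (m / n) := by ring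
    _ ≤ ((b + d) * ((n : ℝ) - 1) ^ m) * Real.exp (m / n) := by gcongr
    _ = (b + d) * (((n : ℝ) - 1) ^ m * Real.exp (m / n)) := by ring
    _ ≤ (b + d) * (n : ℝ) ^ m := by gcongr; exact sub_one_pow_mul_exp_le hn m

/-! ### Trajectories -/

section Trajectory

variable {n : ℕ} [NeZero n] (A : ArrivalRule) (Ts : ℕ → ℕ) (k m : ℕ) (ℓ : ℕ → Fin n → ℝ)

/-- The entries of bucket `i` that survive the update at time `t`. -/
def survivingEntries (t : ℕ) (s : State n) (i : ℕ) : List (Entry n) :=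
  evict (Real.log (Ts k : ℝ) / (m : ℝ)) (blockStart Ts k t) (s.bucket i)

/-- The experts that are forwarded to bucket `i` in the update at time `t`. -/
def forwardedExperts (t : ℕ) (s : State n) (i : ℕ) : List (Fin n) :=
  (List.range i).flatMap fun j => (survivingEntries Ts k m t s j).map Entry.expert

/-- The state after the bucket update at time `t`, if the new samples are `S`. -/
def bucketUpdate (t : ℕ) (s : State n) (S : Fin (topLevel Ts k t + 1) → Fin m → Fin n) :
    State n where
  bucket i :=
    if h : i < topLevel Ts k t + 1 then
      survivingEntries Ts k m t s i ++ fresh (A.fwd t i) (forwardedExperts Ts k m t s i) ++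
        fresh (A.smp t i) (List.ofFn (S ⟨i, h⟩))
    else s.bucket i
  big i := if i + 1 ≤ topLevel Ts k t then 1 else s.big i
  small i := if i + 1 ≤ topLevel Ts k t then 1 else s.small i

theorem updateBuckets_eq_map (t : ℕ) (s : State n) :
    updateBuckets A Ts k m t s =
      (PMF.uniformOfFintype (Fin (topLevel Ts k t + 1) → Fin m → Fin n)).map
        (bucketUpdate A Ts k m t s) := rfl

/-- The states after the days `0, 1, …` and the picks and predictions on the days `1, 2, …`. -/
abbrev Traj (n : ℕ) : Type := (ℕ → State n) × (ℕ → ℕ → Fin n × Fin n)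

/-- The law of the state after day `t + 1`, if the state after day `t` is `s` and the picks and
predictions on day `t + 1` are `y`. -/
def nextState (t : ℕ) (y : ℕ → Fin n × Fin n) (s : State n) : PMF (State n) :=
  if Ts 0 ∣ t + 1 then updateBuckets A Ts k m (t + 1) (updateWeights Ts (ℓ (t + 1)) y s)
  else PMF.pure (updateWeights Ts (ℓ (t + 1)) y s)

/-- The law of a trajectory after day `t + 1`, given the trajectory `h` up to day `t`. -/
def trajStep (t : ℕ) (h : Traj n) : PMF (Traj n) :=
  (getPredictions (h.1 t) (k - 1)).bind fun y =>
    (nextState A Ts k m ℓ t y (h.1 t)).map fun s' =>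
      (Function.update h.1 (t + 1) s', Function.update h.2 (t + 1) y)

/-- The law of the trajectory up to day `t`. Unlike `run`, it remembers all earlier states, picks
and predictions; the values at later days are meaningless. -/
def runTraj : ℕ → PMF (Traj n)
  | 0 => (updateBuckets A Ts k m 0 (emptyState n)).map fun s => (fun _ => s, fun _ _ => (0, 0))
  | t + 1 => (runTraj t).bind (trajStep A Ts k m ℓ t)

theorem run_eq_map_runTraj (t : ℕ) :
    run A Ts k m ℓ t =
      (runTraj A Ts k m ℓ t).map fun h => (h.1 t, fun u => (h.2 u (k - 1)).2) := by
  induction t with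
  | zero =>
    simp only [run, runTraj, PMF.map_comp]
    rfl
  | succ t ih =>
    simp only [run, runTraj, ih, PMF.map_bind, PMF.bind_map]
    refine congrArg _ (funext fun h => ?_)
    simp only [Function.comp, trajStep, PMF.map_bind, PMF.map_comp]
    refine congrArg _ (funext fun y => ?_)
    simp only [nextState]
    refine congrArg (PMF.map · _) (funext fun s' => ?_)
    refine Prod.ext (by simp) (funext fun u => ?_)
    by_cases hu : u = t + 1
    · subst hu
      simp
    · simp [hu]

theorem hierarchicalBaseline_eq_map_runTraj :
    hierarchicalBaseline A Ts k m ℓ =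
      (runTraj A Ts k m ℓ (Ts k)).map fun h u => (h.2 u (k - 1)).2 := by
  rw [hierarchicalBaseline, run_eq_map_runTraj, PMF.map_comp]
  rfl

theorem expect_runTraj_le (f : ℕ → Traj n → ℝ≥0∞) {c : ℝ≥0∞}
    (h0 : expect (runTraj A Ts k m ℓ 0) (f 0) ≤ c) (T : ℕ)
    (hstep : ∀ t < T, ∀ h, expect (trajStep A Ts k m ℓ t h) (f (t + 1)) ≤ f t h) :
    expect (runTraj A Ts k m ℓ T) (f T) ≤ c := by
  induction T with
  | zero => exact h0
  | succ T ih =>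
    rw [runTraj, expect_bind]
    exact (expect_mono _ fun h => hstep T T.lt_succ_self h).trans
      (ih fun t ht => hstep t (ht.trans T.lt_succ_self))

/-- The relations between consecutive states of a trajectory up to day `T` which hold for every
outcome of the random choices. -/
structure Consistent (T : ℕ) (h : Traj n) : Prop where
  init : ∃ S, h.1 0 = bucketUpdate A Ts k m 0 (emptyState n) S
  update : ∀ t < T, Ts 0 ∣ t + 1 → ∃ S, h.1 (t + 1) =
    bucketUpdate A Ts k m (t + 1) (updateWeights Ts (ℓ (t + 1)) (h.2 (t + 1)) (h.1 t)) S
  no_update : ∀ t < T, ¬ Ts 0 ∣ t + 1 →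
    h.1 (t + 1) = updateWeights Ts (ℓ (t + 1)) (h.2 (t + 1)) (h.1 t)
  pick_zero : ∀ t < T, (h.2 (t + 1) 0).1 = (h.2 (t + 1) 0).2

theorem pick_zero_eq_of_mem_support_getPredictions (s : State n) (i : ℕ) :
    ∀ y ∈ (getPredictions s i).support, (y 0).1 = (y 0).2 := by
  induction i with
  | zero =>
    intro y hy
    simp only [getPredictions, PMF.support_map, Set.mem_image] at hy
    obtain ⟨e, -, rfl⟩ := hy
    rfl
  | succ i ih =>
    intro y hy
    simp only [getPredictions, PMF.mem_support_bind_iff, PMF.support_map, Set.mem_image] at hy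
    obtain ⟨y', hy', e, -, p, -, rfl⟩ := hy
    simpa using ih y' hy'

variable {A Ts k m ℓ}

theorem Consistent.extend {t : ℕ} {h : Traj n} (hh : Consistent A Ts k m ℓ t h)
    {y : ℕ → Fin n × Fin n} (hy : (y 0).1 = (y 0).2) {s : State n}
    (hs : s ∈ (nextState A Ts k m ℓ t y (h.1 t)).support) :
    Consistent A Ts k m ℓ (t + 1)
      (Function.update h.1 (t + 1) s, Function.update h.2 (t + 1) y) := by
  have hstate : ∀ u ≤ t, Function.update h.1 (t + 1) s u = h.1 u := fun u hu =>
    Function.update_of_ne (by omega) _ _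
  have hpred : ∀ u < t, Function.update h.2 (t + 1) y (u + 1) = h.2 (u + 1) := fun u hu =>
    Function.update_of_ne (by omega) _ _
  refine ⟨?_, fun u hu hd => ?_, fun u hu hd => ?_, fun u hu => ?_⟩
  · simpa only [hstate 0 t.zero_le] using hh.init
  all_goals rcases (Nat.lt_succ_iff.1 hu).eq_or_lt with rfl | hlt
  · simp only [Function.update_self, hstate u le_rfl]
    rw [nextState, if_pos hd, updateBuckets_eq_map, PMF.support_map] at hs
    obtain ⟨S, -, hS⟩ := hs
    exact ⟨S, hS.symm⟩
  · simpa only [hstate u hlt.le, hstate (u + 1) hlt, hpred u hlt] using hh.update u hlt hd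
  · simp only [Function.update_self, hstate u le_rfl]
    rwa [nextState, if_neg hd, PMF.support_pure, Set.mem_singleton_iff] at hs
  · simpa only [hstate u hlt.le, hstate (u + 1) hlt, hpred u hlt] using hh.no_update u hlt hd
  · simpa only [Function.update_self] using hy
  · simpa only [hpred u hlt] using hh.pick_zero u hlt

variable (A Ts k m ℓ)

theorem consistent_of_mem_support (T : ℕ) :
    ∀ h ∈ (runTraj A Ts k m ℓ T).support, Consistent A Ts k m ℓ T h := by
  induction T with
  | zero =>
    intro h hh
    simp only [runTraj, updateBuckets_eq_map, PMF.support_map, Set.mem_image] at hh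
    obtain ⟨s, ⟨S, -, rfl⟩, rfl⟩ := hh
    exact ⟨⟨S, rfl⟩, fun _ ht => absurd ht (Nat.not_lt_zero _),
      fun _ ht => absurd ht (Nat.not_lt_zero _), fun _ ht => absurd ht (Nat.not_lt_zero _)⟩
  | succ T ih =>
    intro h hh
    simp only [runTraj, trajStep, PMF.mem_support_bind_iff, PMF.support_map, Set.mem_image] at hh
    obtain ⟨g, hg, y, hy, s, hs, rfl⟩ := hh
    exact (ih g hg).extend (pick_zero_eq_of_mem_support_getPredictions _ _ y hy) hs

/-- The exponentials of the partial sums form a supermartingale. -/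
theorem expect_exp_sum_range_le_one (ψ : ℕ → State n → (ℕ → Fin n × Fin n) → ℝ)
    (hψ : ∀ x s, expect (getPredictions s (k - 1))
      (fun y => ENNReal.ofReal (Real.exp (ψ x s y))) ≤ 1) (T : ℕ) :
    expect (runTraj A Ts k m ℓ T) (fun h => ENNReal.ofReal
      (Real.exp (∑ x ∈ Finset.range T, ψ x (h.1 x) (h.2 (x + 1))))) ≤ 1 := by
  refine expect_runTraj_le A Ts k m ℓ (fun t h => ENNReal.ofReal
    (Real.exp (∑ x ∈ Finset.range t, ψ x (h.1 x) (h.2 (x + 1)))))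
    (expect_le_one _ fun h => by simp) T fun t _ h => ?_
  have hpast : ∀ y s', ∑ x ∈ Finset.range t,
      ψ x (Function.update h.1 (t + 1) s' x) (Function.update h.2 (t + 1) y (x + 1)) =
      ∑ x ∈ Finset.range t, ψ x (h.1 x) (h.2 (x + 1)) := fun y s' =>
    Finset.sum_congr rfl fun x hx => by
      have := Finset.mem_range.1 hx
      rw [Function.update_of_ne (by omega), Function.update_of_ne (by omega)]
  have hstate : ∀ s', Function.update h.1 (t + 1) s' t = h.1 t := fun s' =>
    Function.update_of_ne (by omega) _ _
  rw [trajStep, expect_bind]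
  simp only [expect_map, Finset.sum_range_succ, hpast, hstate, Function.update_self, Real.exp_add,
    ENNReal.ofReal_mul (Real.exp_pos _).le, expect_const, expect_const_mul]
  exact mul_le_of_le_one_right' (hψ t (h.1 t))

theorem expect_exp_sum_Ico_le_one (ψ : ℕ → State n → (ℕ → Fin n × Fin n) → ℝ)
    (hψ : ∀ x s, expect (getPredictions s (k - 1))
      (fun y => ENNReal.ofReal (Real.exp (ψ x s y))) ≤ 1) {b c T : ℕ} (hc : c ≤ T) :
    expect (runTraj A Ts k m ℓ T) (fun h => ENNReal.ofReal
      (Real.exp (∑ x ∈ Finset.Ico b c, ψ x (h.1 x) (h.2 (x + 1))))) ≤ 1 := by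
  have hsum : ∀ F : ℕ → ℝ, ∑ x ∈ Finset.Ico b c, F x =
      ∑ x ∈ Finset.range T, if x ∈ Finset.Ico b c then F x else 0 := fun F => by
    rw [← Finset.sum_filter]
    congr 1
    ext x
    simp only [Finset.mem_filter, Finset.mem_range, Finset.mem_Ico]
    omega
  simp only [hsum]
  refine expect_exp_sum_range_le_one A Ts k m ℓ
    (fun x s y => if x ∈ Finset.Ico b c then ψ x s y else 0) (fun x s => ?_) T
  split_ifs
  · exact hψ x s
  · exact expect_le_one _ fun _ => by simp

end Trajectory

/-! ### Concentration of the losses of picks and predictions -/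

section Concentration

variable {n : ℕ} [NeZero n]

/-- The law of the pick from bucket `i`. -/
def pickLaw (s : State n) (i : ℕ) : PMF (Fin n) :=
  weightedChoice 0 ((s.bucket i).map fun x => (x.expert, x.weight))

/-- The law of the prediction of level `j + 1`, given the prediction `p` of level `j` and the pick
`e` from bucket `j + 1`. -/
def mixLaw (s : State n) (j : ℕ) (p e : Fin n) : PMF (Fin n) :=
  weightedChoice e [(e, s.big j), (p, s.small j)]

theorem expect_getPredictions_pick (s : State n) {i j : ℕ} (hj : j ≤ i) (f : Fin n → ℝ≥0∞) :
    expect (getPredictions s i) (fun y => f (y j).1) = expect (pickLaw s j) f := by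
  induction i with
  | zero =>
    obtain rfl : j = 0 := by omega
    simp only [getPredictions, expect_map]
    rfl
  | succ i ih =>
    simp only [getPredictions, expect_bind, expect_map]
    rcases hj.eq_or_lt with rfl | hlt
    · simp only [Function.update_self, expect_const]
      rfl
    · have hne : j ≠ i + 1 := by omega
      simp only [Function.update_of_ne hne, expect_const]
      exact ih (by omega)

theorem expect_getPredictions_mix_le_one (s : State n) {i j : ℕ} (hj : j + 1 ≤ i)
    (f : Fin n → Fin n → Fin n → ℝ≥0∞) (hf : ∀ p e, expect (mixLaw s j p e) (f p e) ≤ 1) :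
    expect (getPredictions s i) (fun y => f (y j).2 (y (j + 1)).1 (y (j + 1)).2) ≤ 1 := by
  induction i with
  | zero => omega
  | succ i ih =>
    simp only [getPredictions, expect_bind, expect_map]
    rcases hj.eq_or_lt with heq | hlt
    · obtain rfl : j = i := by omega
      have hne : j ≠ j + 1 := by omega
      simp only [Function.update_self, Function.update_of_ne hne]
      exact expect_le_one _ fun y => expect_le_one _ fun e => hf (y j).2 e
    · have h1 : j ≠ i + 1 := by omega
      have h2 : j + 1 ≠ i + 1 := by omega
      simp only [Function.update_of_ne h1, Function.update_of_ne h2, expect_const]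
      exact ih (by omega)

variable (A : ArrivalRule) (Ts : ℕ → ℕ) (k m : ℕ) {ℓ : ℕ → Fin n → ℝ}

theorem pick_concentration (hℓ : ∀ t e, ℓ t e ∈ Set.Icc (0 : ℝ) 1) {i : ℕ} (hi : i < k) {c : ℝ}
    (hc : c ∈ Set.Icc (0 : ℝ) 1) {b d T : ℕ} (hd : d ≤ T) (Γ : ℝ) :
    (runTraj A Ts k m ℓ T).toOuterMeasure {h | Γ < ∑ x ∈ Finset.Ico b d,
      (c * ℓ (x + 1) (h.2 (x + 1) i).1 -
        (c + c ^ 2) * mean (pickLaw (h.1 x) i) (ℓ (x + 1)))} ≤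
      ENNReal.ofReal (Real.exp (-Γ)) := by
  refine toOuterMeasure_le_exp_neg_of_expect_le_one _ (expect_exp_sum_Ico_le_one A Ts k m ℓ
    (fun x s y => c * ℓ (x + 1) (y i).1 - (c + c ^ 2) * mean (pickLaw s i) (ℓ (x + 1)))
    (fun x s => ?_) hd)
    fun h hh => ENNReal.ofReal_le_ofReal (Real.exp_le_exp.2 (Set.mem_ofPred_eq ▸ hh).le)
  exact (expect_getPredictions_pick s (Nat.le_sub_one_of_lt hi) fun e => ENNReal.ofReal
    (Real.exp (c * ℓ (x + 1) e - (c + c ^ 2) * mean (pickLaw s i) (ℓ (x + 1))))).le.trans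
      (expect_exp_mul_sub_mean_le_one _ (hℓ (x + 1)) hc)

theorem mix_concentration (hℓ : ∀ t e, ℓ t e ∈ Set.Icc (0 : ℝ) 1) {j : ℕ} (hj : j + 1 < k)
    {c : ℝ} (hc : c ∈ Set.Icc (0 : ℝ) 1) {b d T : ℕ} (hd : d ≤ T) (Γ : ℝ) :
    (runTraj A Ts k m ℓ T).toOuterMeasure {h | Γ < ∑ x ∈ Finset.Ico b d,
      (c * ℓ (x + 1) (h.2 (x + 1) (j + 1)).2 - (c + c ^ 2) *
        mean (mixLaw (h.1 x) j (h.2 (x + 1) j).2 (h.2 (x + 1) (j + 1)).1) (ℓ (x + 1)))} ≤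
      ENNReal.ofReal (Real.exp (-Γ)) := by
  refine toOuterMeasure_le_exp_neg_of_expect_le_one _ (expect_exp_sum_Ico_le_one A Ts k m ℓ
    (fun x s y => c * ℓ (x + 1) (y (j + 1)).2 - (c + c ^ 2) *
      mean (mixLaw s j (y j).2 (y (j + 1)).1) (ℓ (x + 1))) (fun x s => ?_) hd)
    fun h hh => ENNReal.ofReal_le_ofReal (Real.exp_le_exp.2 (Set.mem_ofPred_eq ▸ hh).le)
  exact expect_getPredictions_mix_le_one s (Nat.le_sub_one_of_lt hj) (fun p e q => ENNReal.ofReal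
    (Real.exp (c * ℓ (x + 1) q - (c + c ^ 2) * mean (mixLaw s j p e) (ℓ (x + 1)))))
      fun p e => expect_exp_mul_sub_mean_le_one _ (hℓ (x + 1)) hc

end Concentration

/-! ### Multiplicative weights on one block -/

section BlockHedge

theorem mean_weightedChoice {α : Type} (d : α) (l : List (α × ℝ)) (hl : l ≠ [])
    (hw : ∀ p ∈ l, 0 < p.2) (X : α → ℝ) (hX : ∀ a, 0 ≤ X a) :
    mean (weightedChoice d l) X =
      (l.map fun p => p.2 * X p.1).sum / (l.map Prod.snd).sum := by
  have hne : Nonempty (Fin l.length) := ⟨⟨0, List.length_pos_iff.2 hl⟩⟩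
  have hwj : ∀ j : Fin l.length, 0 < (l[(j : ℕ)]).2 := fun j => hw _ (List.get_mem l j)
  have hsum : ∑' j : Fin l.length, ENNReal.ofReal (l[(j : ℕ)]).2 =
      ENNReal.ofReal (∑ j : Fin l.length, (l[(j : ℕ)]).2) := by
    rw [tsum_fintype, ENNReal.ofReal_sum_of_nonneg fun j _ => (hwj j).le]
  have hpos : 0 < ∑ j : Fin l.length, (l[(j : ℕ)]).2 :=
    Finset.sum_pos (fun j _ => hwj j) Finset.univ_nonempty
  have h0 : ∑' j : Fin l.length, ENNReal.ofReal (l[(j : ℕ)]).2 ≠ 0 := by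
    rw [hsum]
    exact (ENNReal.ofReal_pos.2 hpos).ne'
  simp only [mean, weightedChoice, List.get_eq_getElem]
  rw [dif_pos h0, expect_map, expect, tsum_fintype, ← Fin.sum_univ_fun_getElem,
    ← Fin.sum_univ_fun_getElem]
  simp only [PMF.normalize_apply, hsum]
  rw [ENNReal.toReal_sum]
  · rw [Finset.sum_div]
    refine Finset.sum_congr rfl fun j _ => ?_
    rw [ENNReal.toReal_mul, ENNReal.toReal_mul, ENNReal.toReal_inv,
      ENNReal.toReal_ofReal (hwj j).le, ENNReal.toReal_ofReal hpos.le,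
      ENNReal.toReal_ofReal (hX _)]
    ring
  · intro j _
    exact ENNReal.mul_ne_top (ENNReal.mul_ne_top ENNReal.ofReal_ne_top
      (ENNReal.inv_ne_top.2 (ENNReal.ofReal_pos.2 hpos).ne')) ENNReal.ofReal_ne_top

variable {n : ℕ} {A : ArrivalRule} {Ts : ℕ → ℕ} {k m : ℕ} {ℓ : ℕ → Fin n → ℝ}
  {T : ℕ} {h : Traj n}

theorem Consistent.bucket_succ (hc : Consistent A Ts k m ℓ T h) (hS : BlockSizes Ts k) {t i : ℕ}
    (ht : t < T) (hi : ¬ Ts i ∣ t + 1) :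
    (h.1 (t + 1)).bucket i = (updateWeights Ts (ℓ (t + 1)) (h.2 (t + 1)) (h.1 t)).bucket i := by
  by_cases h0 : Ts 0 ∣ t + 1
  · obtain ⟨S, hs⟩ := hc.update t ht h0
    rw [hs, bucketUpdate]
    simp only
    rw [dif_neg]
    intro hlt
    exact hi (hS.dvd_of_le_topLevel h0 (by omega))
  · rw [hc.no_update t ht h0]

theorem Consistent.external_succ (hc : Consistent A Ts k m ℓ T h) (hS : BlockSizes Ts k) {t i : ℕ}
    (ht : t < T) (hi : ¬ Ts (i + 1) ∣ t + 1) :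
    (h.1 (t + 1)).big i = (updateWeights Ts (ℓ (t + 1)) (h.2 (t + 1)) (h.1 t)).big i ∧
    (h.1 (t + 1)).small i = (updateWeights Ts (ℓ (t + 1)) (h.2 (t + 1)) (h.1 t)).small i := by
  by_cases h0 : Ts 0 ∣ t + 1
  · obtain ⟨S, hs⟩ := hc.update t ht h0
    have hnot : ¬ i + 1 ≤ topLevel Ts k (t + 1) := fun hle => hi (hS.dvd_of_le_topLevel h0 hle)
    rw [hs, bucketUpdate]
    exact ⟨if_neg hnot, if_neg hnot⟩
  · rw [hc.no_update t ht h0]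
    exact ⟨rfl, rfl⟩

theorem Consistent.exists_bucketUpdate (hc : Consistent A Ts k m ℓ T h) {b : ℕ} (hb : b ≤ T)
    (h0 : Ts 0 ∣ b) : ∃ s S, h.1 b = bucketUpdate A Ts k m b s S := by
  rcases Nat.eq_zero_or_pos b with rfl | hpos
  · obtain ⟨S, hs⟩ := hc.init
    exact ⟨_, S, hs⟩
  · obtain ⟨t, rfl⟩ : ∃ t, b = t + 1 := ⟨b - 1, by omega⟩
    obtain ⟨S, hs⟩ := hc.update t hb h0
    exact ⟨_, S, hs⟩

theorem mem_fresh {arr : ℕ → ℝ} {es : List (Fin n)} {x : Entry n} :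
    x ∈ fresh arr es ↔ ∃ r, ∃ hr : r < es.length, x = ⟨es[r], arr r, 0, 1⟩ := by
  simp only [fresh, List.mem_mapIdx, eq_comm]

theorem mem_evict {ε : ℝ} {τ : ℕ} {b : List (Entry n)} {x : Entry n} :
    x ∈ evict ε τ b ↔ ∃ y ∈ b, ¬ ((τ : ℝ) + 1 / 2 ≤ y.arrival ∧ ∃ x' ∈ b, Dominates ε x' y) ∧
      x = { y with weight := 1 } := by
  classical
  simp only [evict, List.mem_map, List.mem_filter, decide_eq_true_eq, and_assoc,
    eq_comm (a := x)]

theorem Consistent.weight_eq_one (hc : Consistent A Ts k m ℓ T h) (hS : BlockSizes Ts k) {b i : ℕ}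
    (hb : b ≤ T) (hi : i < k) (hd : Ts i ∣ b) : ∀ x ∈ (h.1 b).bucket i, x.weight = 1 := by
  obtain ⟨s, S, hs⟩ := hc.exists_bucketUpdate hb (hS.zero_dvd_of_dvd hi.le hd)
  have hlt : i < topLevel Ts k b + 1 := Nat.lt_succ_of_le (le_topLevel hi hd)
  intro x hx
  rw [hs, bucketUpdate] at hx
  simp only [dif_pos hlt, List.mem_append] at hx
  rcases hx with (hx | hx) | hx
  · obtain ⟨y, -, -, rfl⟩ := mem_evict.1 hx
    rfl
  · obtain ⟨r, hr, rfl⟩ := mem_fresh.1 hx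
    rfl
  · obtain ⟨r, hr, rfl⟩ := mem_fresh.1 hx
    rfl

theorem Consistent.external_eq_one (hc : Consistent A Ts k m ℓ T h) (hS : BlockSizes Ts k) {b i : ℕ}
    (hb : b ≤ T) (hi : i + 1 < k) (hd : Ts (i + 1) ∣ b) :
    (h.1 b).big i = 1 ∧ (h.1 b).small i = 1 := by
  obtain ⟨s, S, hs⟩ := hc.exists_bucketUpdate hb (hS.zero_dvd_of_dvd hi.le hd)
  have hle : i + 1 ≤ topLevel Ts k b := le_topLevel hi hd
  rw [hs, bucketUpdate]
  exact ⟨if_pos hle, if_pos hle⟩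

theorem Consistent.bucket_block (hc : Consistent A Ts k m ℓ T h) (hS : BlockSizes Ts k) {b i d : ℕ}
    (hi : i < k) (hd : Ts i ∣ b) (hdi : d < Ts i) (hT : b + d ≤ T) :
    ((h.1 (b + d)).bucket i).map (fun x => (x.expert, x.weight)) =
      ((h.1 b).bucket i).map fun x => (x.expert,
        Real.exp (-(√(Real.log (((h.1 b).bucket i).length : ℝ) / (Ts i : ℝ)) *
          ∑ u ∈ Finset.range d, ℓ (b + u + 1) x.expert))) := by
  induction d with
  | zero =>
    refine List.map_congr_left fun x hx => ?_
    simp [hc.weight_eq_one hS hT hi hd x hx]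
  | succ d ih =>
    have ih' := ih (by omega) (by omega)
    have hlen : ((h.1 (b + d)).bucket i).length = ((h.1 b).bucket i).length := by
      simpa using congrArg List.length ih'
    rw [← add_assoc, hc.bucket_succ hS (by omega)
      (not_dvd_of_lt_of_lt_add hd (by omega) (by omega : b + d + 1 < b + Ts i))]
    simp only [updateWeights, List.map_map, hlen]
    set η := √(Real.log (((h.1 b).bucket i).length : ℝ) / (Ts i : ℝ))
    have hmap := congrArg (List.map fun p : Fin n × ℝ =>
      (p.1, p.2 * Real.exp (-(η * ℓ (b + d + 1) p.1)))) ih'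
    simp only [List.map_map] at hmap
    refine Eq.trans ?_ (hmap.trans ?_)
    · rfl
    · refine List.map_congr_left fun x _ => ?_
      simp only [Function.comp, Finset.sum_range_succ, mul_add, neg_add, Real.exp_add]

theorem Consistent.external_block (hc : Consistent A Ts k m ℓ T h) (hS : BlockSizes Ts k)
    {b i d : ℕ} (hi : i + 1 < k) (hd : Ts (i + 1) ∣ b) (hdi : d < Ts (i + 1)) (hT : b + d ≤ T) :
    (h.1 (b + d)).big i = Real.exp (-(√(2 / (Ts (i + 1) : ℝ)) *
        ∑ u ∈ Finset.range d, ℓ (b + u + 1) (h.2 (b + u + 1) (i + 1)).1)) ∧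
      (h.1 (b + d)).small i = Real.exp (-(√(2 / (Ts (i + 1) : ℝ)) *
        ∑ u ∈ Finset.range d, ℓ (b + u + 1) (h.2 (b + u + 1) i).2)) := by
  induction d with
  | zero => simpa using hc.external_eq_one hS hT hi hd
  | succ d ih =>
    obtain ⟨h1, h2⟩ := ih (by omega) (by omega)
    obtain ⟨h3, h4⟩ := hc.external_succ hS (by omega)
      (not_dvd_of_lt_of_lt_add hd (by omega) (by omega : b + d + 1 < b + Ts (i + 1)))
    rw [← add_assoc, h3, h4]
    simp only [updateWeights, h1, h2, Finset.sum_range_succ, mul_add, neg_add, Real.exp_add,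
      and_self]

theorem Consistent.mean_pickLaw_eq [NeZero n] (hc : Consistent A Ts k m ℓ T h)
    (hS : BlockSizes Ts k) (hℓ : ∀ t e, 0 ≤ ℓ t e) {b i d : ℕ}
    (hi : i < k) (hd : Ts i ∣ b) (hdi : d < Ts i) (hT : b + d ≤ T)
    (hne : (h.1 b).bucket i ≠ []) :
    mean (pickLaw (h.1 (b + d)) i) (ℓ (b + d + 1)) =
      hedgeLoss (√(Real.log (((h.1 b).bucket i).length : ℝ) / (Ts i : ℝ)))
        (fun u (j : Fin ((h.1 b).bucket i).length) =>
          ℓ (b + u + 1) (((h.1 b).bucket i).get j).expert) d := by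
  rw [pickLaw, hc.bucket_block hS hi hd hdi hT, mean_weightedChoice]
  · simp only [List.map_map, Function.comp_def]
    rw [← Fin.sum_univ_fun_getElem, ← Fin.sum_univ_fun_getElem]
    rfl
  · simpa using hne
  · intro p hp
    obtain ⟨x, -, rfl⟩ := List.mem_map.1 hp
    exact Real.exp_pos _
  · exact hℓ _

theorem Consistent.mean_mixLaw_eq (hc : Consistent A Ts k m ℓ T h) (hS : BlockSizes Ts k)
    (hℓ : ∀ t e, 0 ≤ ℓ t e) {b i d : ℕ}
    (hi : i + 1 < k) (hd : Ts (i + 1) ∣ b) (hdi : d < Ts (i + 1)) (hT : b + d ≤ T) :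
    mean (mixLaw (h.1 (b + d)) i (h.2 (b + d + 1) i).2 (h.2 (b + d + 1) (i + 1)).1)
        (ℓ (b + d + 1)) =
      hedgeLoss (√(2 / (Ts (i + 1) : ℝ)))
        (fun u (j : Fin 2) => ℓ (b + u + 1)
          (if j = 0 then (h.2 (b + u + 1) (i + 1)).1 else (h.2 (b + u + 1) i).2)) d := by
  obtain ⟨h1, h2⟩ := hc.external_block hS hi hd hdi hT
  rw [mixLaw, h1, h2, mean_weightedChoice]
  · simp [hedgeLoss, hedgeWeight, Fin.sum_univ_two]
  · simp
  · intro p hp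
    simp only [List.mem_cons, List.not_mem_nil, or_false] at hp
    rcases hp with rfl | rfl <;> exact Real.exp_pos _
  · exact hℓ _

end BlockHedge

/-! ### Bucket contents along a trajectory -/

section Contents

variable {n : ℕ}

/-- The pairs (expert, arrival time) of the entries of a bucket. -/
def entryPairs (b : List (Entry n)) : Set (Fin n × ℝ) :=
  (fun x => (x.expert, x.arrival)) '' {x | x ∈ b}

/-- The pairs (expert, arrival time) of the entries of each bucket after each day. -/
def bucketContents (h : Traj n) (t i : ℕ) : Set (Fin n × ℝ) :=
  entryPairs ((h.1 t).bucket i)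

theorem bucketContents_update (h : Traj n) (t : ℕ) (s : State n) (p : ℕ → ℕ → Fin n × Fin n) :
    bucketContents (Function.update h.1 t s, p) =
      Function.update (bucketContents h) t (entryPairs ∘ s.bucket) := by
  funext u j
  by_cases hu : u = t
  · subst hu
    simp [bucketContents]
  · simp [bucketContents, hu]

/-- The entries of the state `s` arrived before time `c`, and their losses are up to date at
time `t`. -/
def LossesAt (ℓ : ℕ → Fin n → ℝ) (c t : ℕ) (s : State n) : Prop :=
  ∀ i, ∀ x ∈ s.bucket i,
    x.arrival ∈ Set.Ico (0 : ℝ) c ∧ x.loss = cumLoss ℓ ⌊x.arrival⌋₊ t x.expert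

variable {A : ArrivalRule} {Ts : ℕ → ℕ} {k m : ℕ} {ℓ : ℕ → Fin n → ℝ}

theorem LossesAt.mono {c c' t : ℕ} {s : State n} (hs : LossesAt ℓ c t s) (hc : c ≤ c') :
    LossesAt ℓ c' t s := fun i x hx =>
  ⟨Set.Ico_subset_Ico_right (Nat.cast_le.2 hc) (hs i x hx).1, (hs i x hx).2⟩

theorem LossesAt.updateWeights {t : ℕ} {s : State n} (hs : LossesAt ℓ (t + 1) t s)
    (y : ℕ → Fin n × Fin n) :
    LossesAt ℓ (t + 1) (t + 1) (updateWeights Ts (ℓ (t + 1)) y s) := by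
  intro i x hx
  simp only [HierBaseline.updateWeights, List.mem_map] at hx
  obtain ⟨x, hx, rfl⟩ := hx
  obtain ⟨harr, hloss⟩ := hs i x hx
  have hfloor : ⌊x.arrival⌋₊ ≤ t := Nat.lt_succ_iff.1 ((Nat.floor_lt harr.1).2 harr.2)
  exact ⟨harr, by simp only [hloss, cumLoss, Finset.sum_Ico_succ_top hfloor]⟩

theorem LossesAt.bucketUpdate {t : ℕ} {s : State n} (hs : LossesAt ℓ t t s)
    (S : Fin (topLevel Ts k t + 1) → Fin m → Fin n) :
    LossesAt ℓ (t + 1) t (bucketUpdate A Ts k m t s S) := by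
  intro i x hx
  have hnew : ∀ (e : Fin n) {r : ℝ}, r ∈ Set.Ico (t : ℝ) (t + 1) →
      r ∈ Set.Ico (0 : ℝ) (t + 1 : ℕ) ∧ 0 = cumLoss ℓ ⌊r⌋₊ t e := fun e r hr => by
    have hr0 := t.cast_nonneg.trans hr.1
    refine ⟨⟨hr0, by exact_mod_cast hr.2⟩, ?_⟩
    simp [(Nat.floor_eq_iff hr0).2 hr, cumLoss]
  by_cases hi : i < topLevel Ts k t + 1
  · simp only [HierBaseline.bucketUpdate, dif_pos hi, List.mem_append] at hx
    rcases hx with (hx | hx) | hx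
    · obtain ⟨y, hy, -, rfl⟩ := mem_evict.1 hx
      exact hs.mono t.le_succ i y hy
    · obtain ⟨r, hr, rfl⟩ := mem_fresh.1 hx
      exact hnew _ (Set.Ico_subset_Ico_right (by linarith) (A.fwd_mem t i r))
    · obtain ⟨r, hr, rfl⟩ := mem_fresh.1 hx
      exact hnew _ (Set.Ico_subset_Ico_left (by linarith) (A.smp_mem t i r))
  · simp only [HierBaseline.bucketUpdate, dif_neg hi] at hx
    exact hs.mono t.le_succ i x hx

theorem entryPairs_updateWeights (loss : Fin n → ℝ) (y : ℕ → Fin n × Fin n) (s : State n) (i : ℕ) :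
    entryPairs ((updateWeights Ts loss y s).bucket i) = entryPairs (s.bucket i) := by
  ext p
  simp [entryPairs, updateWeights]

theorem entryPairs_append (b b' : List (Entry n)) :
    entryPairs (b ++ b') = entryPairs b ∪ entryPairs b' := by
  simp only [entryPairs, List.mem_append, Set.ofPred_or, Set.image_union]

theorem entryPairs_fresh_ofFn (arr : ℕ → ℝ) (S : Fin m → Fin n) :
    entryPairs (fresh arr (List.ofFn S)) = sampleSet S fun r => arr r := by
  ext p
  constructor
  · rintro ⟨x, hx, rfl⟩
    obtain ⟨r, hr, rfl⟩ := mem_fresh.1 hx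
    exact ⟨⟨r, by simpa using hr⟩, by simp⟩
  · rintro ⟨r, rfl⟩
    exact ⟨_, mem_fresh.2 ⟨r, by simp, rfl⟩, by simp⟩

theorem entryPairs_survivingEntries {c t : ℕ} {s : State n} (hs : LossesAt ℓ c t s) (i : ℕ) :
    entryPairs (survivingEntries Ts k m t s i) =
      survivors Ts k (Real.log (Ts k) / m) ℓ t (entryPairs (s.bucket i)) := by
  set ε : ℝ := Real.log (Ts k) / m
  have hdom : ∀ y ∈ s.bucket i, (∃ x' ∈ s.bucket i, Dominates ε x' y) ↔
      ∃ z ∈ entryPairs (s.bucket i), DominatesAt ε ℓ t z (y.expert, y.arrival) := fun y hy => by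
    have hiff : ∀ x' ∈ s.bucket i, Dominates ε x' y ↔
        DominatesAt ε ℓ t (x'.expert, x'.arrival) (y.expert, y.arrival) := fun x' hx' => by
      rw [Dominates, DominatesAt, (hs i x' hx').2, (hs i y hy).2]
    simp only [entryPairs, Set.exists_mem_image, Set.mem_ofPred_eq]
    exact exists_congr fun x' => and_congr_right (hiff x')
  ext p
  constructor
  · rintro ⟨x, hx, rfl⟩
    obtain ⟨y, hy, hnot, rfl⟩ := mem_evict.1 hx
    exact ⟨⟨y, hy, rfl⟩, by rwa [hdom y hy] at hnot⟩
  · rintro ⟨⟨y, hy, rfl⟩, hnot⟩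
    exact ⟨_, mem_evict.2 ⟨y, hy, by rwa [hdom y hy], rfl⟩, rfl⟩

/-- The content of bucket `i` in the update at time `t`, after eviction and forwarding and before
sampling. -/
def unsampled (A : ArrivalRule) (Ts : ℕ → ℕ) (k m t : ℕ) (s : State n) (i : ℕ) :
    Set (Fin n × ℝ) :=
  entryPairs (survivingEntries Ts k m t s i) ∪
    entryPairs (fresh (A.fwd t i) (forwardedExperts Ts k m t s i))

theorem entryPairs_bucketUpdate (t : ℕ) (s : State n)
    (S : Fin (topLevel Ts k t + 1) → Fin m → Fin n) (j : Fin (topLevel Ts k t + 1)) :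
    entryPairs ((bucketUpdate A Ts k m t s S).bucket j) =
      unsampled A Ts k m t s j ∪ sampleSet (S j) fun r => A.smp t j r := by
  simp only [bucketUpdate, dif_pos j.2, entryPairs_append, entryPairs_fresh_ofFn, unsampled]

theorem exists_fwd_mem_unsampled {t i j : ℕ} {s : State n} {x : Fin n × ℝ} (hj : j < i)
    (hx : x ∈ entryPairs (survivingEntries Ts k m t s j)) :
    ∃ r, (x.1, A.fwd t i r) ∈ unsampled A Ts k m t s i := by
  obtain ⟨y, hy, rfl⟩ := hx
  have hmem : y.expert ∈ forwardedExperts Ts k m t s i :=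
    List.mem_flatMap.2 ⟨j, List.mem_range.2 hj, List.mem_map.2 ⟨y, hy, rfl⟩⟩
  obtain ⟨r, hr, hget⟩ := List.mem_iff_getElem.1 hmem
  exact ⟨r, .inr ⟨_, mem_fresh.2 ⟨r, hr, rfl⟩, by simp only [hget]⟩⟩

theorem mem_unsampled_and_lt_iff {t i : ℕ} {s : State n} (hs : LossesAt ℓ t t s)
    {x : Fin n × ℝ} :
    x ∈ unsampled A Ts k m t s i ∧ x.2 < t ↔
      x ∈ survivors Ts k (Real.log (Ts k) / m) ℓ t (entryPairs (s.bucket i)) := by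
  rw [unsampled, entryPairs_survivingEntries hs]
  constructor
  · rintro ⟨hx | ⟨y, hy, rfl⟩, hlt⟩
    · exact hx
    · obtain ⟨r, hr, rfl⟩ := mem_fresh.1 hy
      exact absurd hlt (not_lt.2 (A.fwd_mem t i r).1)
  · intro hx
    obtain ⟨y, hy, rfl⟩ := hx.1
    exact ⟨.inl hx, (hs i y hy).1.2⟩

variable {T : ℕ} {h : Traj n}

theorem Consistent.lossesAt (hc : Consistent A Ts k m ℓ T h) {t : ℕ} (ht : t ≤ T) :
    LossesAt ℓ (t + 1) t (h.1 t) := by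
  induction t with
  | zero =>
    obtain ⟨S, hs⟩ := hc.init
    rw [hs]
    exact LossesAt.bucketUpdate (fun i x hx => by simp [emptyState] at hx) S
  | succ t ih =>
    have hw := (ih (by omega)).updateWeights (Ts := Ts) (h.2 (t + 1))
    by_cases h0 : Ts 0 ∣ t + 1
    · obtain ⟨S, hs⟩ := hc.update t ht h0
      rw [hs]
      exact hw.bucketUpdate S
    · rw [hc.no_update t ht h0]
      exact hw.mono (Nat.le_succ _)

theorem Consistent.exists_entryPairs_eq (hc : Consistent A Ts k m ℓ T h) (hS : BlockSizes Ts k)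
    {t i : ℕ} (ht : t < T) (hi : i < k) (hd : Ts i ∣ t + 1) :
    ∃ S : Fin m → Fin n, entryPairs ((h.1 (t + 1)).bucket i) =
      unsampled A Ts k m (t + 1) (updateWeights Ts (ℓ (t + 1)) (h.2 (t + 1)) (h.1 t)) i ∪
        sampleSet S fun r => A.smp (t + 1) i r := by
  obtain ⟨S, hs⟩ := hc.update t ht (hS.zero_dvd_of_dvd hi.le hd)
  have hlt : i < topLevel Ts k (t + 1) + 1 := Nat.lt_succ_of_le (le_topLevel hi hd)
  exact ⟨S ⟨i, hlt⟩, hs ▸ entryPairs_bucketUpdate (t + 1) _ S ⟨i, hlt⟩⟩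

theorem Consistent.bucketPath (hc : Consistent A Ts k m ℓ (Ts k) h) (hS : BlockSizes Ts k) :
    BucketPath Ts k (Real.log (Ts k) / m) ℓ (bucketContents h) where
  arrival_mem t ht i _ := by
    rintro - ⟨x, hx, rfl⟩
    exact_mod_cast (hc.lossesAt ht.le i x hx).1
  stay t ht i _ hd := by
    unfold bucketContents
    rw [hc.bucket_succ hS (by omega) hd, entryPairs_updateWeights]
  mem_and_lt_iff t ht i hi hd x := by
    have hw := (hc.lossesAt (t := t) (by omega)).updateWeights (Ts := Ts) (h.2 (t + 1))
    obtain ⟨S, hs⟩ := hc.exists_entryPairs_eq hS (by omega) hi hd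
    unfold bucketContents
    rw [← entryPairs_updateWeights (Ts := Ts) (ℓ (t + 1)) (h.2 (t + 1)) (h.1 t) i,
      ← mem_unsampled_and_lt_iff hw, hs]
    refine and_congr_left fun hlt => or_iff_left ?_
    rintro ⟨r, rfl⟩
    linarith [(A.smp_mem (t + 1) i r).1, hlt]
  forward t ht i hi hd j hj x hx := by
    have hw := (hc.lossesAt (t := t) (by omega)).updateWeights (Ts := Ts) (h.2 (t + 1))
    obtain ⟨S, hs⟩ := hc.exists_entryPairs_eq hS (by omega) hi hd
    rw [bucketContents, ← entryPairs_updateWeights (Ts := Ts) (ℓ (t + 1)) (h.2 (t + 1)) (h.1 t) j,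
      ← entryPairs_survivingEntries hw] at hx
    obtain ⟨r, hr⟩ := exists_fwd_mem_unsampled hj hx
    exact ⟨_, A.fwd_mem (t + 1) i r, hs.ge (.inl hr)⟩

end Contents

section Length

variable {n : ℕ} {A : ArrivalRule} {Ts : ℕ → ℕ} {k m : ℕ} {ℓ : ℕ → Fin n → ℝ}

theorem length_evict_le (ε : ℝ) (τ : ℕ) (b : List (Entry n)) :
    (evict ε τ b).length ≤ b.length := by
  classical
  rw [evict, List.length_map]
  exact List.length_filter_le _ _

theorem pow_add_sum_pow_le (x i : ℕ) :
    x ^ (i + 1) + ∑ j ∈ Finset.range i, x ^ (j + 1) + 1 ≤ (x + 1) ^ (i + 1) := by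
  induction i with
  | zero => simp
  | succ i ih =>
    calc x ^ (i + 2) + ∑ j ∈ Finset.range (i + 1), x ^ (j + 1) + 1
        ≤ (x ^ (i + 1) + ∑ j ∈ Finset.range i, x ^ (j + 1) + 1) * (x + 1) := by
          rw [Finset.sum_range_succ, pow_succ x (i + 1)]
          nlinarith [Nat.zero_le ((∑ j ∈ Finset.range i, x ^ (j + 1)) * x + x)]
      _ ≤ (x + 1) ^ (i + 2) := by
          rw [pow_succ (x + 1)]
          exact Nat.mul_le_mul_right _ ih

theorem length_bucketUpdate_le {t : ℕ} {s : State n} {x : ℕ}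
    (hs : ∀ i, (s.bucket i).length ≤ m * x ^ (i + 1))
    (S : Fin (topLevel Ts k t + 1) → Fin m → Fin n) (i : ℕ) :
    ((bucketUpdate A Ts k m t s S).bucket i).length ≤ m * (x + 1) ^ (i + 1) := by
  by_cases hi : i < topLevel Ts k t + 1
  · have hsurv : ∀ j, (survivingEntries Ts k m t s j).length ≤ m * x ^ (j + 1) := fun j =>
      (length_evict_le _ _ _).trans (hs j)
    have hforw : (forwardedExperts Ts k m t s i).length ≤
        ∑ j ∈ Finset.range i, m * x ^ (j + 1) := by
      simp only [forwardedExperts, List.length_flatMap, List.length_map]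
      exact Finset.sum_le_sum (s := Finset.range i) fun j _ => hsurv j
    simp only [bucketUpdate, dif_pos hi, List.length_append, fresh, List.length_mapIdx,
      List.length_ofFn]
    calc _ ≤ m * x ^ (i + 1) + ∑ j ∈ Finset.range i, m * x ^ (j + 1) + m :=
          Nat.add_le_add_right (Nat.add_le_add (hsurv i) hforw) m
      _ = m * (x ^ (i + 1) + ∑ j ∈ Finset.range i, x ^ (j + 1) + 1) := by
          rw [← Finset.mul_sum]
          ring
      _ ≤ _ := Nat.mul_le_mul_left _ (pow_add_sum_pow_le x i)
  · simp only [bucketUpdate, dif_neg hi]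
    exact (hs i).trans (Nat.mul_le_mul_left _ (Nat.pow_le_pow_left (Nat.le_succ x) _))

theorem Consistent.length_le {T : ℕ} {h : Traj n} (hc : Consistent A Ts k m ℓ T h) {t : ℕ}
    (ht : t ≤ T) (i : ℕ) : ((h.1 t).bucket i).length ≤ m * (t + 1) ^ (i + 1) := by
  induction t generalizing i with
  | zero =>
    obtain ⟨S, hs⟩ := hc.init
    rw [hs]
    exact length_bucketUpdate_le (x := 0) (fun i => by simp [emptyState]) S i
  | succ t ih =>
    have hw : ∀ i, ((updateWeights Ts (ℓ (t + 1)) (h.2 (t + 1)) (h.1 t)).bucket i).length ≤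
        m * (t + 1) ^ (i + 1) := fun i => by
      simpa [updateWeights] using ih (by omega) i
    by_cases h0 : Ts 0 ∣ t + 1
    · obtain ⟨S, hs⟩ := hc.update t ht h0
      rw [hs]
      exact length_bucketUpdate_le hw S i
    · rw [hc.no_update t ht h0]
      exact (hw i).trans (Nat.mul_le_mul_left _ (Nat.pow_le_pow_left (Nat.le_succ _) _))

end Length

/-! ### The number of bad times -/

section BadCount

variable {n : ℕ} (Ts : ℕ → ℕ) (k : ℕ) (ε : ℝ) (ℓ : ℕ → Fin n → ℝ) (star : Fin n)

open Classical in
/-- The number of bad times of level `i` before time `t`. -/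
def badCount (X : ℕ → ℕ → Set (Fin n × ℝ)) (i t : ℕ) : ℕ :=
  ((Finset.range t).filter (BadTime Ts k ε ℓ star X i)).card

/-- The quantity `c ^ badCount`, which is a supermartingale for a suitable `c > 1` once it is
stopped at the `N`-th bad time and set to `0` when the walk jumps to the last day before that. -/
def potential (c : ℝ≥0∞) (N : ℕ) (X : ℕ → ℕ → Set (Fin n × ℝ)) (i t : ℕ) : ℝ≥0∞ :=
  if badCount Ts k ε ℓ star X i t < N ∧ walkPos Ts k ε ℓ star X t = Ts k then 0
  else c ^ min N (badCount Ts k ε ℓ star X i t)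

variable {Ts k ε ℓ star} {X X' : ℕ → ℕ → Set (Fin n × ℝ)} {c : ℝ≥0∞} {N i t : ℕ}

theorem badCount_congr (h : ∀ u < t, X u = X' u) :
    badCount Ts k ε ℓ star X i t = badCount Ts k ε ℓ star X' i t := by
  classical
  refine congrArg Finset.card (Finset.filter_congr fun s hs => ?_)
  have hst := Finset.mem_range.1 hs
  exact ⟨fun hb => hb.congr fun u hu => h u (hu.trans_lt hst),
    fun hb => hb.congr fun u hu => (h u (hu.trans_lt hst)).symm⟩

theorem potential_congr (h : ∀ u < t, X u = X' u) :
    potential Ts k ε ℓ star c N X i t = potential Ts k ε ℓ star c N X' i t := by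
  rw [potential, potential, badCount_congr h, walkPos_congr h]

open Classical in
theorem badCount_succ (X : ℕ → ℕ → Set (Fin n × ℝ)) (i t : ℕ) :
    badCount Ts k ε ℓ star X i (t + 1) =
      badCount Ts k ε ℓ star X i t + if BadTime Ts k ε ℓ star X i t then 1 else 0 := by
  rw [badCount, badCount, Finset.range_add_one, Finset.filter_insert]
  split_ifs with h
  · rw [Finset.card_insert_of_notMem (by simp)]
  · rfl

theorem potential_le (c : ℝ≥0∞) (N : ℕ) (X : ℕ → ℕ → Set (Fin n × ℝ)) (i t : ℕ) :
    potential Ts k ε ℓ star c N X i t ≤ c ^ min N (badCount Ts k ε ℓ star X i t) := by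
  unfold potential
  split_ifs
  exacts [zero_le, le_rfl]

theorem potential_eq_pow_of_le (h : N ≤ badCount Ts k ε ℓ star X i t) :
    potential Ts k ε ℓ star c N X i t = c ^ N := by
  rw [potential, if_neg fun hN => hN.1.not_ge h, min_eq_left h]

theorem potential_succ_le (ht : t < Ts k)
    (hbad : badCount Ts k ε ℓ star X i t < N → ¬ BadTime Ts k ε ℓ star X i t) :
    potential Ts k ε ℓ star c N X i (t + 1) ≤ potential Ts k ε ℓ star c N X i t := by
  rcases le_or_gt N (badCount Ts k ε ℓ star X i t) with hN | hN
  · rw [potential_eq_pow_of_le hN, potential_eq_pow_of_le (hN.trans ?_)]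
    exact (badCount_succ X i t).symm ▸ Nat.le_add_right _ _
  · have hcount : badCount Ts k ε ℓ star X i (t + 1) = badCount Ts k ε ℓ star X i t := by
      rw [badCount_succ, if_neg (hbad hN), add_zero]
    rw [potential.eq_def _ _ _ _ _ _ _ _ _ t]
    split_ifs with h
    · have hend : walkPos Ts k ε ℓ star X (t + 1) = Ts k := by
        rw [walkPos, if_neg (h.2.symm ▸ ht.ne'), h.2]
      rw [potential, if_pos ⟨hcount.trans_lt hN, hend⟩]
    · exact hcount ▸ potential_le c N X i (t + 1)

theorem potential_succ_le_mul (hc : 1 ≤ c) (hend : walkPos Ts k ε ℓ star X t ≠ Ts k) :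
    potential Ts k ε ℓ star c N X i (t + 1) ≤ potential Ts k ε ℓ star c N X i t * c := by
  classical
  rw [potential.eq_def _ _ _ _ _ _ _ _ _ t, if_neg fun h => hend h.2, ← pow_succ]
  refine (potential_le c N X i (t + 1)).trans (pow_le_pow_right₀ hc ?_)
  rw [badCount_succ]
  split_ifs <;> omega

theorem potential_succ_eq_zero (hvis : Visited Ts k ε ℓ star X t)
    (hN : badCount Ts k ε ℓ star X i t < N) (hi : i ≤ topLevel Ts k t)
    (hbad : ∀ j, i < j → j ≤ topLevel Ts k t → Bad Ts k ε ℓ star j t (X t j))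
    (hjump : CanJump Ts k ε ℓ star i t (X t i) (Ts k)) :
    potential Ts k ε ℓ star c N X i (t + 1) = 0 := by
  refine if_pos ⟨?_, ?_⟩
  · rwa [badCount_succ, if_neg fun hb => hb.bad i le_rfl hi _ hjump, add_zero]
  · exact (if_pos hvis).trans (nextPos_eq_of_canJump hi hbad hjump)

theorem potential_update_succ_le (ht : t < Ts k) {Y : ℕ → Set (Fin n × ℝ)}
    (hbad : badCount Ts k ε ℓ star X i t < N →
      ¬ BadTime Ts k ε ℓ star (Function.update X t Y) i t) :
    potential Ts k ε ℓ star c N (Function.update X t Y) i (t + 1) ≤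
      potential Ts k ε ℓ star c N X i t := by
  have hpast : ∀ u < t, Function.update X t Y u = X u := fun u hu =>
    Function.update_of_ne hu.ne _ _
  exact (potential_succ_le ht (badCount_congr hpast ▸ hbad)).trans_eq (potential_congr hpast)

variable [NeZero n]

theorem expect_potential_updateBuckets_le_of_visited (A : ArrivalRule) {m : ℕ}
    (hS : BlockSizes Ts k) (hε : 0 ≤ ε) (hℓ : ∀ t e, 0 ≤ ℓ t e) (hi : i < k) (ht : t < Ts k)
    (hdvd : Ts i ∣ t) (hvis : Visited Ts k ε ℓ star X t) (hN : badCount Ts k ε ℓ star X i t < N)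
    (s : State n) :
    expect (updateBuckets A Ts k m t s) (fun s' =>
        potential Ts k ε ℓ star (ENNReal.ofReal (Real.exp (m / n))) N
          (Function.update X t (entryPairs ∘ s'.bucket)) i (t + 1)) ≤
      potential Ts k ε ℓ star (ENNReal.ofReal (Real.exp (m / n))) N X i t := by
  have hpast : ∀ Y, ∀ u < t, Function.update X t Y u = X u := fun Y u hu =>
    Function.update_of_ne hu.ne _ _
  have hvis' : ∀ Y, Visited Ts k ε ℓ star (Function.update X t Y) t := fun Y => by
    rwa [Visited, walkPos_congr (hpast Y)]
  have htop : i ≤ topLevel Ts k t := le_topLevel hi hdvd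
  let i' : Fin (topLevel Ts k t + 1) := ⟨i, Nat.lt_succ_of_le htop⟩
  let Y := fun S => entryPairs ∘ (bucketUpdate A Ts k m t s S).bucket
  have hY : ∀ S (j : Fin (topLevel Ts k t + 1)), Y S j =
      unsampled A Ts k m t s j ∪ sampleSet (S j) fun r => A.smp t j r := entryPairs_bucketUpdate t s
  have hsmp : ∀ r, A.smp t i r ∈ Set.Ico (t : ℝ) (t + 1) := fun r =>
    Set.Ico_subset_Ico_left (by linarith) (A.smp_mem t i r)
  rw [updateBuckets_eq_map, expect_map]
  refine expect_uniformOfFintype_le_of_plant i' star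
    (B := fun S => ∀ j : Fin (topLevel Ts k t + 1), i ≤ j → Bad Ts k ε ℓ star j t (Y S j))
    (D := fun S => (∀ j : Fin (topLevel Ts k t + 1), i < j → Bad Ts k ε ℓ star j t (Y S j)) ∧
      CanJump Ts k ε ℓ star i t (Y S i') (Ts k))
    (fun S hB => ?_) (fun S hB R hR => ⟨fun j hj => ?_, ?_⟩) (fun S hB hD => hB i' le_rfl _ hD.2)
    (fun S _ => ?_) (fun S hD => ?_)
    (fun S hB => potential_update_succ_le ht fun _ hb => hB fun j hj => ?_)
  · exact (hY S i' ▸ hB i' le_rfl).ne_star hS hε hℓ hi ht fun r => hsmp r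
  · rw [hY, Function.update_of_ne (Fin.val_ne_iff.1 hj.ne'), ← hY]
    exact hB j hj.le
  · rw [hY, Function.update_self]
    exact (hY S i' ▸ hB i' le_rfl).canJump_plant hS hε hℓ hi ht (fun r => hsmp r) hR
  · rw [← potential_congr (hpast (Y S))]
    exact potential_succ_le_mul (ENNReal.one_le_ofReal.2 (Real.one_le_exp (by positivity)))
      ((hvis' (Y S)).trans_ne ht.ne)
  · refine potential_succ_eq_zero (hvis' _) (badCount_congr (hpast _) ▸ hN) htop
      (fun j hj hjt => ?_) ?_ <;> rw [Function.update_self]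
    exacts [hD.1 ⟨j, Nat.lt_succ_of_le hjt⟩ hj, hD.2]
  · simpa only [Function.update_self] using hb.bad j hj (Nat.lt_succ_iff.1 j.2)

theorem expect_potential_updateBuckets_le (A : ArrivalRule) {m : ℕ} (hS : BlockSizes Ts k)
    (hε : 0 ≤ ε) (hℓ : ∀ t e, 0 ≤ ℓ t e) (hi : i < k) (ht : t < Ts k)
    (X : ℕ → ℕ → Set (Fin n × ℝ)) (s : State n) :
    expect (updateBuckets A Ts k m t s) (fun s' =>
        potential Ts k ε ℓ star (ENNReal.ofReal (Real.exp (m / n))) N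
          (Function.update X t (entryPairs ∘ s'.bucket)) i (t + 1)) ≤
      potential Ts k ε ℓ star (ENNReal.ofReal (Real.exp (m / n))) N X i t := by
  by_cases hactive : Ts i ∣ t ∧ Visited Ts k ε ℓ star X t ∧ badCount Ts k ε ℓ star X i t < N
  · exact expect_potential_updateBuckets_le_of_visited A hS hε hℓ hi ht hactive.1 hactive.2.1
      hactive.2.2 s
  · have hpast : ∀ Y, ∀ u < t, Function.update X t Y u = X u := fun Y u hu =>
      Function.update_of_ne hu.ne _ _
    exact (expect_mono _ fun s' => potential_update_succ_le ht fun hN hb =>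
      hactive ⟨hb.dvd, (walkPos_congr (hpast _)).symm.trans hb.visited, hN⟩).trans
      (expect_const _ _).le

variable (A : ArrivalRule) {m : ℕ}

theorem expect_potential_trajStep_eq (t : ℕ) (h : Traj n) :
    expect (trajStep A Ts k m ℓ t h) (fun h' =>
        potential Ts k ε ℓ star c N (bucketContents h') i (t + 1)) =
      potential Ts k ε ℓ star c N (bucketContents h) i (t + 1) := by
  have hcongr : ∀ Y, potential Ts k ε ℓ star c N
      (Function.update (bucketContents h) (t + 1) Y) i (t + 1) =
        potential Ts k ε ℓ star c N (bucketContents h) i (t + 1) := fun Y =>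
    potential_congr fun u hu => Function.update_of_ne hu.ne _ _
  simp only [trajStep, expect_bind, expect_map, bucketContents_update, hcongr, expect_const]

theorem expect_potential_trajStep_le (hS : BlockSizes Ts k) (hε : 0 ≤ ε) (hℓ : ∀ t e, 0 ≤ ℓ t e)
    (hi : i < k) (ht : t + 1 < Ts k) (h : Traj n) :
    expect (trajStep A Ts k m ℓ t h) (fun h' =>
        potential Ts k ε ℓ star (ENNReal.ofReal (Real.exp (m / n))) N (bucketContents h') i
          (t + 1 + 1)) ≤
      potential Ts k ε ℓ star (ENNReal.ofReal (Real.exp (m / n))) N (bucketContents h) i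
        (t + 1) := by
  simp only [trajStep, expect_bind, expect_map, bucketContents_update]
  refine (expect_mono _ fun y => ?_).trans (expect_const _ _).le
  unfold nextState
  split_ifs with hdvd
  · exact expect_potential_updateBuckets_le A hS hε hℓ hi ht _ _
  · rw [expect_pure]
    refine (potential_succ_le ht fun _ hb => hdvd (hb.visited.dvd hS)).trans_eq ?_
    exact potential_congr fun u hu => Function.update_of_ne hu.ne _ _

theorem expect_potential_runTraj_le (hS : BlockSizes Ts k) (hε : 0 ≤ ε) (hℓ : ∀ t e, 0 ≤ ℓ t e)
    (hi : i < k) (N : ℕ) :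
    expect (runTraj A Ts k m ℓ (Ts k)) (fun h =>
      potential Ts k ε ℓ star (ENNReal.ofReal (Real.exp (m / n))) N (bucketContents h) i
        (Ts k)) ≤ 1 := by
  set c := ENNReal.ofReal (Real.exp ((m : ℝ) / n))
  have hinit : expect (runTraj A Ts k m ℓ 0) (fun h =>
      potential Ts k ε ℓ star c N (bucketContents h) i (0 + 1)) ≤ 1 := by
    have hzero : potential Ts k ε ℓ star c N (fun _ _ => ∅) i 0 ≤ 1 :=
      (potential_le ..).trans_eq (by simp [badCount])
    rw [runTraj, expect_map]
    refine (expect_mono _ fun s => (potential_congr fun u hu => ?_).le).trans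
      ((expect_potential_updateBuckets_le A hS hε hℓ hi (hS.pos le_rfl) (fun _ _ => ∅)
        (emptyState n)).trans hzero)
    obtain rfl := Nat.lt_one_iff.1 hu
    rw [Function.update_self]
    rfl
  obtain ⟨T, hT⟩ : ∃ T, Ts k = T + 1 := Nat.exists_eq_succ_of_ne_zero (hS.pos le_rfl).ne'
  have hbefore := expect_runTraj_le A Ts k m ℓ
    (fun t h => potential Ts k ε ℓ star c N (bucketContents h) i (t + 1)) hinit T
    fun t ht h => expect_potential_trajStep_le A hS hε hℓ hi (by omega) h
  -- The state after the last day does not matter: bad times are counted up to day `T` only.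
  have hlast : expect (runTraj A Ts k m ℓ (T + 1)) (fun h =>
      potential Ts k ε ℓ star c N (bucketContents h) i (T + 1)) ≤ 1 := by
    rw [runTraj, expect_bind]
    simpa only [expect_potential_trajStep_eq] using hbefore
  rwa [← hT] at hlast

theorem badCount_concentration (hm : 0 < m) (hS : BlockSizes Ts k) (hε : 0 ≤ ε)
    (hℓ : ∀ t e, 0 ≤ ℓ t e) (hi : i < k) {Γ : ℝ} (hΓ : 0 ≤ Γ) :
    (runTraj A Ts k m ℓ (Ts k)).toOuterMeasure {h | (n : ℝ) / m * Γ <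
        badCount Ts k ε ℓ star (bucketContents h) i (Ts k)} ≤
      ENNReal.ofReal (Real.exp (-Γ)) := by
  have hn : (0 : ℝ) < n := Nat.cast_pos.2 (Nat.pos_of_ne_zero (NeZero.ne n))
  have hm' : (0 : ℝ) < m := Nat.cast_pos.2 hm
  refine toOuterMeasure_le_exp_neg_of_expect_le_one _
    (expect_potential_runTraj_le (star := star) A hS hε hℓ hi (⌊(n : ℝ) / m * Γ⌋₊ + 1))
    fun h hh => ?_
  rw [potential_eq_pow_of_le (Nat.succ_le_of_lt ((Nat.floor_lt (by positivity)).2 hh)),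
    ← ENNReal.ofReal_pow (Real.exp_pos _).le, ← Real.exp_nat_mul]
  refine ENNReal.ofReal_le_ofReal (Real.exp_le_exp.2 ?_)
  calc Γ = (n : ℝ) / m * Γ * (m / n) := by field_simp [hm'.ne']
    _ ≤ (⌊(n : ℝ) / m * Γ⌋₊ + 1 : ℕ) * (m / n) := by
        push_cast
        gcongr
        exact (Nat.lt_floor_add_one _).le

end BadCount

/-! ### Regret on one block -/

section BlockRegret

/-- A self-normalized excess of the total of `f` over that of its conditional means `μ` on a block
of length `D`, at scale `√D`. -/
def excess (D b : ℕ) (f μ : ℕ → ℝ) : ℝ :=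
  ∑ x ∈ Finset.Ico b (b + D), ((√(D : ℝ))⁻¹ * f x - ((√(D : ℝ))⁻¹ + (√(D : ℝ))⁻¹ ^ 2) * μ x)

theorem sum_le_of_excess_le {b D : ℕ} (hD : 0 < D) {f μ : ℕ → ℝ} (hμ : ∀ x, μ x ≤ 1) {Γ : ℝ}
    (h : excess D b f μ ≤ Γ) :
    ∑ x ∈ Finset.Ico b (b + D), f x ≤ ∑ x ∈ Finset.Ico b (b + D), μ x + (1 + Γ) * √(D : ℝ) := by
  rw [excess, Finset.sum_sub_distrib, ← Finset.mul_sum, ← Finset.mul_sum] at h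
  set r := √(D : ℝ)
  set F := ∑ x ∈ Finset.Ico b (b + D), f x
  set M := ∑ x ∈ Finset.Ico b (b + D), μ x
  have hr : 0 < r := Real.sqrt_pos.2 (Nat.cast_pos.2 hD)
  have hM : M ≤ r * r :=
    calc M ≤ ∑ _x ∈ Finset.Ico b (b + D), (1 : ℝ) := Finset.sum_le_sum fun x _ => hμ x
      _ = r * r := by simp [r]
  have hMr : r⁻¹ * M ≤ r := (inv_mul_le_iff₀ hr).2 hM
  have hscale : r * (r⁻¹ * F - (r⁻¹ + r⁻¹ ^ 2) * M) = F - M - r⁻¹ * M := by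
    field_simp
    ring
  linarith [hscale ▸ mul_le_mul_of_nonneg_left h hr.le]

theorem sum_Ico_div_sqrt (D b : ℕ) (c : ℝ) :
    ∑ _x ∈ Finset.Ico b (b + D), c / √(D : ℝ) = c * √(D : ℝ) := by
  rw [Finset.sum_const, Nat.card_Ico, Nat.add_sub_cancel_left, nsmul_eq_mul, mul_div_left_comm,
    Real.div_sqrt]

variable {n : ℕ}

/-- The loss of the expert drawn from bucket `i` on day `x + 1`. -/
def pickLoss (ℓ : ℕ → Fin n → ℝ) (h : Traj n) (i x : ℕ) : ℝ := ℓ (x + 1) (h.2 (x + 1) i).1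

/-- The loss of the prediction of level `i` on day `x + 1`. -/
def predictionLoss (ℓ : ℕ → Fin n → ℝ) (h : Traj n) (i x : ℕ) : ℝ := ℓ (x + 1) (h.2 (x + 1) i).2

/-- The conditional mean of `pickLoss` given the state at the beginning of day `x + 1`. -/
def meanPickLoss [NeZero n] (ℓ : ℕ → Fin n → ℝ) (h : Traj n) (i x : ℕ) : ℝ :=
  mean (pickLaw (h.1 x) i) (ℓ (x + 1))

/-- The conditional mean of `predictionLoss` at level `i + 1`, given the state at the beginning of
day `x + 1`, the pick of level `i + 1` and the prediction of level `i`. -/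
def meanPredictionLoss (ℓ : ℕ → Fin n → ℝ) (h : Traj n) (i x : ℕ) : ℝ :=
  mean (mixLaw (h.1 x) i (h.2 (x + 1) i).2 (h.2 (x + 1) (i + 1)).1) (ℓ (x + 1))

theorem meanPickLoss_le_one [NeZero n] {ℓ : ℕ → Fin n → ℝ} (hℓ : ∀ t e, ℓ t e ≤ 1) (h : Traj n)
    (i x : ℕ) : meanPickLoss ℓ h i x ≤ 1 :=
  mean_le_one _ (hℓ (x + 1))

theorem meanPredictionLoss_le_one {ℓ : ℕ → Fin n → ℝ} (hℓ : ∀ t e, ℓ t e ≤ 1) (h : Traj n)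
    (i x : ℕ) : meanPredictionLoss ℓ h i x ≤ 1 :=
  mean_le_one _ (hℓ (x + 1))

variable {A : ArrivalRule} {Ts : ℕ → ℕ} {k m T b i : ℕ} {ℓ : ℕ → Fin n → ℝ} {h : Traj n}

theorem Consistent.sum_meanPickLoss_le [NeZero n] (hc : Consistent A Ts k m ℓ T h)
    (hS : BlockSizes Ts k) (hℓ : ∀ t e, ℓ t e ∈ Set.Icc (0 : ℝ) 1) (hi : i < k)
    (hd : Ts i ∣ b) (hT : b + Ts i ≤ T) {B : ℝ} (hB : 0 ≤ B)
    (hlen : Real.log ((h.1 b).bucket i).length ≤ B ^ 2) {z : Fin n × ℝ}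
    (hz : z ∈ bucketContents h b i) :
    ∑ x ∈ Finset.Ico b (b + Ts i), meanPickLoss ℓ h i x ≤
      cumLoss ℓ b (b + Ts i) z.1 + 2 * B * √(Ts i : ℝ) := by
  obtain ⟨e, he, rfl⟩ := hz
  have he : e ∈ (h.1 b).bucket i := he
  obtain ⟨j, rfl⟩ := List.get_of_mem he
  have hhedge := sum_hedgeLoss_sqrt_log_div_le
    (ℓ := fun u (j : Fin ((h.1 b).bucket i).length) =>
      ℓ (b + u + 1) (((h.1 b).bucket i).get j).expert)
    (fun _ _ => hℓ _ _) (hS.pos hi.le) hB (by rwa [Fintype.card_fin]) j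
  rw [Fintype.card_fin] at hhedge
  rw [cumLoss, Finset.sum_Ico_eq_sum_range, Finset.sum_Ico_eq_sum_range, Nat.add_sub_cancel_left]
  refine (Finset.sum_le_sum fun d hd' => ?_).trans hhedge
  have hdi := Finset.mem_range.1 hd'
  exact (hc.mean_pickLaw_eq hS (fun t e => (hℓ t e).1) hi hd hdi (by omega)
    (List.ne_nil_of_mem he)).le

theorem Consistent.sum_meanPredictionLoss_le (hc : Consistent A Ts k m ℓ T h)
    (hS : BlockSizes Ts k) (hℓ : ∀ t e, ℓ t e ∈ Set.Icc (0 : ℝ) 1) (hi : i + 1 < k)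
    (hd : Ts (i + 1) ∣ b) (hT : b + Ts (i + 1) ≤ T) :
    ∑ x ∈ Finset.Ico b (b + Ts (i + 1)), meanPredictionLoss ℓ h i x ≤
        ∑ x ∈ Finset.Ico b (b + Ts (i + 1)), pickLoss ℓ h (i + 1) x + 2 * √(Ts (i + 1) : ℝ) ∧
      ∑ x ∈ Finset.Ico b (b + Ts (i + 1)), meanPredictionLoss ℓ h i x ≤
        ∑ x ∈ Finset.Ico b (b + Ts (i + 1)), predictionLoss ℓ h i x + 2 * √(Ts (i + 1) : ℝ) := by
  have hlog : Real.log (Fintype.card (Fin 2)) ≤ 1 := by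
    rw [Fintype.card_fin, Nat.cast_ofNat]
    exact (Real.log_two_lt_d9.trans (by norm_num)).le
  have hhedge := sum_hedgeLoss_sqrt_two_div_le
    (ℓ := fun u (j : Fin 2) => ℓ (b + u + 1)
      (if j = 0 then (h.2 (b + u + 1) (i + 1)).1 else (h.2 (b + u + 1) i).2))
    (fun _ _ => hℓ _ _) (hS.pos hi.le) hlog
  have hmean : ∀ d ∈ Finset.range (Ts (i + 1)), meanPredictionLoss ℓ h i (b + d) = _ :=
    fun d hd' => have hdi := Finset.mem_range.1 hd'
      hc.mean_mixLaw_eq hS (fun t e => (hℓ t e).1) hi hd hdi (by omega)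
  simp only [Finset.sum_Ico_eq_sum_range, Nat.add_sub_cancel_left]
  rw [Finset.sum_congr rfl hmean]
  exact ⟨hhedge 0, hhedge 1⟩

end BlockRegret

/-! ### The regret on a good trajectory -/

section GoodTrajectory

variable {n : ℕ} [NeZero n] (Ts : ℕ → ℕ) (k m : ℕ) (ℓ : ℕ → Fin n → ℝ) (star : Fin n)

/-- The losses of picks and predictions are close to their conditional means on every block, and
there are few bad times. -/
structure GoodTraj (Γ : ℝ) (h : Traj n) : Prop where
  pick_le : ∀ i < k, ∀ b < Ts k, b + Ts i ≤ Ts k →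
    excess (Ts i) b (pickLoss ℓ h i) (meanPickLoss ℓ h i) ≤ Γ
  prediction_le : ∀ i < k, ∀ b < Ts k, i + 1 < k → b + Ts (i + 1) ≤ Ts k →
    excess (Ts (i + 1)) b (predictionLoss ℓ h (i + 1)) (meanPredictionLoss ℓ h i) ≤ Γ
  badCount_le : ∀ i < k, badCount Ts k (Real.log (Ts k : ℝ) / (m : ℝ)) ℓ star
    (bucketContents h) i (Ts k) ≤ (n : ℝ) / m * Γ

variable {Ts k m ℓ star} {A : ArrivalRule} {Γ B : ℝ} {h : Traj n}

theorem GoodTraj.blockCompetitive (hg : GoodTraj Ts k m ℓ star Γ h)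
    (hc : Consistent A Ts k m ℓ (Ts k) h) (hS : BlockSizes Ts k)
    (hℓ : ∀ t e, ℓ t e ∈ Set.Icc (0 : ℝ) 1) (hB : 0 ≤ B)
    (hlen : ∀ b < Ts k, ∀ i < k, Real.log ((h.1 b).bucket i).length ≤ B ^ 2) :
    BlockCompetitive Ts k ℓ (bucketContents h)
      fun j x => pickLoss ℓ h j x - (3 + Γ + 2 * B) / √(Ts j : ℝ) := by
  intro j hj b hd hb z hz
  have hfit : b + Ts j ≤ Ts k := add_le_of_dvd_of_lt hd (hS.dvd_of_le hj.le le_rfl) hb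
  have hconc := sum_le_of_excess_le (hS.pos hj.le)
    (meanPickLoss_le_one (fun t e => (hℓ t e).2) h j) (hg.pick_le j hj b hb hfit)
  have hhedge := hc.sum_meanPickLoss_le hS hℓ hj hd hfit hB (hlen b hb j hj) hz
  rw [Finset.sum_sub_distrib, sum_Ico_div_sqrt]
  linarith [Real.sqrt_nonneg (Ts j : ℝ)]

theorem GoodTraj.mixedPredictions (hg : GoodTraj Ts k m ℓ star Γ h)
    (hc : Consistent A Ts k m ℓ (Ts k) h) (hS : BlockSizes Ts k)
    (hℓ : ∀ t e, ℓ t e ∈ Set.Icc (0 : ℝ) 1) (hB : 0 ≤ B) :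
    MixedPredictions Ts k (pickLoss ℓ h) (predictionLoss ℓ h)
      fun j => (3 + Γ + 2 * B) / √(Ts j : ℝ) := by
  have hmix : ∀ j, j + 1 < k → ∀ b, Ts (j + 1) ∣ b → b < Ts k → ∀ f : ℕ → ℝ,
      ∑ x ∈ Finset.Ico b (b + Ts (j + 1)), meanPredictionLoss ℓ h j x ≤
        ∑ x ∈ Finset.Ico b (b + Ts (j + 1)), f x + 2 * √(Ts (j + 1) : ℝ) →
      ∑ x ∈ Finset.Ico b (b + Ts (j + 1)), predictionLoss ℓ h (j + 1) x ≤
        ∑ x ∈ Finset.Ico b (b + Ts (j + 1)), (f x + (3 + Γ + 2 * B) / √(Ts (j + 1) : ℝ)) := by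
    intro j hj b hd hb f hf
    have hconc := sum_le_of_excess_le (hS.pos hj.le)
      (meanPredictionLoss_le_one (fun t e => (hℓ t e).2) h j) (hg.prediction_le j (by omega) b hb hj
        (add_le_of_dvd_of_lt hd (hS.dvd_of_le hj.le le_rfl) hb))
    rw [Finset.sum_add_distrib, sum_Ico_div_sqrt]
    linarith [mul_nonneg hB (Real.sqrt_nonneg (Ts (j + 1) : ℝ))]
  have hhedge : ∀ j, j + 1 < k → ∀ b, Ts (j + 1) ∣ b → b < Ts k → _ := fun j hj b hd hb =>
    hc.sum_meanPredictionLoss_le (i := j) hS hℓ hj hd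
      (add_le_of_dvd_of_lt hd (hS.dvd_of_le hj.le le_rfl) hb)
  exact ⟨fun x hx => by rw [pickLoss, predictionLoss, hc.pick_zero x hx],
    fun j hj b hd hb => hmix j hj b hd hb _ (hhedge j hj b hd hb).1,
    fun j hj b hd hb => hmix j hj b hd hb _ (hhedge j hj b hd hb).2⟩

theorem GoodTraj.sum_predictionLoss_le (hg : GoodTraj Ts k m ℓ star Γ h)
    (hc : Consistent A Ts k m ℓ (Ts k) h) (hS : BlockSizes Ts k)
    (hℓ : ∀ t e, ℓ t e ∈ Set.Icc (0 : ℝ) 1) (hΓ : 0 ≤ Γ) (hB : 0 ≤ B)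
    (hlen : ∀ b < Ts k, ∀ i < k, Real.log ((h.1 b).bucket i).length ≤ B ^ 2) :
    ∑ x ∈ Finset.range (Ts k), predictionLoss ℓ h (k - 1) x ≤
      (1 + Real.log (Ts k : ℝ) / (m : ℝ)) ^ k * cumLoss ℓ 0 (Ts k) star +
        Ts 0 * ((n : ℝ) / m * Γ) + ∑ j ∈ Finset.range k, 2 * ((3 + Γ + 2 * B) / √(Ts j : ℝ)) *
          (if j + 1 < k then Ts (j + 1) * ((n : ℝ) / m * Γ) else Ts k) :=
  (hg.mixedPredictions hc hS hℓ hB).sum_top_le_of_card_badTime_le hS (hc.bucketPath hS)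
    (by positivity) (fun t e => (hℓ t e).1) (fun j => by positivity) (fun x => (hℓ _ _).2)
    (hg.blockCompetitive hc hS hℓ hB hlen) hg.badCount_le

end GoodTrajectory

/-! ### Good trajectories are likely -/

section Probability

theorem toOuterMeasure_and_le {α : Type*} (p : PMF α) {P : Prop} {Q : α → Prop} {c : ℝ≥0∞}
    (h : P → p.toOuterMeasure {a | Q a} ≤ c) : p.toOuterMeasure {a | P ∧ Q a} ≤ c := by
  by_cases hP : P
  · simpa only [hP, true_and] using h hP
  · simp [hP]

variable {n : ℕ} [NeZero n] {Ts : ℕ → ℕ} {k m : ℕ} {ℓ : ℕ → Fin n → ℝ}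

theorem BlockSizes.inv_sqrt_mem_Icc (hS : BlockSizes Ts k) {j : ℕ} (hj : j ≤ k) :
    (√(Ts j : ℝ))⁻¹ ∈ Set.Icc (0 : ℝ) 1 :=
  ⟨by positivity, inv_le_one_of_one_le₀ (Real.one_le_sqrt.2 (Nat.one_le_cast.2 (hS.pos hj)))⟩

theorem toOuterMeasure_not_goodTraj_le (A : ArrivalRule) (hm : 0 < m) (hS : BlockSizes Ts k)
    (hℓ : ∀ t e, ℓ t e ∈ Set.Icc (0 : ℝ) 1) (star : Fin n) {Γ : ℝ} (hΓ : 0 ≤ Γ) :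
    (runTraj A Ts k m ℓ (Ts k)).toOuterMeasure {h | ¬ GoodTraj Ts k m ℓ star Γ h} ≤
      (k * (2 * Ts k + 1) : ℕ) * ENNReal.ofReal (Real.exp (-Γ)) := by
  set μ := (runTraj A Ts k m ℓ (Ts k)).toOuterMeasure
  set δ := ENNReal.ofReal (Real.exp (-Γ))
  let P : ℕ → ℕ → Set (Traj n) := fun i b => {h | b + Ts i ≤ Ts k ∧
    Γ < excess (Ts i) b (pickLoss ℓ h i) (meanPickLoss ℓ h i)}
  let Q : ℕ → ℕ → Set (Traj n) := fun i b => {h | (i + 1 < k ∧ b + Ts (i + 1) ≤ Ts k) ∧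
    Γ < excess (Ts (i + 1)) b (predictionLoss ℓ h (i + 1)) (meanPredictionLoss ℓ h i)}
  let Z : ℕ → Set (Traj n) := fun i => {h | (n : ℝ) / m * Γ <
    badCount Ts k (Real.log (Ts k : ℝ) / (m : ℝ)) ℓ star (bucketContents h) i (Ts k)}
  have hP : ∀ i < k, ∀ b, μ (P i b) ≤ δ := fun i hi b => toOuterMeasure_and_le _ fun hb =>
    pick_concentration A Ts k m hℓ hi (hS.inv_sqrt_mem_Icc hi.le) hb Γ
  have hQ : ∀ i < k, ∀ b, μ (Q i b) ≤ δ := fun i hi b => toOuterMeasure_and_le _ fun hb =>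
    mix_concentration A Ts k m hℓ hb.1 (hS.inv_sqrt_mem_Icc hi) hb.2 Γ
  have hZ : ∀ i < k, μ (Z i) ≤ δ := fun i hi =>
    badCount_concentration A hm hS (by positivity) (fun t e => (hℓ t e).1) hi hΓ
  have hsub : {h | ¬ GoodTraj Ts k m ℓ star Γ h} ⊆
      ⋃ i ∈ Finset.range k, ((⋃ b ∈ Finset.range (Ts k), (P i b ∪ Q i b)) ∪ Z i) := by
    intro h hh
    by_contra hnot
    simp only [Set.mem_iUnion, Set.mem_union, Finset.mem_range, not_exists, not_or] at hnot
    exact hh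
      ⟨fun i hi b hb hbi => not_lt.1 fun hlt => ((hnot i hi).1 b hb).1 ⟨hbi, hlt⟩,
        fun i hi b hb hik hbi => not_lt.1 fun hlt => ((hnot i hi).1 b hb).2 ⟨⟨hik, hbi⟩, hlt⟩,
        fun i hi => not_lt.1 (hnot i hi).2⟩
  calc μ {h | ¬ GoodTraj Ts k m ℓ star Γ h}
      ≤ ∑ i ∈ Finset.range k, μ ((⋃ b ∈ Finset.range (Ts k), (P i b ∪ Q i b)) ∪ Z i) :=
        (μ.mono hsub).trans (MeasureTheory.measure_biUnion_finset_le _ _)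
    _ ≤ ∑ _i ∈ Finset.range k, (∑ _b ∈ Finset.range (Ts k), (δ + δ) + δ) := by
        refine Finset.sum_le_sum fun i hi => (MeasureTheory.measure_union_le _ _).trans ?_
        have hik := Finset.mem_range.1 hi
        refine add_le_add ((MeasureTheory.measure_biUnion_finset_le _ _).trans ?_) (hZ i hik)
        exact Finset.sum_le_sum fun b _ => (MeasureTheory.measure_union_le _ _).trans
          (add_le_add (hP i hik b) (hQ i hik b))
    _ = (k * (2 * Ts k + 1) : ℕ) * δ := by
        rw [Finset.sum_const, Finset.sum_const, Finset.card_range, Finset.card_range, nsmul_eq_mul,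
          nsmul_eq_mul]
        push_cast
        ring

end Probability

/-! ### The regret bound -/

section Regret

theorem one_add_pow_sub_one_le {ε : ℝ} {k : ℕ} (hε : 0 ≤ ε) (h : k * ε ≤ 1) :
    (1 + ε) ^ k - 1 ≤ 2 * (k * ε) := by
  have hkε : 0 ≤ k * ε := by positivity
  have hpow : (1 + ε) ^ k ≤ Real.exp (k * ε) := by
    rw [Real.exp_nat_mul]
    exact pow_le_pow_left₀ (by linarith) (by linarith [Real.add_one_le_exp ε]) k
  have hexp := (abs_le.1 (Real.abs_exp_sub_one_sub_id_le (abs_le.2 ⟨by linarith, h⟩))).2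
  have hsq : (k * ε) ^ 2 ≤ k * ε := pow_le_of_le_one hkε h two_ne_zero
  linarith

theorem sub_le_of_le_one_add_pow_mul_add {ε F R E T : ℝ} {k : ℕ} (hε : 0 ≤ ε) (hFT : F ≤ T)
    (hR : R ∈ Set.Icc 0 T) (hE : 0 ≤ E) (hF : F ≤ (1 + ε) ^ k * R + E) :
    F - R ≤ 2 * (k * ε) * T + E := by
  rcases le_total (k * ε) 1 with h | h
  · have hpow : ((1 + ε) ^ k - 1) * R ≤ 2 * (k * ε) * T :=
      mul_le_mul (one_add_pow_sub_one_le hε h) hR.2 hR.1 (by positivity)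
    linarith
  · have hT : 0 ≤ T := hR.1.trans hR.2
    linarith [hR.1, le_mul_of_one_le_left hT h]

theorem one_half_le_log {T : ℕ} (hT : 2 ≤ T) : 1 / 2 ≤ Real.log T := by
  have hlog : Real.log 2 ≤ Real.log T := Real.log_le_log two_pos (Nat.ofNat_le_cast.2 hT)
  linarith [Real.log_two_gt_d9]

variable {Ts : ℕ → ℕ} {k : ℕ}

theorem BlockSizes.two_le (hS : BlockSizes Ts k) : 2 ≤ Ts k :=
  (Nat.pow_le_pow_right two_pos hS.k_pos).trans (hS.two_pow_le le_rfl)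

theorem BlockSizes.cast_le_two_mul_log (hS : BlockSizes Ts k) : (k : ℝ) ≤ 2 * Real.log (Ts k) := by
  have hpow : (2 : ℝ) ^ k ≤ Ts k := by exact_mod_cast hS.two_pow_le le_rfl
  have hlog := Real.log_le_log (by positivity) hpow
  rw [Real.log_pow] at hlog
  linarith [mul_le_mul_of_nonneg_left Real.log_two_gt_d9.le (Nat.cast_nonneg (α := ℝ) k),
    Nat.cast_nonneg (α := ℝ) k]

theorem BlockSizes.mul_exp_neg_le (hS : BlockSizes Ts k) (γ : ℝ) :
    (k * (2 * Ts k + 1) : ℕ) * Real.exp (-((γ + 2) * Real.log (Ts k))) ≤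
      3 * (Ts k : ℝ) ^ (-γ) := by
  have hT : (1 : ℝ) ≤ Ts k := Nat.one_le_cast.2 (hS.pos le_rfl)
  have hk : (k : ℝ) ≤ Ts k := Nat.cast_le.2 (Nat.lt_two_pow_self.le.trans (hS.two_pow_le le_rfl))
  have hexp : Real.exp (-((γ + 2) * Real.log (Ts k))) =
      (Ts k : ℝ) ^ (-γ) * ((Ts k : ℝ) ^ 2)⁻¹ := by
    rw [← mul_neg, mul_comm, neg_mul_comm, ← Real.rpow_def_of_pos (by linarith), neg_add,
      Real.rpow_add (by linarith), Real.rpow_neg (by linarith) 2, Real.rpow_two]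
  rw [hexp]
  push_cast
  calc (k : ℝ) * (2 * Ts k + 1) * ((Ts k : ℝ) ^ (-γ) * ((Ts k : ℝ) ^ 2)⁻¹)
      ≤ (Ts k : ℝ) * (2 * Ts k + Ts k) * ((Ts k : ℝ) ^ (-γ) * ((Ts k : ℝ) ^ 2)⁻¹) := by gcongr
    _ = 3 * (Ts k : ℝ) ^ (-γ) := by
        field_simp
        ring

theorem BlockSizes.sum_levels_le (hS : BlockSizes Ts k) {g Z : ℝ} (hg : 1 ≤ 2 * g) (hZ : 0 ≤ Z) :
    Ts 0 * Z + ∑ j ∈ Finset.range k, 2 * (g / √(Ts j : ℝ)) *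
        (if j + 1 < k then Ts (j + 1) * Z else Ts k) ≤
      2 * g * ((Ts k : ℝ) / √(prevSize Ts k : ℝ) +
        Z * ∑ i ∈ Finset.range k, (Ts i : ℝ) / √(prevSize Ts i : ℝ)) := by
  obtain ⟨l, rfl⟩ : ∃ l, k = l + 1 := Nat.exists_eq_succ_of_ne_zero hS.k_pos.ne'
  have hinner : ∑ j ∈ Finset.range l, 2 * (g / √(Ts j : ℝ)) *
      (if j + 1 < l + 1 then Ts (j + 1) * Z else Ts (l + 1)) =
        2 * g * Z * ∑ j ∈ Finset.range l, (Ts (j + 1) : ℝ) / √(prevSize Ts (j + 1) : ℝ) := by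
    rw [Finset.mul_sum]
    refine Finset.sum_congr rfl fun j hj => ?_
    rw [if_pos (Nat.succ_lt_succ (Finset.mem_range.1 hj)), prevSize]
    ring
  rw [Finset.sum_range_succ, Finset.sum_range_succ', hinner, if_neg (lt_irrefl _)]
  simp only [prevSize, Nat.cast_one, Real.sqrt_one, div_one]
  have hzero : Ts 0 * Z ≤ 2 * g * (Ts 0 * Z) := le_mul_of_one_le_left (by positivity) hg
  linear_combination hzero

variable {n m : ℕ} {ℓ : ℕ → Fin n → ℝ} {A : ArrivalRule} {a γ : ℝ} {h : Traj n} {star : Fin n}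

theorem Consistent.log_length_le (hc : Consistent A Ts k m ℓ (Ts k) h) (hm : 0 < m)
    (hS : BlockSizes Ts k) (ha : 0 ≤ a) (hma : (m : ℝ) ≤ (Ts k : ℝ) ^ a) {b i : ℕ} (hb : b < Ts k)
    (hi : i < k) :
    Real.log ((h.1 b).bucket i).length ≤ ((2 * a + 2) * Real.log (Ts k)) ^ 2 := by
  have hlog := one_half_le_log hS.two_le
  set L := Real.log (Ts k)
  have hT : (0 : ℝ) < Ts k := Nat.cast_pos.2 (hS.pos le_rfl)
  have hm' : (0 : ℝ) < m := Nat.cast_pos.2 hm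
  have hpow : ((h.1 b).bucket i).length ≤ m * Ts k ^ k :=
    (hc.length_le hb.le i).trans (Nat.mul_le_mul_left _
      ((Nat.pow_le_pow_left hb _).trans (Nat.pow_le_pow_right (hS.pos le_rfl) hi)))
  have hlogm : Real.log m ≤ a * L :=
    (Real.log_le_log hm' hma).trans_eq (Real.log_rpow hT a)
  have hL : L ≤ 2 * (L * L) := by nlinarith
  calc Real.log ((h.1 b).bucket i).length ≤ Real.log (m * (Ts k : ℝ) ^ k) := by
        rcases Nat.eq_zero_or_pos ((h.1 b).bucket i).length with h0 | h0
        · rw [h0, Nat.cast_zero, Real.log_zero, ← Nat.cast_pow, ← Nat.cast_mul]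
          exact Real.log_natCast_nonneg _
        · exact Real.log_le_log (Nat.cast_pos.2 h0) (by exact_mod_cast hpow)
    _ = Real.log m + k * L := by rw [Real.log_mul hm'.ne' (by positivity), Real.log_pow]
    _ ≤ a * (2 * (L * L)) + 2 * L * L := by
        gcongr
        · exact hlogm.trans (by gcongr)
        · exact hS.cast_le_two_mul_log
    _ = (2 * a + 2) * L ^ 2 := by ring
    _ ≤ (2 * a + 2) ^ 2 * L ^ 2 := by
        gcongr
        exact le_self_pow₀ (by linarith) two_ne_zero
    _ = ((2 * a + 2) * L) ^ 2 := by ring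

theorem regret_eq_sub_cumLoss (hstar : ∑ t ∈ Finset.Icc 1 (Ts k), ℓ t star =
      ⨅ e : Fin n, ∑ t ∈ Finset.Icc 1 (Ts k), ℓ t e) (i : ℕ) :
    regret ℓ (Ts k) (fun u => (h.2 u i).2) =
      ∑ x ∈ Finset.range (Ts k), predictionLoss ℓ h i x - cumLoss ℓ 0 (Ts k) star := by
  have hshift : ∀ f : ℕ → ℝ, ∑ t ∈ Finset.Icc 1 (Ts k), f t =
      ∑ x ∈ Finset.range (Ts k), f (x + 1) := fun f => by
    rw [Finset.range_eq_Ico, Finset.sum_Ico_add' f 0 (Ts k) 1]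
    rfl
  rw [regret, ← hstar, hshift, hshift, cumLoss, Finset.range_eq_Ico]
  rfl

theorem GoodTraj.regret_le_of_log_length_le [NeZero n] {Γ B : ℝ}
    (hg : GoodTraj Ts k m ℓ star Γ h) (hc : Consistent A Ts k m ℓ (Ts k) h) (hS : BlockSizes Ts k)
    (hℓ : ∀ t e, ℓ t e ∈ Set.Icc (0 : ℝ) 1) (hΓ : 0 ≤ Γ) (hB : 0 ≤ B)
    (hlen : ∀ b < Ts k, ∀ i < k, Real.log ((h.1 b).bucket i).length ≤ B ^ 2)
    (hstar : ∑ t ∈ Finset.Icc 1 (Ts k), ℓ t star = ⨅ e : Fin n, ∑ t ∈ Finset.Icc 1 (Ts k), ℓ t e) :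
    regret ℓ (Ts k) (fun u => (h.2 u (k - 1)).2) ≤
      2 * (k * (Real.log (Ts k) / m)) * Ts k + 2 * (3 + Γ + 2 * B) *
        ((Ts k : ℝ) / √(prevSize Ts k : ℝ) +
          (n : ℝ) / m * Γ * ∑ i ∈ Finset.range k, (Ts i : ℝ) / √(prevSize Ts i : ℝ)) := by
  have hone : ∀ f : ℕ → ℝ, (∀ x, f x ≤ 1) → ∑ x ∈ Finset.range (Ts k), f x ≤ Ts k := fun f hf =>
    (Finset.sum_le_sum fun x _ => hf x).trans_eq (by simp)
  have hcum : cumLoss ℓ 0 (Ts k) star ∈ Set.Icc 0 (Ts k : ℝ) := by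
    refine ⟨cumLoss_nonneg (fun t e => (hℓ t e).1) _ _ _, ?_⟩
    rw [cumLoss, ← Finset.range_eq_Ico]
    exact hone _ fun x => (hℓ _ _).2
  have hlevels := hS.sum_levels_le (g := 3 + Γ + 2 * B) (Z := (n : ℝ) / m * Γ) (by linarith)
    (by positivity)
  have hloss := hg.sum_predictionLoss_le hc hS hℓ hΓ hB hlen
  rw [add_assoc] at hloss
  rw [regret_eq_sub_cumLoss hstar]
  exact sub_le_of_le_one_add_pow_mul_add (by positivity)
    (hone (predictionLoss ℓ h (k - 1)) fun x => (hℓ _ _).2) hcum (by positivity)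
    (hloss.trans (add_le_add_right hlevels _))

theorem GoodTraj.regret_le [NeZero n]
    (hg : GoodTraj Ts k m ℓ star ((γ + 2) * Real.log (Ts k)) h)
    (hc : Consistent A Ts k m ℓ (Ts k) h) (hm : 0 < m) (hS : BlockSizes Ts k) (ha : 0 ≤ a)
    (hγ : 0 ≤ γ) (hma : (m : ℝ) ≤ (Ts k : ℝ) ^ a) (hℓ : ∀ t e, ℓ t e ∈ Set.Icc (0 : ℝ) 1)
    (hstar : ∑ t ∈ Finset.Icc 1 (Ts k), ℓ t star = ⨅ e : Fin n, ∑ t ∈ Finset.Icc 1 (Ts k), ℓ t e) :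
    regret ℓ (Ts k) (fun u => (h.2 u (k - 1)).2) ≤
      (4 + 2 * (γ + 4 * a + 12) * (γ + 2)) * Real.log (Ts k : ℝ) ^ 2 * regretBound Ts k n m := by
  have hlog := one_half_le_log hS.two_le
  have hregret := hg.regret_le_of_log_length_le hc hS hℓ (B := (2 * a + 2) * Real.log (Ts k))
    (by positivity) (by positivity) (fun b hb i hi => hc.log_length_le hm hS ha hma hb hi) hstar
  rw [regretBound]
  set L := Real.log (Ts k : ℝ)
  set W := (Ts k : ℝ) / √(prevSize Ts k : ℝ)
  set V := ∑ i ∈ Finset.range k, (Ts i : ℝ) / √(prevSize Ts i : ℝ)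
  have : 0 ≤ V := Finset.sum_nonneg fun i _ => by positivity
  have hΓ : 1 ≤ (γ + 2) * L := by nlinarith
  calc _ ≤ 2 * (k * (L / m)) * Ts k +
        2 * (3 + (γ + 2) * L + 2 * ((2 * a + 2) * L)) *
          (W + (n : ℝ) / m * ((γ + 2) * L) * V) := hregret
    _ ≤ 2 * (2 * L * (L / m)) * Ts k + 2 * ((γ + 4 * a + 12) * L) *
          ((γ + 2) * L * W + (n : ℝ) / m * ((γ + 2) * L) * V) := by
        gcongr
        · exact hS.cast_le_two_mul_log
        · linarith
        · exact le_mul_of_one_le_left (by positivity) hΓ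
    _ = 4 * L ^ 2 * (Ts k / m) +
          2 * (γ + 4 * a + 12) * (γ + 2) * L ^ 2 * (W + (n : ℝ) / m * V) := by ring
    _ ≤ 4 * L ^ 2 * (Ts k / m + (W + (n : ℝ) / m * V)) +
          2 * (γ + 4 * a + 12) * (γ + 2) * L ^ 2 * (Ts k / m + (W + (n : ℝ) / m * V)) := by
        have hbase : 0 ≤ (Ts k / m : ℝ) := by positivity
        have hrest : 0 ≤ W + (n : ℝ) / m * V := by positivity
        refine add_le_add (mul_le_mul_of_nonneg_left ?_ (by positivity))
          (mul_le_mul_of_nonneg_left ?_ (by positivity)) <;> linarith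
    _ = _ := by ring

theorem le_toOuterMeasure_goodTraj [NeZero n] (A : ArrivalRule) (hm : 0 < m)
    (hS : BlockSizes Ts k) (hℓ : ∀ t e, ℓ t e ∈ Set.Icc (0 : ℝ) 1) (star : Fin n) (hγ : 0 ≤ γ) :
    ENNReal.ofReal (1 - 3 * (Ts k : ℝ) ^ (-γ)) ≤ (runTraj A Ts k m ℓ (Ts k)).toOuterMeasure
      {h | GoodTraj Ts k m ℓ star ((γ + 2) * Real.log (Ts k)) h} := by
  have hbad := toOuterMeasure_not_goodTraj_le A hm hS hℓ star
    (Γ := (γ + 2) * Real.log (Ts k)) (by positivity)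
  rw [← ENNReal.ofReal_natCast, ← ENNReal.ofReal_mul (Nat.cast_nonneg _)] at hbad
  rw [ENNReal.ofReal_sub _ (by positivity), ENNReal.ofReal_one, tsub_le_iff_right,
    ← toOuterMeasure_add_compl (runTraj A Ts k m ℓ (Ts k))]
  gcongr
  exact hbad.trans (ENNReal.ofReal_le_ofReal (hS.mul_exp_neg_le γ))

end Regret

end

end HierBaseline

open HierBaseline in
theorem mainTheorem2 (γ a : ℝ) (hγ : 0 < γ) (ha : 0 < a) :
    ∃ C K : ℝ, ∃ c : ℕ, 0 < C ∧ 0 < K ∧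
      ∀ (n : ℕ) [NeZero n] (m k : ℕ) (Ts : ℕ → ℕ),
        0 < m → 0 < k → 0 < Ts 0 →
        (∀ i < k, Ts i < Ts (i + 1)) →
        (∀ i < k, Ts i ∣ Ts (i + 1)) →
        (m : ℝ) ≤ (Ts k : ℝ) ^ a →
        ∀ (A : HierBaseline.ArrivalRule) (ℓ : ℕ → Fin n → ℝ),
          (∀ t e, ℓ t e ∈ Set.Icc (0 : ℝ) 1) →
          ENNReal.ofReal (1 - K * (Ts k : ℝ) ^ (-γ)) ≤
            (HierBaseline.hierarchicalBaseline A Ts k m ℓ).toOuterMeasure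
              {p | HierBaseline.regret ℓ (Ts k) p ≤
                C * Real.log (Ts k : ℝ) ^ c * HierBaseline.regretBound Ts k n m} := by
  refine ⟨4 + 2 * (γ + 4 * a + 12) * (γ + 2), 3, 2, by positivity, by norm_num, ?_⟩
  intro n _ m k Ts hm hk h0 hlt hdvd hma A ℓ hℓ
  have hS : BlockSizes Ts k := ⟨hk, h0, hlt, hdvd⟩
  obtain ⟨star, hstar⟩ :=
    exists_eq_ciInf_of_finite (f := fun e : Fin n => ∑ t ∈ Finset.Icc 1 (Ts k), ℓ t e)
  rw [hierarchicalBaseline_eq_map_runTraj, PMF.toOuterMeasure_map_apply]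
  refine (le_toOuterMeasure_goodTraj A hm hS hℓ star hγ.le).trans (PMF.toOuterMeasure_mono _ ?_)
  rintro h ⟨hgood, hsupp⟩
  exact hgood.regret_le (consistent_of_mem_support A Ts k m ℓ (Ts k) h hsupp) hm hS ha.le hγ.le hma
    hℓ hstar
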